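/- **Model.** A central system holds $N$ qubits $c_1,\dots,c_N$, and qubit $c_k$ shares the Bell state $|\Phi\rangle=(|00\rangle+|11\rangle)/\sqrt2$ with the qubit $e_k$ of the $k$-th of $N$ end nodes. A *one-way LOCC protocol in the central hub* consists of a unitary $U$ on the $N$ central qubits, followed by a measurement of them in the computational basis with outcome $s\in\{0,1\}^N$; positive integers $\alpha_1(s),\dots,\alpha_N(s)$, of which $\alpha_k(s)$ is sent to the end node $k$; and single-qubit unitaries $R^{k,a}$, of which the end node $k$ applies $R^{k,\alpha_k(s)}$. It *distributes* an $N$-qubit state $\rho$ (deterministically and exactly) if, started on $|\Phi\rangle^{\otimes N}$, the final state of the end nodes (averaged over the outcomes $s$, with the central system traced out) equals $\rho$. Its *classical communication cost*, in bits, is $\log_2\prod_{k=1}^N\max_s\alpha_k(s)$. Let $|W_N\rangle=\frac1{\sqrt N}\sum_{k=1}^N X_k|0\rangle^{\otimes N}$, where $X_k$ is the Pauli matrix $X$ acting on qubit $k$. **Proposition.** Let $N\ge 2$. (i) There is a one-way LOCC protocol in the central hub that distributes $|W_N\rangle\langle W_N|$ from $N$ preshared Bell states, with classical communication cost exactly $2N-2$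 bits. Explicitly, one can take $$U=U_N=\frac1{\sqrt N}\sum_{r=1}^N Z^{\otimes(r-1)}\otimes X\otimes I^{\otimes(N-r)}$$ (which is unitary), the recovery operation $X^{s_1}Z^{s_1}$ at the first end node, $X^{s_2}$ at the second, and $Z^{\kappa_k}X^{s_k}$ with $\kappa_k=\left(\sum_{l=2}^{k-1}s_l\right)\bmod 2$ at the $k$-th end node for $3\le k\le N$, and the messages that encode $s_1$, $s_2$ and $(\kappa_k,s_k)$, namely $\alpha_k(s)=1+s_k$ for $k\le2$ and $\alpha_k(s)=1+s_k+2\kappa_k$ for $k\ge3$. Every outcome $s$ has probability $2^{-N}$ and leaves the end nodes in the state $|W_N\rangle$. (ii) This cost is optimal: every one-way LOCC protocol in the central hub that distributes $|W_N\rangle\langle W_N|$, whatever its unitary, messages and local recovery unitaries, has classical communication cost at least $2N-2$ bits. -/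

import Mathlib

open scoped Matrix Kronecker

noncomputable section

namespace CentralHub

/-- Computational-basis labels `s = s_1 ⋯ s_N` of an `N`-qubit system. Qubit `k` of the usual
numbering `1, …, N` has index `k - 1 : Fin N`. -/
abbrev Bits (N : ℕ) : Type := Fin N → Fin 2

/-- The Pauli matrix `X`. -/
def pauliX : Matrix (Fin 2) (Fin 2) ℂ := !![0, 1; 1, 0]

/-- The Pauli matrix `Z`. -/
def pauliZ : Matrix (Fin 2) (Fin 2) ℂ := !![1, 0; 0, -1]

/-- The tensor product `A_1 ⊗ ⋯ ⊗ A_N` of one-qubit operators. -/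
def tensor {N : ℕ} (A : Fin N → Matrix (Fin 2) (Fin 2) ℂ) : Matrix (Bits N) (Bits N) ℂ :=
  Matrix.of fun x y => ∏ k, A k (x k) (y k)

/-- The basis vector `|s⟩`. -/
def ket {N : ℕ} (s : Bits N) : Bits N → ℂ := Pi.single s 1

/-- The density matrix `|ψ⟩⟨ψ|`. -/
def pure {ι : Type} (ψ : ι → ℂ) : Matrix ι ι ℂ := Matrix.vecMulVec ψ (star ψ)

/-- The `N`-qubit W state `(1/√N) ∑_k X_k |0⟩^{⊗N}`, with `X_k` acting on the `k`-th qubit. -/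
def wState (N : ℕ) : Bits N → ℂ :=
  (((√(N : ℝ) : ℝ) : ℂ)⁻¹) •
    ∑ k : Fin N, tensor (fun j => if j = k then pauliX else 1) *ᵥ ket 0

/-- The Bell state `(|00⟩ + |11⟩)/√2` of one central qubit and one end qubit. -/
def bell (c e : Fin 2) : ℂ := if c = e then (((√(2 : ℝ) : ℝ) : ℂ)⁻¹) else 0

/-- The `N` preshared Bell states `⨂_k |Φ⟩_{c_k e_k}`, as a vector of the joint system
(central system, end system). -/
def bellPairs (N : ℕ) : Bits N × Bits N → ℂ := fun p => ∏ k, bell (p.1 k) (p.2 k)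

/-- The partial trace over the central system. -/
def traceCentral {N : ℕ} (ρ : Matrix (Bits N × Bits N) (Bits N × Bits N) ℂ) :
    Matrix (Bits N) (Bits N) ℂ :=
  Matrix.of fun x y => ∑ c : Bits N, ρ (c, x) (c, y)

/-- A one-way LOCC protocol in a central hub with `N` end nodes: the central system applies a
unitary `U` and measures in the computational basis; on outcome `s` it sends the positive integer
`msg k s` to the end node `k`, which then applies the local unitary `recovery k (msg k s)`. -/
structure Protocol (N : ℕ) where
  /-- the unitary applied to the central system before the measurement -/
  U : Matrix.unitaryGroup (Bits N) ℂ
  /-- the message `α_k(s)` for the end node `k` on outcome `s` -/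
  msg : Fin N → Bits N → ℕ+
  /-- the local unitary that the end node `k` applies on receiving a given message -/
  recovery : Fin N → ℕ+ → Matrix.unitaryGroup (Fin 2) ℂ

namespace Protocol

variable {N : ℕ} (P : Protocol N)

/-- The operator `(|s⟩⟨s| U) ⊗ (R^{1,α_1(s)} ⊗ ⋯ ⊗ R^{N,α_N(s)})` applied on outcome `s`. -/
def kraus (s : Bits N) : Matrix (Bits N × Bits N) (Bits N × Bits N) ℂ :=
  (pure (ket s) * (P.U : Matrix (Bits N) (Bits N) ℂ)) ⊗ₖ
    tensor fun k => (P.recovery k (P.msg k s) : Matrix (Fin 2) (Fin 2) ℂ)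

/-- The unnormalised final state of the end system on outcome `s`, starting from the `N` preshared
Bell states; its trace is the probability of the outcome. -/
def branch (s : Bits N) : Matrix (Bits N) (Bits N) ℂ :=
  traceCentral (P.kraus s * pure (bellPairs N) * (P.kraus s)ᴴ)

/-- The final state of the end system. -/
def output : Matrix (Bits N) (Bits N) ℂ := ∑ s, P.branch s

/-- The protocol distributes the state with density matrix `ρ` deterministically and exactly. -/
def Distributes (ρ : Matrix (Bits N) (Bits N) ℂ) : Prop := P.output = ρ

/-- The number of classical bits sent to the end nodes: `log₂ ∏_k max_s α_k(s)`. -/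
def cost : ℝ :=
  Real.logb 2 ((∏ k, Finset.univ.sup fun s => (P.msg k s : ℕ) : ℕ) : ℝ)

end Protocol

/-- `U_N = (1/√N) ∑_r Z^{⊗(r-1)} ⊗ X ⊗ I^{⊗(N-r)}`. -/
def wUnitary (N : ℕ) : Matrix (Bits N) (Bits N) ℂ :=
  (((√(N : ℝ) : ℝ) : ℂ)⁻¹) •
    ∑ r : Fin N, tensor fun j => if j < r then pauliZ else if j = r then pauliX else 1

/-- `κ_k = (s_2 + ⋯ + s_{k-1}) mod 2`, in the numbering `1, …, N` of the qubits. -/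
def kappa {N : ℕ} (k : Fin N) (s : Bits N) : ℕ :=
  (∑ l ∈ Finset.univ.filter (fun l : Fin N => 1 ≤ (l : ℕ) ∧ l < k), (s l : ℕ)) % 2

/-- The Pauli correction of an end node on outcome `s`: `X^{s_1} Z^{s_1}` for the first node,
`X^{s_2}` for the second node, and `Z^{κ_k} X^{s_k}` for the `k`-th node with `k ≥ 3`. -/
def wCorrection {N : ℕ} (k : Fin N) (s : Bits N) : Matrix (Fin 2) (Fin 2) ℂ :=
  if (k : ℕ) = 0 then pauliX ^ (s k : ℕ) * pauliZ ^ (s k : ℕ)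
  else if (k : ℕ) = 1 then pauliX ^ (s k : ℕ)
  else pauliZ ^ kappa k s * pauliX ^ (s k : ℕ)

/-- The message of an end node on outcome `s`: the bit `s_k` for the first two nodes, encoded as
`1 + s_k`, and the two bits `κ_k, s_k` for the others, encoded as `1 + s_k + 2 κ_k`. -/
def wMessage {N : ℕ} (k : Fin N) (s : Bits N) : ℕ+ :=
  if (k : ℕ) ≤ 1 then Nat.succPNat (s k : ℕ) else Nat.succPNat ((s k : ℕ) + 2 * kappa k s)

end CentralHub

end

namespace CentralHub

/-! Upper bound. The summands of $U_N$ are the Jordan–Wigner operators: Hermitian, of square one,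
pairwise anticommuting, so their normalised sum is unitary. Row $s$ of $U_N$ is a superposition of
product vectors, and the Pauli corrections turn its $r$-th summand into $X_r|0\rangle$ with a sign;
$\kappa_r$ is chosen so that all these signs are $+1$.

Lower bound. On outcome $s$ the end nodes hold row $s$ of $U$ with the recoveries applied. A mixture
of pure states that is pure has proportional components, so this vector is a phase times $W_N$.
Since the rows form an orthonormal basis, $\sum_s\langle
W_N|R_sHR_s^\dagger|W_N\rangle=\operatorname{tr}H$ for every product operator $H$ (`sum_sandwich`),
where $R_s$ is the product of the recoveries. Everything except a count of outcomes for $N=2$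
follows from this identity.

Consider a node with at most three messages. Three unit quaternions have a common orthogonal one, so
in a suitable frame of the qubit the recoveries are, up to phases, half-turns about real unit axes
$u_a$ (`exists_axes`). With one or two Pauli factors in $H$, the identity fixes second moments of
the axes of one node and joint moments for two nodes (`AxisPair`). Among three such nodes none is
degenerate: all three messages occur and the axes are independent (`planeDet_ne_zero`,
`pos_and_det`).

Five such nodes cannot exist (`not_five`). If some but not all have an axis along $z$, a pair of
them is contradictory (`not_polar_mixed`). If all do, the events "the axis is not along $z$" have
probability $1/2$ and are pairwise independent, yet at most two occur together; a second moment over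
four nodes forbids this (`not_four_polar`). If none does, five-body correlators (`pentagon`) force a
node with $u_z^2=1/2$ for all its axes, and such a node excludes every other one (`not_centered`).

For $N\ge3$ each node has at least two messages, at most four nodes have fewer than four, and if
there are three or four of these then each has three. As $4^4\le4\cdot3^4$, the product of the
message numbers is at least $4^{N-1}$. -/

/-! ### Product operators and the state of the end nodes on each outcome -/

theorem tensor_mul {N : ℕ} (A B : Fin N → Matrix (Fin 2) (Fin 2) ℂ) :
    tensor A * tensor B = tensor fun k => A k * B k := by
  ext x y
  simp only [tensor, Matrix.mul_apply, Matrix.of_apply, ← Finset.prod_mul_distrib]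
  rw [Finset.prod_univ_sum, Fintype.piFinset_univ]

theorem tensor_conjTranspose {N : ℕ} (A : Fin N → Matrix (Fin 2) (Fin 2) ℂ) :
    (tensor A)ᴴ = tensor fun k => (A k)ᴴ := by
  ext x y
  simp [tensor, Matrix.conjTranspose_apply]

theorem tensor_one (N : ℕ) : tensor (fun _ : Fin N => (1 : Matrix (Fin 2) (Fin 2) ℂ)) = 1 := by
  ext x y
  simp only [tensor, Matrix.of_apply, Matrix.one_apply, Finset.prod_ite_zero, Finset.mem_univ,
    forall_true_left, Finset.prod_const_one]
  simp only [funext_iff]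

theorem tensor_trace {N : ℕ} (A : Fin N → Matrix (Fin 2) (Fin 2) ℂ) :
    (tensor A).trace = ∏ k, (A k).trace := by
  simp only [tensor, Matrix.trace, Matrix.diag_apply, Matrix.of_apply]
  rw [Finset.prod_univ_sum, Fintype.piFinset_univ]

theorem tensor_smul {N : ℕ} (c : Fin N → ℂ) (A : Fin N → Matrix (Fin 2) (Fin 2) ℂ) :
    tensor (fun k => c k • A k) = (∏ k, c k) • tensor A := by
  ext x y
  simp [tensor, Finset.prod_mul_distrib]

theorem mul_pure_mul {ι κ : Type} [Fintype ι] (K : Matrix κ ι ℂ) (v : ι → ℂ) :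
    K * pure v * Kᴴ = pure (K *ᵥ v) := by
  rw [pure, Matrix.mul_vecMulVec, Matrix.vecMulVec_mul, pure, Matrix.star_mulVec]

/-- The unnormalised amplitude of the end nodes' state on outcome `s`. -/
noncomputable def endState {N : ℕ} (P : Protocol N) (s : Bits N) : Bits N → ℂ :=
  tensor (fun k => (P.recovery k (P.msg k s) : Matrix (Fin 2) (Fin 2) ℂ)) *ᵥ
    (P.U : Matrix (Bits N) (Bits N) ℂ) s

theorem bellPairs_apply {N : ℕ} (p : Bits N × Bits N) :
    bellPairs N p = if p.1 = p.2 then (((√(2 : ℝ) : ℝ) : ℂ)⁻¹) ^ N else 0 := by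
  simp only [bellPairs, bell, Finset.prod_ite_zero, Finset.mem_univ, forall_true_left,
    Finset.prod_const, Finset.card_univ, Fintype.card_fin]
  simp only [funext_iff]

/-- Maximal entanglement transfers the measured functional to the end nodes: projecting the central
system on row `s` of `U` leaves that row, not its conjugate, as the amplitude vector there. -/
theorem kraus_mulVec {N : ℕ} (P : Protocol N) (s : Bits N) (c x : Bits N) :
    (P.kraus s *ᵥ bellPairs N) (c, x) =
      if c = s then (((√(2 : ℝ) : ℝ) : ℂ)⁻¹) ^ N * endState P s x else 0 := by
  have h1 : ∀ d, (pure (ket s) * (P.U : Matrix (Bits N) (Bits N) ℂ)) c d =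
      if c = s then (P.U : Matrix (Bits N) (Bits N) ℂ) s d else 0 := by
    intro d
    simp only [pure, Matrix.vecMulVec_mul, Matrix.vecMulVec_apply, ket]
    by_cases h : c = s
    · subst h
      simp [Matrix.vecMul, dotProduct, Pi.single_apply]
    · simp [h]
  simp only [Matrix.mulVec, dotProduct, Fintype.sum_prod_type, bellPairs_apply, Protocol.kraus,
    Matrix.kroneckerMap_apply, h1, mul_ite, mul_zero, Finset.sum_ite_eq, Finset.mem_univ, if_true]
  by_cases h : c = s
  · simp only [h, if_true, endState, Matrix.mulVec, dotProduct, Finset.mul_sum]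
    refine Finset.sum_congr rfl fun d _ => ?_
    ring
  · simp [h]

theorem branch_eq {N : ℕ} (P : Protocol N) (s : Bits N) :
    P.branch s = ((1 / 2 ^ N : ℝ) : ℂ) • pure (endState P s) := by
  rw [Protocol.branch, mul_pure_mul]
  ext x y
  have h2 : (((√(2 : ℝ) : ℝ) : ℂ)⁻¹) ^ N * (((√(2 : ℝ) : ℝ) : ℂ)⁻¹) ^ N = ((1 / 2 ^ N : ℝ) : ℂ) := by
    rw [← mul_pow, ← mul_inv, ← Complex.ofReal_mul, Real.mul_self_sqrt (by norm_num)]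
    push_cast
    simp
  simp only [traceCentral, Matrix.of_apply, pure, Matrix.vecMulVec_apply, Pi.star_apply,
    kraus_mulVec, Matrix.smul_apply, smul_eq_mul]
  rw [Finset.sum_eq_single s (fun c _ hc => by simp [hc]) (by simp)]
  simp only [if_true, star_mul', star_pow, star_inv₀]
  rw [← h2]
  simp only [RCLike.star_def, Complex.conj_ofReal]
  ring

theorem recovery_tensor_unitary {N : ℕ} (P : Protocol N) (s : Bits N) :
    (tensor fun k => (P.recovery k (P.msg k s) : Matrix (Fin 2) (Fin 2) ℂ))ᴴ *
      (tensor fun k => (P.recovery k (P.msg k s) : Matrix (Fin 2) (Fin 2) ℂ)) = 1 := by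
  rw [tensor_conjTranspose, tensor_mul, ← tensor_one]
  congr 1
  funext k
  exact Matrix.mem_unitaryGroup_iff'.1 (P.recovery k (P.msg k s)).2

theorem endState_norm {N : ℕ} (P : Protocol N) (s : Bits N) :
    star (endState P s) ⬝ᵥ endState P s = 1 := by
  rw [endState, Matrix.star_mulVec, ← Matrix.dotProduct_mulVec, Matrix.mulVec_mulVec,
    recovery_tensor_unitary, Matrix.one_mulVec]
  have := congrFun (congrFun (Matrix.mem_unitaryGroup_iff.1 P.U.2) s) s
  rw [Matrix.mul_apply, Matrix.one_apply_eq] at this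
  rw [← this, dotProduct]
  refine Finset.sum_congr rfl fun d _ => ?_
  rw [Matrix.star_apply, Pi.star_apply, mul_comm]

open scoped ComplexOrder in
/-- If a pure state is a mixture of pure states, then all of these are multiples of it. -/
theorem eq_smul_of_sum_pure {ι κ : Type} [Fintype ι] [Fintype κ] (r : ℝ) (hr : 0 < r)
    (φ : κ → ι → ℂ) (w : ι → ℂ) (hw : star w ⬝ᵥ w = 1)
    (h : ∑ s, (r : ℂ) • pure (φ s) = pure w) (s : κ) : φ s = (star w ⬝ᵥ φ s) • w := by
  -- `v` is the part of `φ s` orthogonal to `w`. The mixture has expectation zero in `v`, and the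
  -- expectation is a sum of nonnegative terms, so each `φ t`, and `φ s` in particular, is
  -- orthogonal to `v`.
  set v : ι → ℂ := φ s - (star w ⬝ᵥ φ s) • w with hv
  have hwv : star w ⬝ᵥ v = 0 := by
    rw [hv, dotProduct_sub, dotProduct_smul, hw]; simp
  have hq : ∀ u : ι → ℂ, star v ⬝ᵥ (pure u *ᵥ v) = ((‖star u ⬝ᵥ v‖ ^ 2 : ℝ) : ℂ) := by
    intro u
    have h1 : star v ⬝ᵥ u = star (star u ⬝ᵥ v) := by
      rw [← Matrix.star_dotProduct_star, star_star]
    rw [pure, Matrix.vecMulVec_mulVec, dotProduct_smul, h1, op_smul_eq_smul,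
      smul_eq_mul, RCLike.star_def, Complex.mul_conj, Complex.normSq_eq_norm_sq]
  have h2 := congrArg (fun M => star v ⬝ᵥ (M *ᵥ v)) h
  simp only [Matrix.sum_mulVec, dotProduct_sum, Matrix.smul_mulVec, dotProduct_smul, hq, hwv,
    smul_eq_mul, norm_zero] at h2
  have h3 : ∑ t, r * ‖star (φ t) ⬝ᵥ v‖ ^ 2 = 0 := by
    have : ((∑ t, r * ‖star (φ t) ⬝ᵥ v‖ ^ 2 : ℝ) : ℂ) = 0 := by
      push_cast
      push_cast at h2
      rw [h2]; simp
    exact_mod_cast this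
  rw [Finset.sum_eq_zero_iff_of_nonneg (fun t _ => by positivity)] at h3
  have h4 := h3 s (Finset.mem_univ s)
  have h5 : star (φ s) ⬝ᵥ v = 0 := by
    rcases mul_eq_zero.1 h4 with h | h
    · exact absurd h hr.ne'
    · exact norm_eq_zero.1 (pow_eq_zero_iff (two_ne_zero) |>.1 h)
  have h6 : star v ⬝ᵥ v = 0 := by
    conv_lhs => rw [hv]
    rw [star_sub, sub_dotProduct, ← hv, h5, star_smul, smul_dotProduct, hwv]; simp
  have h7 : v = 0 := dotProduct_star_self_eq_zero.1 h6
  exact sub_eq_zero.1 h7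

/-! ### Expectation values of product operators in the W state -/

/-- The factors of the `i`-th term of the W state. -/
noncomputable def flip {N : ℕ} (i j : Fin N) : Matrix (Fin 2) (Fin 2) ℂ :=
  if j = i then pauliX else 1

/-- The `k`-th bit of the basis label with a single `1`, in position `i`. -/
def spike {N : ℕ} (i k : Fin N) : Fin 2 := if k = i then 1 else 0

theorem wState_sandwich {N : ℕ} (A : Fin N → Matrix (Fin 2) (Fin 2) ℂ) :
    star (wState N) ⬝ᵥ (tensor A *ᵥ wState N) =
      (N : ℂ)⁻¹ * ∑ i, ∑ j, ∏ k, A k (spike i k) (spike j k) := by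
  have hN : (((√(N : ℝ) : ℝ) : ℂ)⁻¹) * (((√(N : ℝ) : ℝ) : ℂ)⁻¹) = (N : ℂ)⁻¹ := by
    rw [← mul_inv, ← Complex.ofReal_mul, Real.mul_self_sqrt (by positivity)]
    simp
  have hterm : ∀ i j : Fin N,
      star (tensor (flip i) *ᵥ ket 0) ⬝ᵥ (tensor A *ᵥ (tensor (flip j) *ᵥ ket 0)) =
        ∏ k, A k (spike i k) (spike j k) := by
    intro i j
    rw [Matrix.star_mulVec, ← Matrix.dotProduct_mulVec, Matrix.mulVec_mulVec, Matrix.mulVec_mulVec,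
      tensor_conjTranspose, tensor_mul, tensor_mul]
    have : ∀ M : Matrix (Bits N) (Bits N) ℂ, star (ket 0) ⬝ᵥ (M *ᵥ ket 0) = M 0 0 := by
      intro M
      rw [ket, Pi.star_single]
      simp
    rw [this]
    simp only [tensor, Matrix.of_apply]
    refine Finset.prod_congr rfl fun k _ => ?_
    by_cases h1 : k = i <;> by_cases h2 : k = j <;>
      simp [flip, spike, h1, h2, pauliX, Matrix.mul_apply, Fin.sum_univ_two]
    all_goals (try subst h1; try simp [h2])
    all_goals (try subst h2; try simp [h1])
  have hw : wState N = (((√(N : ℝ) : ℝ) : ℂ)⁻¹) • ∑ i : Fin N, tensor (flip i) *ᵥ ket 0 := rfl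
  rw [hw, Matrix.mulVec_smul, star_smul, smul_dotProduct, dotProduct_smul, smul_smul,
    Matrix.mulVec_sum, star_sum, sum_dotProduct]
  simp only [dotProduct_sum, hterm, smul_eq_mul, star_inv₀, RCLike.star_def, Complex.conj_ofReal, hN]

theorem wState_norm {N : ℕ} (hN : 0 < N) : star (wState N) ⬝ᵥ wState N = 1 := by
  have := wState_sandwich (fun _ : Fin N => (1 : Matrix (Fin 2) (Fin 2) ℂ))
  rw [tensor_one, Matrix.one_mulVec] at this
  rw [this]
  have h : ∀ i j : Fin N, ∏ k, (1 : Matrix (Fin 2) (Fin 2) ℂ) (spike i k) (spike j k) =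
      if i = j then 1 else 0 := by
    intro i j
    split_ifs with hij
    · subst hij; simp
    · refine Finset.prod_eq_zero (Finset.mem_univ i) ?_
      simp [spike, hij]
  simp only [h]
  have : (N : ℂ) ≠ 0 := by exact_mod_cast hN.ne'
  simp [this]

theorem endState_eq {N : ℕ} (hN : 0 < N) (P : Protocol N)
    (hP : P.Distributes (pure (wState N))) (s : Bits N) :
    endState P s = (star (wState N) ⬝ᵥ endState P s) • wState N := by
  refine eq_smul_of_sum_pure (1 / 2 ^ N) (by positivity) (endState P) (wState N) (wState_norm hN) ?_ s
  rw [← hP, Protocol.output]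
  exact Finset.sum_congr rfl fun s _ => (branch_eq P s).symm

theorem exists_phase {N : ℕ} (hN : 0 < N) (P : Protocol N)
    (hP : P.Distributes (pure (wState N))) (s : Bits N) :
    ∃ c : ℂ, star c * c = 1 ∧ endState P s = c • wState N := by
  refine ⟨star (wState N) ⬝ᵥ endState P s, ?_, endState_eq hN P hP s⟩
  have h := endState_norm P s
  rw [endState_eq hN P hP s, star_smul, smul_dotProduct, dotProduct_smul, wState_norm hN] at h
  simpa using h

/-- Completeness of the vectors that the recoveries take to the W state. -/
theorem sum_sandwich {N : ℕ} (hN : 0 < N) (P : Protocol N)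
    (hP : P.Distributes (pure (wState N))) (H : Fin N → Matrix (Fin 2) (Fin 2) ℂ) :
    ∑ s : Bits N, ∑ i, ∑ j, ∏ k,
      ((P.recovery k (P.msg k s) : Matrix (Fin 2) (Fin 2) ℂ) * H k *
        (P.recovery k (P.msg k s) : Matrix (Fin 2) (Fin 2) ℂ)ᴴ) (spike i k) (spike j k) =
      N * ∏ k, (H k).trace := by
  have hN0 : (N : ℂ) ≠ 0 := by exact_mod_cast hN.ne'
  have key : ∀ s : Bits N, ∑ i, ∑ j, ∏ k,
      ((P.recovery k (P.msg k s) : Matrix (Fin 2) (Fin 2) ℂ) * H k *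
        (P.recovery k (P.msg k s) : Matrix (Fin 2) (Fin 2) ℂ)ᴴ) (spike i k) (spike j k) =
      N * (star ((P.U : Matrix (Bits N) (Bits N) ℂ) s) ⬝ᵥ
        (tensor H *ᵥ (P.U : Matrix (Bits N) (Bits N) ℂ) s)) := by
    intro s
    obtain ⟨c, hc, hs⟩ := exists_phase hN P hP s
    set T := tensor fun k => (P.recovery k (P.msg k s) : Matrix (Fin 2) (Fin 2) ℂ) with hT
    have h1 : Tᴴ *ᵥ endState P s = (P.U : Matrix (Bits N) (Bits N) ℂ) s := by
      rw [endState, ← hT, Matrix.mulVec_mulVec, recovery_tensor_unitary, Matrix.one_mulVec]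
    have h2 := wState_sandwich (fun k => (P.recovery k (P.msg k s) : Matrix (Fin 2) (Fin 2) ℂ) * H k *
        (P.recovery k (P.msg k s) : Matrix (Fin 2) (Fin 2) ℂ)ᴴ)
    rw [eq_inv_mul_iff_mul_eq₀ hN0] at h2
    rw [← h2, ← tensor_mul, ← tensor_mul, ← tensor_conjTranspose, ← hT, ← h1, hs,
      Matrix.mulVec_smul, Matrix.mulVec_smul, star_smul, smul_dotProduct, dotProduct_smul, smul_smul,
      hc, one_smul, Matrix.star_mulVec, Matrix.conjTranspose_conjTranspose, ← Matrix.mulVec_mulVec,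
      ← Matrix.mulVec_mulVec, Matrix.dotProduct_mulVec]
  simp only [key, ← Finset.mul_sum]
  congr 1
  rw [← tensor_trace]
  have hU : ((P.U : Matrix (Bits N) (Bits N) ℂ)ᴴ) * (P.U : Matrix (Bits N) (Bits N) ℂ) = 1 :=
    Matrix.mem_unitaryGroup_iff'.1 P.U.2
  -- The amplitude vectors are rows of `U`, that is, columns of its transpose; hence the conjugation
  -- with `Uᵀ`.
  have h3 : (tensor H).trace =
      ((P.U : Matrix (Bits N) (Bits N) ℂ)ᵀᴴ * (tensor H * (P.U : Matrix (Bits N) (Bits N) ℂ)ᵀ)).trace := by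
    have hU' : ((P.U : Matrix (Bits N) (Bits N) ℂ)ᵀ) * (P.U : Matrix (Bits N) (Bits N) ℂ)ᵀᴴ = 1 := by
      have := congrArg Matrix.transpose hU
      rw [Matrix.transpose_mul, Matrix.transpose_one] at this
      exact this
    rw [← Matrix.mul_assoc, Matrix.trace_mul_comm, ← Matrix.mul_assoc, hU', Matrix.one_mul]
  rw [h3, Matrix.trace]
  refine Finset.sum_congr rfl fun s _ => ?_
  rw [Matrix.diag_apply, Matrix.mul_apply]
  rfl

theorem spike_injective_comp {N m : ℕ} {g : Fin m → Fin N} (hg : g.Injective) (t t' : Fin m) :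
    spike (g t) (g t') = spike t t' := by
  simp [spike, hg.eq_iff]

theorem extend_entry_prod {N m : ℕ} {g : Fin m → Fin N} (hg : g.Injective)
    (A : Fin m → Matrix (Fin 2) (Fin 2) ℂ) (i j : Fin N) :
    ∏ k, (Function.extend g A 1) k (spike i k) (spike j k) =
      (∏ t, A t (spike i (g t)) (spike j (g t))) *
        if ∀ k, k ∉ Set.range g → spike i k = spike j k then 1 else 0 := by
  classical
  rw [← Finset.prod_mul_prod_compl (Finset.univ.image g),
    Finset.prod_image (fun a _ b _ h => hg h)]
  congr 1
  · exact Finset.prod_congr rfl fun t _ => by rw [hg.extend_apply]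
  · rw [Finset.prod_congr rfl (g := fun k => if spike i k = spike j k then (1 : ℂ) else 0),
      Finset.prod_ite_zero]
    · simp
    · intro k hk
      rw [Function.extend_apply' _ _ _ (by simpa using hk)]
      simp [Matrix.one_apply]

/-- Operators on `m` of the `N` qubits: the terms of the W state with the excitation outside of
these qubits contribute alike. -/
theorem sum_extend_entry_prod {N m : ℕ} {g : Fin m → Fin N} (hg : g.Injective)
    (A : Fin m → Matrix (Fin 2) (Fin 2) ℂ) :
    ∑ i, ∑ j, ∏ k, (Function.extend g A 1) k (spike i k) (spike j k) =
      ((N : ℂ) - m) * ∏ t, A t 0 0 + ∑ t, ∑ t', ∏ r, A r (spike t r) (spike t' r) := by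
  classical
  have hin : ∀ t j, j ∉ Set.range g → ∏ k, (Function.extend g A 1) k (spike (g t) k) (spike j k) = 0 := by
    intro t j hj
    rw [extend_entry_prod hg, if_neg, mul_zero]
    intro h
    have := h j hj
    have h2 : j ≠ g t := fun e => hj ⟨t, e.symm⟩
    simp [spike, h2] at this
  have hout : ∀ i j, i ∉ Set.range g → ∏ k, (Function.extend g A 1) k (spike i k) (spike j k) =
      if j = i then ∏ t, A t 0 0 else 0 := by
    intro i j hi
    rw [extend_entry_prod hg]
    split_ifs with h1 h2 h2
    · subst h2
      rw [mul_one]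
      refine Finset.prod_congr rfl fun t _ => ?_
      have : g t ≠ j := fun e => hi ⟨t, e⟩
      simp [spike, this]
    · have := h1 i hi
      have h3 : i ≠ j := fun e => h2 e.symm
      simp [spike, h3] at this
    · subst h2; exact absurd (fun _ _ => rfl) h1
    · simp
  have hboth : ∀ t t', ∏ k, (Function.extend g A 1) k (spike (g t) k) (spike (g t') k) =
      ∏ r, A r (spike t r) (spike t' r) := by
    intro t t'
    rw [extend_entry_prod hg, if_pos, mul_one]
    · exact Finset.prod_congr rfl fun r _ => by rw [spike_injective_comp hg, spike_injective_comp hg]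
    · intro k hk
      have h1 : k ≠ g t := fun e => hk ⟨t, e.symm⟩
      have h2 : k ≠ g t' := fun e => hk ⟨t', e.symm⟩
      simp [spike, h1, h2]
  have hcompl : ∀ k, k ∈ (Finset.univ.image g)ᶜ → k ∉ Set.range g := fun k hk => by simpa using hk
  rw [← Finset.sum_add_sum_compl (Finset.univ.image g), Finset.sum_image (fun a _ b _ h => hg h),
    add_comm]
  congr 1
  · rw [Finset.sum_congr rfl (g := fun _ => ∏ t, A t 0 0)]
    · rw [Finset.sum_const, Finset.card_compl, Finset.card_image_of_injective _ hg, nsmul_eq_mul]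
      simp only [Fintype.card_fin, Finset.card_univ]
      rw [Nat.cast_sub (by simpa using Fintype.card_le_of_injective g hg)]
    · intro i hi
      simp [hout i _ (hcompl i hi)]
  · refine Finset.sum_congr rfl fun t _ => ?_
    rw [← Finset.sum_add_sum_compl (Finset.univ.image g), Finset.sum_image (fun a _ b _ h => hg h)]
    rw [Finset.sum_eq_zero (s := (Finset.univ.image g)ᶜ) (fun j hj => hin t j (hcompl j hj)), add_zero]
    exact Finset.sum_congr rfl fun t' _ => hboth t t'

/-- `sum_sandwich` for operators on the qubits in the range of `g`: the other factors are 1, which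
every recovery leaves alone and whose trace 2 goes into the power of 2. -/
theorem sum_sandwich_extend {N m : ℕ} (hN : 0 < N) (P : Protocol N)
    (hP : P.Distributes (pure (wState N))) {g : Fin m → Fin N} (hg : g.Injective)
    (H : Fin m → Matrix (Fin 2) (Fin 2) ℂ) (A : Bits N → Fin m → Matrix (Fin 2) (Fin 2) ℂ)
    (hA : ∀ s t, (P.recovery (g t) (P.msg (g t) s) : Matrix (Fin 2) (Fin 2) ℂ) * H t *
        (P.recovery (g t) (P.msg (g t) s) : Matrix (Fin 2) (Fin 2) ℂ)ᴴ = A s t) :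
    ∑ s : Bits N, (((N : ℂ) - m) * ∏ t, A s t 0 0 +
      ∑ t, ∑ t', ∏ r, A s r (spike t r) (spike t' r)) =
      2 ^ N * (N * ∏ t, ((H t).trace / 2)) := by
  have h1 := sum_sandwich hN P hP (Function.extend g H 1)
  have h2 : ∀ s k, (P.recovery k (P.msg k s) : Matrix (Fin 2) (Fin 2) ℂ) * Function.extend g H 1 k *
        (P.recovery k (P.msg k s) : Matrix (Fin 2) (Fin 2) ℂ)ᴴ = Function.extend g (A s) 1 k := by
    intro s k
    by_cases hk : ∃ t, g t = k
    · obtain ⟨t, rfl⟩ := hk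
      rw [hg.extend_apply, hg.extend_apply, hA]
    · rw [Function.extend_apply' _ _ _ hk, Function.extend_apply' _ _ _ hk]
      simp only [Pi.one_apply, mul_one]
      exact Matrix.mem_unitaryGroup_iff.1 (P.recovery k (P.msg k s)).2
  simp only [h2, sum_extend_entry_prod hg] at h1
  rw [h1]
  have h3 : ∏ k, (Function.extend g H 1 k).trace =
      2 ^ N * ∏ k, ((Function.extend g H 1 k).trace / 2) := by
    rw [Finset.prod_div_distrib]
    simp only [Finset.prod_const, Finset.card_univ, Fintype.card_fin]
    field_simp
  have h4 : ∏ k, ((Function.extend g H 1 k).trace / 2) = ∏ t, ((H t).trace / 2) := by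
    classical
    rw [← Finset.prod_mul_prod_compl (Finset.univ.image g),
      Finset.prod_image (fun a _ b _ h => hg h), Finset.prod_eq_one (s := (Finset.univ.image g)ᶜ),
      mul_one]
    · exact Finset.prod_congr rfl fun t _ => by rw [hg.extend_apply]
    · intro k hk
      rw [Function.extend_apply' _ _ _ (by simpa using hk)]
      simp
  rw [h3, h4]
  ring

/-! ### Three one-qubit unitaries as half-turns -/

/-- The combination `m₀ X + m₁ Y + m₂ Z` of the Pauli matrices. -/
noncomputable def pauliVec (m : Fin 3 → ℂ) : Matrix (Fin 2) (Fin 2) ℂ :=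
  !![m 2, m 0 - Complex.I * m 1; m 0 + Complex.I * m 1, -m 2]

/-- The complexification of a real vector. -/
def cvec (u : Fin 3 → ℝ) : Fin 3 → ℂ := fun i => (u i : ℂ)

/-- The quaternion `w₀ + i (w₁ X + w₂ Y + w₃ Z)` as a matrix. -/
noncomputable def quat (w : Fin 4 → ℝ) : Matrix (Fin 2) (Fin 2) ℂ :=
  !![w 0 + Complex.I * w 3, w 2 + Complex.I * w 1; -w 2 + Complex.I * w 1, w 0 - Complex.I * w 3]

theorem exists_quat (R : Matrix.unitaryGroup (Fin 2) ℂ) :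
    ∃ (c : ℂ) (w : Fin 4 → ℝ), star c * c = 1 ∧ w ⬝ᵥ w = 1 ∧
      (R : Matrix (Fin 2) (Fin 2) ℂ) = c • quat w := by
  set M := (R : Matrix (Fin 2) (Fin 2) ℂ) with hM
  have h1 : Mᴴ * M = 1 := Matrix.mem_unitaryGroup_iff'.1 R.2
  have hdet : star M.det * M.det = 1 := by
    rw [← Matrix.det_conjTranspose, ← Matrix.det_mul, h1, Matrix.det_one]
  -- Dividing by a square root of the determinant lands in SU(2), which is the group of unit
  -- quaternions.
  obtain ⟨c, hc⟩ := IsAlgClosed.exists_pow_nat_eq M.det (n := 2) (by norm_num)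
  have hcc : star c * c = 1 := by
    rw [← hc] at hdet
    have h3 : ‖c‖ ^ 4 = 1 := by
      have := congrArg norm hdet
      simp only [norm_mul, norm_star, norm_pow, norm_one] at this
      nlinarith [this]
    have h4 : ‖c‖ = 1 := (pow_eq_one_iff_of_nonneg (norm_nonneg c) (by norm_num)).1 h3
    rw [RCLike.star_def, Complex.conj_mul', h4]; norm_num
  have hc0 : c ≠ 0 := by rintro rfl; simp at hcc
  have hsc : star c = c⁻¹ := eq_inv_of_mul_eq_one_left hcc
  have hadj : Mᴴ = (M.det)⁻¹ • M.adjugate := by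
    have hd : M.det ≠ 0 := by rw [← hc]; exact pow_ne_zero 2 hc0
    have : Mᴴ * (M * M.adjugate) = M.adjugate := by rw [← Matrix.mul_assoc, h1, Matrix.one_mul]
    rw [Matrix.mul_adjugate, Matrix.mul_smul, Matrix.mul_one] at this
    rw [← this, smul_smul, inv_mul_cancel₀ hd, one_smul]
  rw [← hc] at hadj
  have e00 : star (M 0 0) = (c ^ 2)⁻¹ * M 1 1 := by
    have := congrFun (congrFun hadj 0) 0
    simpa [Matrix.adjugate_fin_two] using this
  have e01 : star (M 1 0) = (c ^ 2)⁻¹ * -M 0 1 := by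
    have := congrFun (congrFun hadj 0) 1
    simpa [Matrix.adjugate_fin_two] using this
  have n1 : star (M 0 0) * M 0 0 + star (M 1 0) * M 1 0 = 1 := by
    have := congrFun (congrFun h1 0) 0
    simpa [Matrix.mul_apply, Fin.sum_univ_two] using this
  set α := c⁻¹ * M 0 0 with hα
  set β := c⁻¹ * M 1 0 with hβ
  have hsα : star α = c⁻¹ * M 1 1 := by
    rw [hα, star_mul', star_inv₀, hsc, inv_inv, e00]; field_simp
  have hsβ : star β = -(c⁻¹ * M 0 1) := by
    rw [hβ, star_mul', star_inv₀, hsc, inv_inv, e01]; field_simp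
  have hn : star α * α + star β * β = 1 := by
    rw [← n1, hα, hβ]
    simp only [star_mul', star_inv₀, hsc, inv_inv]; field_simp
  refine ⟨c, ![α.re, β.im, -β.re, α.im], hcc, ?_, ?_⟩
  · have := congrArg Complex.re hn
    simp [Complex.mul_re] at this
    simp [dotProduct, Fin.sum_univ_four]
    linarith
  · have hαe : (α.re : ℂ) + Complex.I * α.im = α := by rw [mul_comm]; exact Complex.re_add_im α
    have hβe : (β.re : ℂ) + Complex.I * β.im = β := by rw [mul_comm]; exact Complex.re_add_im β
    have hαs : (α.re : ℂ) - Complex.I * α.im = star α := by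
      apply Complex.ext <;> simp
    have hβs : -(β.re : ℂ) + Complex.I * β.im = -star β := by
      apply Complex.ext <;> simp
    ext i j
    fin_cases i <;> fin_cases j <;> simp [quat]
    · rw [hαe, hα]; field_simp
    · rw [hβs, hsβ]; field_simp
    · rw [hβe, hβ]; field_simp
    · rw [hαs, hsα]; field_simp

/-- Three linear equations in four unknowns; this is where the bound of three messages enters. -/
theorem exists_orthogonal_quat (w : Fin 3 → Fin 4 → ℝ) :
    ∃ v : Fin 4 → ℝ, v ⬝ᵥ v = 1 ∧ ∀ a, w a ⬝ᵥ v = 0 := by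
  have h : LinearMap.ker (Matrix.mulVecLin (Matrix.of w)) ≠ ⊥ :=
    LinearMap.ker_ne_bot_of_finrank_lt (by simp)
  obtain ⟨v, hv, hv0⟩ := Submodule.exists_mem_ne_zero_of_ne_bot h
  have hv1 : ∀ a, w a ⬝ᵥ v = 0 := fun a => congrFun hv a
  have hpos : 0 < v ⬝ᵥ v := by
    refine lt_of_le_of_ne (Finset.sum_nonneg fun i _ => mul_self_nonneg _) fun e => hv0 ?_
    exact dotProduct_self_eq_zero.1 e.symm
  refine ⟨(√(v ⬝ᵥ v))⁻¹ • v, ?_, fun a => by rw [dotProduct_smul, hv1, smul_zero]⟩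
  rw [dotProduct_smul, smul_dotProduct, smul_smul, ← mul_inv, Real.mul_self_sqrt hpos.le, smul_eq_mul,
    inv_mul_cancel₀ hpos.ne']

/-- Three one-qubit unitaries are, up to phases and a common right factor, half-turns. -/
theorem exists_axes (R : Fin 3 → Matrix.unitaryGroup (Fin 2) ℂ) :
    ∃ (V : Matrix (Fin 2) (Fin 2) ℂ) (u : Fin 3 → Fin 3 → ℝ), V * Vᴴ = 1 ∧
      (∀ a, u a ⬝ᵥ u a = 1) ∧ ∀ a H, (R a : Matrix (Fin 2) (Fin 2) ℂ) * (Vᴴ * H * V) *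
        (R a : Matrix (Fin 2) (Fin 2) ℂ)ᴴ = pauliVec (cvec (u a)) * H * pauliVec (cvec (u a)) := by
  choose c w hc hw hR using fun a => exists_quat (R a)
  obtain ⟨v, hv, hwv⟩ := exists_orthogonal_quat w
  have hI : (Complex.I) ^ 2 = -1 := Complex.I_sq
  -- The axes are the imaginary parts of the quaternion products of `w a` with the conjugate of `v`.
  -- The real part is the inner product of `w a` and `v`, which vanishes, so these products are
  -- purely imaginary.
  refine ⟨quat v, fun a => ![v 0 * w a 1 - w a 0 * v 1 + w a 2 * v 3 - w a 3 * v 2,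
    v 0 * w a 2 - w a 0 * v 2 + w a 3 * v 1 - w a 1 * v 3,
    v 0 * w a 3 - w a 0 * v 3 + w a 1 * v 2 - w a 2 * v 1], ?_, ?_, ?_⟩
  · simp only [dotProduct, Fin.sum_univ_four] at hv
    have hvc : (v 0 : ℂ) * v 0 + v 1 * v 1 + v 2 * v 2 + v 3 * v 3 = 1 := by exact_mod_cast hv
    ext i j
    fin_cases i <;> fin_cases j <;>
      simp [quat, Matrix.mul_apply, Fin.sum_univ_two] <;>
      first
        | linear_combination hvc - (v 3 * v 3 + v 1 * v 1 : ℂ) * hI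
        | ring
  · intro a
    have h1 := hwv a
    have h2 := hw a
    simp only [dotProduct, Fin.sum_univ_four] at hv h1 h2
    simp only [dotProduct, Fin.sum_univ_three, Matrix.cons_val]
    linear_combination h2 + (w a 0 * w a 0 + w a 1 * w a 1 + w a 2 * w a 2 + w a 3 * w a 3) * hv
       - (w a 0 * v 0 + w a 1 * v 1 + w a 2 * v 2 + w a 3 * v 3) * h1
  · intro a H
    have h1 := hwv a
    simp only [dotProduct, Fin.sum_univ_four] at h1
    have h1c : (w a 0 : ℂ) * v 0 + w a 1 * v 1 + w a 2 * v 2 + w a 3 * v 3 = 0 := by exact_mod_cast h1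
    set u : Fin 3 → ℝ := ![v 0 * w a 1 - w a 0 * v 1 + w a 2 * v 3 - w a 3 * v 2,
      v 0 * w a 2 - w a 0 * v 2 + w a 3 * v 1 - w a 1 * v 3,
      v 0 * w a 3 - w a 0 * v 3 + w a 1 * v 2 - w a 2 * v 1] with hu
    have hq : quat (w a) * (quat v)ᴴ = Complex.I • pauliVec (cvec u) := by
      ext i j
      fin_cases i <;> fin_cases j <;>
        simp [quat, pauliVec, cvec, hu, Matrix.mul_apply, Fin.sum_univ_two]
      · linear_combination h1c - ((w a 3 : ℂ) * v 3 + w a 1 * v 1) * hI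
      · ring_nf
        simp only [hI]
        ring
      · ring_nf
        simp only [hI]
        ring
      · linear_combination h1c - ((w a 3 : ℂ) * v 3 + w a 1 * v 1) * hI
    have hR' : (R a : Matrix (Fin 2) (Fin 2) ℂ) * (quat v)ᴴ = (c a * Complex.I) • pauliVec (cvec u) := by
      rw [hR, Matrix.smul_mul, hq, smul_smul]
    have hher : (pauliVec (cvec u))ᴴ = pauliVec (cvec u) := by
      ext i j
      fin_cases i <;> fin_cases j <;> simp [pauliVec, cvec]
      ring
    calc (R a : Matrix (Fin 2) (Fin 2) ℂ) * ((quat v)ᴴ * H * quat v) * (R a : Matrix (Fin 2) (Fin 2) ℂ)ᴴ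
        = ((R a : Matrix (Fin 2) (Fin 2) ℂ) * (quat v)ᴴ) * H *
          ((R a : Matrix (Fin 2) (Fin 2) ℂ) * (quat v)ᴴ)ᴴ := by
          rw [Matrix.conjTranspose_mul, Matrix.conjTranspose_conjTranspose]
          simp only [Matrix.mul_assoc]
      _ = _ := by
          rw [hR', Matrix.conjTranspose_smul, hher, Matrix.smul_mul, Matrix.smul_mul, Matrix.mul_smul,
            smul_smul, star_mul']
          have : c a * Complex.I * (star (c a) * star Complex.I) = 1 := by
            have h5 := hc a
            simp only [RCLike.star_def, Complex.conj_I] at h5 ⊢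
            linear_combination h5 - (c a * (starRingEnd ℂ) (c a)) * hI
          rw [this, one_smul]

/-! ### Correlator constraints on the axes of two nodes -/

/-- The weights of the W state's two-body correlators. -/
def wWeight (κ : ℝ) : Fin 3 → ℝ := ![2, 2, κ]

/-- The expectation of a function of two messages with joint distribution `p`. -/
def expect (p : Fin 3 → Fin 3 → ℝ) (f : Fin 3 → Fin 3 → ℝ) : ℝ := ∑ a, ∑ b, p a b * f a b

/-- The axes `u`, `v` of the half-turns at two end nodes and the joint distribution `p` of the
messages, subject to the one- and two-body correlators of a protocol that distributes the W
state. -/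
structure AxisPair (κ : ℝ) (u v : Fin 3 → Fin 3 → ℝ) (p : Fin 3 → Fin 3 → ℝ) : Prop where
  unit_left : ∀ a, u a 0 ^ 2 + u a 1 ^ 2 + u a 2 ^ 2 = 1
  unit_right : ∀ b, v b 0 ^ 2 + v b 1 ^ 2 + v b 2 ^ 2 = 1
  nonneg : ∀ a b, 0 ≤ p a b
  total : expect p (fun _ _ => 1) = 1
  left_moment : ∀ i, expect p (fun a _ => u a 2 * u a i) = if i = 2 then 1 / 2 else 0
  right_moment : ∀ j, expect p (fun _ b => v b 2 * v b j) = if j = 2 then 1 / 2 else 0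
  moment : ∀ i j, expect p (fun a b =>
      (2 * (u a 0 * v b 0 + u a 1 * v b 1) + κ * (u a 2 * v b 2)) * (u a i * v b j)) =
    wWeight κ j / 2 * expect p (fun a _ => u a i * u a j) +
      wWeight κ i / 2 * expect p (fun _ b => v b i * v b j) - if i = j then wWeight κ i / 4 else 0

/-- The determinant of the second moments of the components orthogonal to the `z` axis. -/
def planeDet (p : Fin 3 → ℝ) (u : Fin 3 → Fin 3 → ℝ) : ℝ :=
  (∑ a, p a * u a 0 ^ 2) * (∑ a, p a * u a 1 ^ 2) - (∑ a, p a * (u a 0 * u a 1)) ^ 2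

/-- By Cauchy–Binet, the determinant of the full second-moment matrix is $p_0p_1p_2\det(u)^2$. The
hypothesis makes that matrix block diagonal with $zz$ entry $1/2$, and `planeDet` is the determinant
of the other block. -/
theorem planeDet_eq (p : Fin 3 → ℝ) (u : Fin 3 → Fin 3 → ℝ)
    (h : ∀ i, ∑ a, p a * (u a 2 * u a i) = if i = 2 then 1 / 2 else 0) :
    planeDet p u = 2 * ((p 0 * p 1 * p 2) * (Matrix.of u).det ^ 2) := by
  have h0 := h 0
  have h1 := h 1
  have h2 := h 2
  simp only [Fin.sum_univ_three, Fin.isValue, Fin.reduceEq, if_false, if_true] at h0 h1 h2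
  have key : (p 0 * p 1 * p 2) * (Matrix.of u).det ^ 2 =
      planeDet p u * (p 0 * (u 0 2 * u 0 2) + p 1 * (u 1 2 * u 1 2) + p 2 * (u 2 2 * u 2 2))
      - (∑ a, p a * u a 0 ^ 2) * (p 0 * (u 0 2 * u 0 1) + p 1 * (u 1 2 * u 1 1) + p 2 * (u 2 2 * u 2 1)) ^ 2
      - (∑ a, p a * u a 1 ^ 2) * (p 0 * (u 0 2 * u 0 0) + p 1 * (u 1 2 * u 1 0) + p 2 * (u 2 2 * u 2 0)) ^ 2
      + 2 * (∑ a, p a * (u a 0 * u a 1)) * (p 0 * (u 0 2 * u 0 0) + p 1 * (u 1 2 * u 1 0) + p 2 * (u 2 2 * u 2 0))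
        * (p 0 * (u 0 2 * u 0 1) + p 1 * (u 1 2 * u 1 1) + p 2 * (u 2 2 * u 2 1)) := by
    simp only [Matrix.det_fin_three, Matrix.of_apply, planeDet, Fin.sum_univ_three]
    ring
  rw [key, h0, h1, h2]
  ring

theorem eq_zero_of_comb {v : Fin 3 → Fin 3 → ℝ} (hv : (Matrix.of v).det ≠ 0) (c : Fin 3 → ℝ)
    (h : ∀ i, ∑ b, c b * v b i = 0) (b : Fin 3) : c b = 0 := by
  have : c ᵥ* Matrix.of v = 0 := by
    funext i
    simpa [Matrix.vecMul, dotProduct] using h i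
  exact congrFun (Matrix.eq_zero_of_vecMul_eq_zero hv this) b

theorem eq_zero_of_orthogonal {v : Fin 3 → Fin 3 → ℝ} (hv : (Matrix.of v).det ≠ 0) (g : Fin 3 → ℝ)
    (h : ∀ b, ∑ i, v b i * g i = 0) (i : Fin 3) : g i = 0 := by
  have : Matrix.of v *ᵥ g = 0 := by
    funext b
    simpa [Matrix.mulVec, dotProduct] using h b
  exact congrFun (Matrix.eq_zero_of_mulVec_eq_zero hv this) i

theorem exists_third {a b : Fin 3} (h : a ≠ b) : ∃ c, c ≠ a ∧ c ≠ b ∧ ∀ f : Fin 3 → ℝ,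
    ∑ x, f x = f a + f b + f c := by
  have : ∃ c, c ≠ a ∧ c ≠ b ∧ (Finset.univ : Finset (Fin 3)) = {a, b, c} := by
    revert a b; decide
  obtain ⟨c, h1, h2, h3⟩ := this
  refine ⟨c, h1, h2, fun f => ?_⟩
  rw [h3, Finset.sum_insert (by simp [h, h1.symm]), Finset.sum_pair h2.symm, add_assoc]

namespace AxisPair

variable {κ : ℝ} {u v : Fin 3 → Fin 3 → ℝ} {p : Fin 3 → Fin 3 → ℝ}

theorem swap (h : AxisPair κ u v p) : AxisPair κ v u (fun b a => p a b) where
  unit_left := h.unit_right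
  unit_right := h.unit_left
  nonneg a b := h.nonneg b a
  total := by
    have := h.total
    rw [expect, Finset.sum_comm] at this
    exact this
  left_moment i := by rw [← h.right_moment i, expect, expect, Finset.sum_comm]
  right_moment i := by rw [← h.left_moment i, expect, expect, Finset.sum_comm]
  moment i j := by
    have e1 : expect (fun b a => p a b) (fun a _ => v a i * v a j) =
        expect p (fun _ b => v b j * v b i) := by
      rw [expect, expect, Finset.sum_comm]
      simp only [mul_comm]
    have e2 : expect (fun b a => p a b) (fun _ b => u b i * u b j) =
        expect p (fun a _ => u a j * u a i) := by
      rw [expect, expect, Finset.sum_comm]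
      simp only [mul_comm]
    rw [e1, e2]
    have := h.moment j i
    rw [expect, Finset.sum_comm] at this ⊢
    have e3 : (if i = j then wWeight κ i / 4 else 0) = if j = i then wWeight κ j / 4 else 0 := by
      by_cases hij : i = j
      · subst hij; rfl
      · rw [if_neg hij, if_neg (Ne.symm hij)]
    rw [e3]
    rw [Finset.sum_comm] at this
    rw [Finset.sum_comm]
    rw [add_comm (wWeight κ j / 2 * _), ← this, Finset.sum_comm]
    refine Finset.sum_congr rfl fun a _ => Finset.sum_congr rfl fun b _ => ?_
    ring

theorem left_sum (h : AxisPair κ u v p) (i : Fin 3) :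
    ∑ a, (∑ b, p a b) * (u a 2 * u a i) = if i = 2 then 1 / 2 else 0 := by
  rw [← h.left_moment i, expect]
  exact Finset.sum_congr rfl fun a _ => Finset.sum_mul _ _ _

theorem right_sum (h : AxisPair κ u v p) (j : Fin 3) :
    ∑ b, (∑ a, p a b) * (v b 2 * v b j) = if j = 2 then 1 / 2 else 0 := h.swap.left_sum j

/-- A pair of nodes with nondegenerate axes. -/
structure Regular (u v : Fin 3 → Fin 3 → ℝ) (p : Fin 3 → Fin 3 → ℝ) : Prop where
  pos_left : ∀ a, 0 < ∑ b, p a b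
  pos_right : ∀ b, 0 < ∑ a, p a b
  det_left : (Matrix.of u).det ≠ 0
  det_right : (Matrix.of v).det ≠ 0

theorem Regular.swap (h : Regular u v p) : Regular v u (fun b a => p a b) :=
  ⟨h.pos_right, h.pos_left, h.det_right, h.det_left⟩

/-! ### Nodes with an axis along z -/

/-- If one of the axes is the `z` axis, then the others are orthogonal to it. -/
theorem polar_right (h : AxisPair κ u v p) (hr : Regular u v p) {b₀ : Fin 3} (h0 : v b₀ 0 = 0)
    (h1 : v b₀ 1 = 0) : ∑ a, p a b₀ = 1 / 2 ∧ ∀ b, b ≠ b₀ → v b 2 = 0 := by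
  have hz : v b₀ 2 ^ 2 = 1 := by have := h.unit_right b₀; rw [h0, h1] at this; linarith
  -- The right moments give $\sum_b p_bv_{b,z}v_b=\tfrac12e_z=\tfrac12v_{b_0,z}v_{b_0}$;
  -- coefficients are compared by independence of the axes.
  have hc := eq_zero_of_comb hr.det_right
    (fun b => (∑ a, p a b) * v b 2 - if b = b₀ then v b₀ 2 / 2 else 0) (fun i => by
      have := h.right_sum i
      simp only [sub_mul, Finset.sum_sub_distrib, ite_mul, zero_mul, Finset.sum_ite_eq',
        Finset.mem_univ, if_true]
      rw [Finset.sum_congr rfl (fun b _ => mul_assoc _ (v b 2) (v b i)), this]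
      fin_cases i <;> simp [h0, h1]
      linarith)
  constructor
  · have := hc b₀
    simp only [if_true] at this
    have hne : v b₀ 2 ≠ 0 := by intro e; rw [e] at hz; norm_num at hz
    have h3 : ((∑ a, p a b₀) - 1 / 2) * v b₀ 2 = 0 := by linarith
    rcases mul_eq_zero.1 h3 with h4 | h4
    · linarith
    · exact absurd h4 hne
  · intro b hb
    have := hc b
    simp only [if_neg hb, sub_zero] at this
    exact (mul_eq_zero.1 this).resolve_left (hr.pos_right b).ne'

/-- If no axis is the `z` axis, at most one is orthogonal to it. -/
theorem left_z_ne (h : AxisPair κ u v p) (hr : Regular u v p)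
    (hu : ∀ a, ¬ (u a 0 = 0 ∧ u a 1 = 0)) {a a' : Fin 3} (ha : a ≠ a') (h0 : u a 2 = 0) :
    u a' 2 ≠ 0 := by
  intro h0'
  obtain ⟨c, -, -, hs⟩ := exists_third ha
  have e0 := h.left_sum 0
  have e1 := h.left_sum 1
  have e2 := h.left_sum 2
  rw [hs, h0, h0'] at e0 e1 e2
  simp only [zero_mul, mul_zero, zero_add, Fin.isValue, Fin.reduceEq, if_false, if_true,
    mul_eq_zero, (hr.pos_left c).ne', false_or] at e0 e1 e2
  have hc2 : u c 2 ≠ 0 := by intro e; rw [e] at e2; norm_num at e2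
  exact hu c ⟨e0.resolve_left hc2, e1.resolve_left hc2⟩

/-- Vanishing of a nonnegative expectation: the components orthogonal to the `z` axis of jointly
possible axes are orthogonal. -/
theorem orthogonal_of_expect_eq_zero (h : AxisPair κ u v p)
    (hAB : expect p (fun a b => (u a 0 * v b 0 + u a 1 * v b 1) * (u a 2 * v b 2)) = 0) (a b : Fin 3) :
    p a b * (u a 0 * v b 0 + u a 1 * v b 1) = 0 := by
  have hA : expect p (fun a b => (u a 0 * v b 0 + u a 1 * v b 1) ^ 2) = 0 := by
    have m0 := h.moment 0 0
    have m1 := h.moment 1 1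
    have l2 := h.left_moment 2
    have r2 := h.right_moment 2
    have lu : expect p (fun a _ => u a 0 * u a 0) + expect p (fun a _ => u a 1 * u a 1) +
        expect p (fun a _ => u a 2 * u a 2) = 1 := by
      rw [← h.total]
      simp only [expect, ← Finset.sum_add_distrib]
      refine Finset.sum_congr rfl fun a _ => Finset.sum_congr rfl fun b _ => ?_
      linear_combination p a b * h.unit_left a
    have rv : expect p (fun _ b => v b 0 * v b 0) + expect p (fun _ b => v b 1 * v b 1) +
        expect p (fun _ b => v b 2 * v b 2) = 1 := by
      rw [← h.total]
      simp only [expect, ← Finset.sum_add_distrib]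
      refine Finset.sum_congr rfl fun a _ => Finset.sum_congr rfl fun b _ => ?_
      linear_combination p a b * h.unit_right b
    -- Write $A$ for the inner product of the transverse parts and $B$ for the product of the $z$
    -- components. The sum of the moments $(0,0)$ and $(1,1)$ is $2E[A^2]+\kappa
    -- E[AB]=\tfrac12+\tfrac12-1=0$.
    have e : 2 * expect p (fun a b => (u a 0 * v b 0 + u a 1 * v b 1) ^ 2) +
        κ * expect p (fun a b => (u a 0 * v b 0 + u a 1 * v b 1) * (u a 2 * v b 2)) =
        expect p (fun a b =>
          (2 * (u a 0 * v b 0 + u a 1 * v b 1) + κ * (u a 2 * v b 2)) * (u a 0 * v b 0)) +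
        expect p (fun a b =>
          (2 * (u a 0 * v b 0 + u a 1 * v b 1) + κ * (u a 2 * v b 2)) * (u a 1 * v b 1)) := by
      simp only [expect, Finset.mul_sum, ← Finset.sum_add_distrib]
      refine Finset.sum_congr rfl fun a _ => Finset.sum_congr rfl fun b _ => ?_
      ring
    rw [m0, m1, hAB] at e
    simp only [wWeight, Matrix.cons_val_zero, Matrix.cons_val_one, if_true] at e l2 r2
    linarith
  have h1 := (Finset.sum_eq_zero_iff_of_nonneg (fun a _ => Finset.sum_nonneg fun b _ =>
    mul_nonneg (h.nonneg a b) (sq_nonneg _))).1 hA a (Finset.mem_univ a)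
  have h2 := (Finset.sum_eq_zero_iff_of_nonneg (fun b _ =>
    mul_nonneg (h.nonneg a b) (sq_nonneg _))).1 h1 b (Finset.mem_univ b)
  rcases mul_eq_zero.1 h2 with h3 | h3
  · rw [h3, zero_mul]
  · rw [pow_eq_zero_iff two_ne_zero |>.1 h3, mul_zero]

/-- With orthogonality, only the `z` components enter the two-body correlators. -/
theorem moment_of_orthogonal (h : AxisPair κ u v p)
    (ho : ∀ a b, p a b * (u a 0 * v b 0 + u a 1 * v b 1) = 0) (i j : Fin 3) :
    κ * expect p (fun a b => (u a 2 * v b 2) * (u a i * v b j)) =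
    wWeight κ j / 2 * expect p (fun a _ => u a i * u a j) +
      wWeight κ i / 2 * expect p (fun _ b => v b i * v b j) - if i = j then wWeight κ i / 4 else 0 := by
  rw [← h.moment i j]
  simp only [expect, Finset.mul_sum]
  refine Finset.sum_congr rfl fun a _ => Finset.sum_congr rfl fun b _ => ?_
  linear_combination -2 * (u a i * v b j) * ho a b

/-- The mixed expectation vanishes term by term: the axis `v b₀` has no transverse part, and the
other axes of that node have no $z$ component. -/
theorem polar_orthogonal (h : AxisPair κ u v p) (hr : Regular u v p) {b₀ : Fin 3} (h0 : v b₀ 0 = 0)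
    (h1 : v b₀ 1 = 0) (a b : Fin 3) : p a b * (u a 0 * v b 0 + u a 1 * v b 1) = 0 := by
  refine h.orthogonal_of_expect_eq_zero ?_ a b
  refine Finset.sum_eq_zero fun a _ => Finset.sum_eq_zero fun b _ => ?_
  by_cases hb : b = b₀
  · simp only [hb, h0, h1]; ring
  · simp only [(h.polar_right hr h0 h1).2 b hb]; ring

/-- The message with the `z` axis is independent of the other node's message. -/
theorem polar_independent (h : AxisPair κ u v p) (hr : Regular u v p) (hκ : κ ≠ 0) {b₀ : Fin 3}
    (h0 : v b₀ 0 = 0) (h1 : v b₀ 1 = 0) (a : Fin 3) :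
    (p a b₀ - 1 / 2 * ∑ b, p a b) * u a 2 = 0 := by
  obtain ⟨hh, hz⟩ := h.polar_right hr h0 h1
  have hz0 : v b₀ 2 * v b₀ 2 = 1 := by have := h.unit_right b₀; rw [h0, h1] at this; linarith
  refine eq_zero_of_comb hr.det_left (fun a => (p a b₀ - 1 / 2 * ∑ b, p a b) * u a 2) (fun i => ?_) a
  have m := h.moment_of_orthogonal (h.polar_orthogonal hr h0 h1) i 2
  have l := h.left_moment i
  have r := h.right_moment i
  have e1 : expect p (fun a b => (u a 2 * v b 2) * (u a i * v b 2)) = ∑ a, p a b₀ * (u a 2 * u a i) := by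
    refine Finset.sum_congr rfl fun a _ => ?_
    rw [Finset.sum_eq_single b₀ (fun b _ hb => by simp only [hz b hb]; ring) (by simp)]
    linear_combination p a b₀ * u a 2 * u a i * hz0
  have e2 : ∀ i, expect p (fun a _ => u a i * u a 2) = expect p (fun a _ => u a 2 * u a i) := by
    intro i; simp only [mul_comm]
  have e3 : ∀ i, expect p (fun _ b => v b i * v b 2) = expect p (fun _ b => v b 2 * v b i) := by
    intro i; simp only [mul_comm]
  rw [e1, e2, e3, l, r] at m
  -- In the moments $(i,2)$ only the message `b₀` survives, so $\sum_a p(a,b_0)u_{a,z}u_a$ is half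
  -- of the unconditional sum; the axes `u` are independent.
  have goal : ∑ a, p a b₀ * (u a 2 * u a i) = 1 / 2 * if i = 2 then 1 / 2 else 0 := by
    apply mul_left_cancel₀ hκ
    rw [m]
    fin_cases i <;> simp [wWeight]
    ring
  have ls := h.left_sum i
  calc ∑ a, (p a b₀ - 1 / 2 * ∑ b, p a b) * u a 2 * u a i
      = ∑ a, p a b₀ * (u a 2 * u a i) - 1 / 2 * ∑ a, (∑ b, p a b) * (u a 2 * u a i) := by
        rw [Finset.mul_sum, ← Finset.sum_sub_distrib]
        exact Finset.sum_congr rfl fun a _ => by ring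
    _ = 0 := by rw [goal, ls, sub_self]

/-- Serves the case that `b₁` occurs only with `a₀` and `b₂` never does. The transverse second
moments of the two nodes add up to $\tfrac12I$. Evaluated on the unit vector $v_{b_2}$, this gives
$P(a_0)W^2=P(b_1)\bigl(1-(v_{b_1}\cdot v_{b_2})^2\bigr)$. The axes of `a₀` and `b₁` are an
orthonormal basis of the plane, so the bracket is $W^2$; then $P(b_1)=\tfrac12P(a_0)$ forces $W=0$.
-/
theorem polar_mixed_core (h : AxisPair κ u v p) (hr : Regular u v p) {b₀ b₁ b₂ a₀ : Fin 3}
    (h0 : v b₀ 0 = 0) (h1 : v b₀ 1 = 0) (hb : b₁ ≠ b₀) (hb' : b₂ ≠ b₀)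
    (hs : ∀ f : Fin 3 → ℝ, ∑ x, f x = f b₁ + f b₂ + f b₀)
    (hp : ∑ a, p a b₁ = 1 / 2 * ∑ b, p a₀ b)
    (h2 : ∀ a, a ≠ a₀ → u a 0 * v b₂ 0 + u a 1 * v b₂ 1 = 0)
    (h3 : u a₀ 0 * v b₁ 0 + u a₀ 1 * v b₁ 1 = 0) : False := by
  obtain ⟨hh, hz⟩ := h.polar_right hr h0 h1
  have ho := h.polar_orthogonal hr h0 h1
  have hz1 := hz b₁ hb
  have hz2 := hz b₂ hb'
  have n1 := h.unit_right b₁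
  have n2 := h.unit_right b₂
  rw [hz1] at n1
  rw [hz2] at n2
  set W := u a₀ 0 * v b₂ 0 + u a₀ 1 * v b₂ 1 with hW
  -- Otherwise the nonzero transverse vector of `b₂` would be orthogonal to all three independent
  -- axes `u`.
  have hW0 : W ≠ 0 := by
    intro hw
    have := eq_zero_of_orthogonal hr.det_left ![v b₂ 0, v b₂ 1, 0] (fun a => by
      rw [Fin.sum_univ_three]
      simp only [Matrix.cons_val]
      by_cases ha : a = a₀
      · rw [ha]; linarith
      · linarith [h2 a ha])
    have t0 := this 0
    have t1 := this 1
    simp only [Matrix.cons_val] at t0 t1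
    rw [t0, t1] at n2
    norm_num at n2
  have hP := hr.pos_left a₀
  have huz : u a₀ 2 = 0 := by
    have l0 := h.left_sum 0
    have l1 := h.left_sum 1
    simp only [Fin.isValue, Fin.reduceEq, if_false] at l0 l1
    have : (∑ b, p a₀ b) * u a₀ 2 * W = 0 := by
      have e : ∑ a, (∑ b, p a b) * (u a 2) * (u a 0 * v b₂ 0 + u a 1 * v b₂ 1) = 0 := by
        calc _ = (∑ a, (∑ b, p a b) * (u a 2 * u a 0)) * v b₂ 0 +
            (∑ a, (∑ b, p a b) * (u a 2 * u a 1)) * v b₂ 1 := by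
              rw [Finset.sum_mul, Finset.sum_mul, ← Finset.sum_add_distrib]
              exact Finset.sum_congr rfl fun a _ => by ring
          _ = 0 := by rw [l0, l1]; ring
      rw [Finset.sum_eq_single a₀ (fun a _ ha => by rw [h2 a ha, mul_zero]) (by simp)] at e
      exact e
    rcases mul_eq_zero.1 this with h4 | h4
    · exact (mul_eq_zero.1 h4).resolve_left hP.ne'
    · exact absurd h4 hW0
  have n3 := h.unit_left a₀
  rw [huz] at n3
  -- two unit vectors orthogonal in the plane
  have hcs : W ^ 2 + (v b₁ 0 * v b₂ 0 + v b₁ 1 * v b₂ 1) ^ 2 = 1 := by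
    have hx : u a₀ 0 * v b₁ 1 - u a₀ 1 * v b₁ 0 ≠ 0 := by
      intro hx
      have : (u a₀ 0 ^ 2 + u a₀ 1 ^ 2) * (v b₁ 0 ^ 2 + v b₁ 1 ^ 2) = 0 := by
        linear_combination (u a₀ 0 * v b₁ 0 + u a₀ 1 * v b₁ 1) * h3 +
          (u a₀ 0 * v b₁ 1 - u a₀ 1 * v b₁ 0) * hx
      nlinarith
    have hx2 : (u a₀ 0 * v b₁ 1 - u a₀ 1 * v b₁ 0) ^ 2 = 1 := by
      have : (u a₀ 0 ^ 2 + u a₀ 1 ^ 2) * (v b₁ 0 ^ 2 + v b₁ 1 ^ 2) = 1 := by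
        rw [show u a₀ 0 ^ 2 + u a₀ 1 ^ 2 = 1 by linarith, show v b₁ 0 ^ 2 + v b₁ 1 ^ 2 = 1 by linarith]
        norm_num
      linear_combination this - (u a₀ 0 * v b₁ 0 + u a₀ 1 * v b₁ 1) * h3
    have e0 : u a₀ 0 = (u a₀ 0 * v b₁ 1 - u a₀ 1 * v b₁ 0) * v b₁ 1 := by
      linear_combination v b₁ 0 * h3 - u a₀ 0 * n1
    have e1 : u a₀ 1 = -(u a₀ 0 * v b₁ 1 - u a₀ 1 * v b₁ 0) * v b₁ 0 := by
      linear_combination v b₁ 1 * h3 - u a₀ 1 * n1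
    have hW' : W = (u a₀ 0 * v b₁ 1 - u a₀ 1 * v b₁ 0) * (v b₁ 1 * v b₂ 0 - v b₁ 0 * v b₂ 1) := by
      linear_combination hW + v b₂ 0 * e0 + v b₂ 1 * e1
    rw [hW', mul_pow, hx2]
    linear_combination n1 * (v b₂ 0 ^ 2 + v b₂ 1 ^ 2) + n2
  -- the second moments of the two nodes add up to half the identity
  have mm : ∀ i j : Fin 3, i ≠ 2 → j ≠ 2 → expect p (fun a _ => u a i * u a j) +
      expect p (fun _ b => v b i * v b j) = if i = j then 1 / 2 else 0 := by
    intro i j hi hj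
    have m := h.moment_of_orthogonal ho i j
    have e : expect p (fun a b => (u a 2 * v b 2) * (u a i * v b j)) = 0 := by
      refine Finset.sum_eq_zero fun a _ => Finset.sum_eq_zero fun b _ => ?_
      by_cases hb : b = b₀
      · have : v b j = 0 := by
          rw [hb]; fin_cases j
          · exact h0
          · exact h1
          · exact absurd rfl hj
        simp only [this]; ring
      · simp only [hz b hb]; ring
    rw [e] at m
    have wi : wWeight κ i = 2 := by fin_cases i <;> simp [wWeight] at hi ⊢
    have wj : wWeight κ j = 2 := by fin_cases j <;> simp [wWeight] at hj ⊢
    rw [wi, wj] at m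
    split_ifs at m ⊢ <;> linarith
  have m00 := mm 0 0 (by decide) (by decide)
  have m01 := mm 0 1 (by decide) (by decide)
  have m11 := mm 1 1 (by decide) (by decide)
  simp only [Fin.isValue, Fin.reduceEq, if_false, if_true] at m00 m01 m11
  have eL : expect p (fun a _ => (u a 0 * v b₂ 0 + u a 1 * v b₂ 1) ^ 2) = (∑ b, p a₀ b) * W ^ 2 := by
    simp only [expect, ← Finset.sum_mul]
    rw [Finset.sum_eq_single a₀ (fun a _ ha => by rw [h2 a ha]; ring) (by simp)]
  have eR : expect p (fun _ b => (v b 0 * v b₂ 0 + v b 1 * v b₂ 1) ^ 2) =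
      (∑ a, p a b₁) * (v b₁ 0 * v b₂ 0 + v b₁ 1 * v b₂ 1) ^ 2 + ∑ a, p a b₂ := by
    rw [expect, Finset.sum_comm]
    simp only [← Finset.sum_mul]
    rw [hs, h0, h1]
    linear_combination (∑ a, p a b₂) * (v b₂ 0 ^ 2 + v b₂ 1 ^ 2 + 1) * n2
  have eLx : expect p (fun a _ => (u a 0 * v b₂ 0 + u a 1 * v b₂ 1) ^ 2) =
      v b₂ 0 ^ 2 * expect p (fun a _ => u a 0 * u a 0) +
      2 * (v b₂ 0 * v b₂ 1) * expect p (fun a _ => u a 0 * u a 1) +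
      v b₂ 1 ^ 2 * expect p (fun a _ => u a 1 * u a 1) := by
    simp only [expect, Finset.mul_sum, ← Finset.sum_add_distrib]
    exact Finset.sum_congr rfl fun a _ => Finset.sum_congr rfl fun b _ => by ring
  have eRx : expect p (fun _ b => (v b 0 * v b₂ 0 + v b 1 * v b₂ 1) ^ 2) =
      v b₂ 0 ^ 2 * expect p (fun _ b => v b 0 * v b 0) +
      2 * (v b₂ 0 * v b₂ 1) * expect p (fun _ b => v b 0 * v b 1) +
      v b₂ 1 ^ 2 * expect p (fun _ b => v b 1 * v b 1) := by
    simp only [expect, Finset.mul_sum, ← Finset.sum_add_distrib]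
    exact Finset.sum_congr rfl fun a _ => Finset.sum_congr rfl fun b _ => by ring
  have tot : (∑ a, p a b₁) + (∑ a, p a b₂) = 1 / 2 := by
    have t := h.total
    rw [expect, Finset.sum_comm] at t
    simp only [mul_one] at t
    rw [hs] at t
    linarith
  have fin : (∑ b, p a₀ b) * W ^ 2 = 0 := by
    linear_combination 2 * (-eL - eR + eLx + eRx + v b₂ 0 ^ 2 * m00 + 2 * (v b₂ 0 * v b₂ 1) * m01 + v b₂ 1 ^ 2 * m11)
      - 2 * tot + n2 - 2 * (v b₁ 0 * v b₂ 0 + v b₁ 1 * v b₂ 1) ^ 2 * hp + 2 * hp - (∑ b, p a₀ b) * hcs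
  rcases mul_eq_zero.1 fin with h4 | h4
  · exact hP.ne' h4
  · exact hW0 (pow_eq_zero_iff two_ne_zero |>.1 h4)

end AxisPair

namespace AxisPair

variable {κ : ℝ} {u v : Fin 3 → Fin 3 → ℝ} {p : Fin 3 → Fin 3 → ℝ}

/-- Two regular nodes cannot be such that exactly one of them has the `z` axis among its axes. -/
theorem not_polar_mixed (h : AxisPair κ u v p) (hr : Regular u v p) (hκ : κ ≠ 0) {b₀ : Fin 3}
    (h0 : v b₀ 0 = 0) (h1 : v b₀ 1 = 0) (hu : ∀ a, ¬ (u a 0 = 0 ∧ u a 1 = 0)) : False := by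
  obtain ⟨hh, hz⟩ := h.polar_right hr h0 h1
  have ho := h.polar_orthogonal hr h0 h1
  have hi := h.polar_independent hr hκ h0 h1
  obtain ⟨b₁, hb₁⟩ : ∃ b₁ : Fin 3, b₀ ≠ b₁ := by
    have : ∀ b₀ : Fin 3, ∃ b₁, b₀ ≠ b₁ := by decide
    exact this b₀
  obtain ⟨b₂, hb₂, hb₂', hs⟩ := exists_third hb₁
  -- independence of the polar message
  have hhalf : ∀ a, p a b₀ = 1 / 2 * ∑ b, p a b := by
    intro a
    rcases mul_eq_zero.1 (hi a) with e | e
    · linarith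
    -- At most one message has vanishing $z$ component, so for this one independence follows from
    -- the other two and the total probability.
    · obtain ⟨a', ha'⟩ : ∃ a' : Fin 3, a ≠ a' := by
        have : ∀ a : Fin 3, ∃ a', a ≠ a' := by decide
        exact this a
      obtain ⟨a'', ha'', -, hs'⟩ := exists_third ha'
      have t1 := (mul_eq_zero.1 (hi a')).resolve_right (h.left_z_ne hr hu ha' e)
      have t2 := (mul_eq_zero.1 (hi a'')).resolve_right (h.left_z_ne hr hu ha''.symm e)
      have tot := h.total
      simp only [expect, mul_one] at tot
      rw [hs'] at tot hh
      linarith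
  have hrest : ∀ a, p a b₁ + p a b₂ = 1 / 2 * ∑ b, p a b := by
    intro a
    have := hs (fun b => p a b)
    have := hhalf a
    linarith
  have n1 := h.unit_right b₁
  have n2 := h.unit_right b₂
  rw [hz b₁ hb₁.symm] at n1
  rw [hz b₂ hb₂] at n2
  -- If `a` occurred with both, its transverse part would be orthogonal to all three axes `v`, hence
  -- zero, and `u a` would lie along $z$.
  have hex : ∀ a, p a b₁ = 0 ∨ p a b₂ = 0 := by
    intro a
    by_contra hc
    push Not at hc
    have e1 := (mul_eq_zero.1 (ho a b₁)).resolve_left hc.1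
    have e2 := (mul_eq_zero.1 (ho a b₂)).resolve_left hc.2
    have := eq_zero_of_orthogonal hr.det_right ![u a 0, u a 1, 0] (fun b => by
      rw [Fin.sum_univ_three]
      simp only [Matrix.cons_val]
      have hb : b = b₀ ∨ b = b₁ ∨ b = b₂ := by
        have := hs (fun x => if x = b then 1 else 0)
        by_contra hn
        push Not at hn
        simp [hn.1.symm, hn.2.1.symm, hn.2.2.symm] at this
      rcases hb with rfl | rfl | rfl
      · rw [h0, h1]; ring
      · linarith
      · linarith)
    have t0 := this 0
    have t1 := this 1
    simp only [Matrix.cons_val] at t0 t1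
    exact hu a ⟨t0, t1⟩
  have hpos := hr.pos_left
  have hp1 := hr.pos_right b₁
  have hp2 := hr.pos_right b₂
  -- one of the two remaining messages is possible with a single message of the other node
  have core : ∀ c₁ c₂ : Fin 3, c₁ ≠ b₀ → c₂ ≠ b₀ →
      (∀ f : Fin 3 → ℝ, ∑ x, f x = f c₁ + f c₂ + f b₀) →
      (∀ a, p a c₁ + p a c₂ = 1 / 2 * ∑ b, p a b) → ∀ a₀, p a₀ c₂ = 0 →
      (∀ a, a ≠ a₀ → p a c₁ = 0) → False := by
    intro c₁ c₂ hc1 hc2 hsc hrc a₀ hz2 hz1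
    have q1 : p a₀ c₁ = 1 / 2 * ∑ b, p a₀ b := by linarith [hrc a₀]
    refine h.polar_mixed_core hr h0 h1 hc1 hc2 hsc (a₀ := a₀) ?_ ?_ ?_
    · rw [Finset.sum_eq_single a₀ (fun a _ ha => hz1 a ha) (by simp), q1]
    · intro a ha
      refine (mul_eq_zero.1 (ho a c₂)).resolve_left ?_
      have := hrc a
      rw [hz1 a ha] at this
      have := hpos a
      linarith
    · refine (mul_eq_zero.1 (ho a₀ c₁)).resolve_left ?_
      have := hpos a₀
      linarith
  have core1 := core b₁ b₂ hb₁.symm hb₂ (fun f => by rw [hs f]; ring) hrest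
  have core2 := core b₂ b₁ hb₂ hb₁.symm (fun f => by rw [hs f]; ring) (fun a => by rw [← hrest a]; ring)
  rw [Fin.sum_univ_three] at hp1 hp2
  have all : ∀ P : Fin 3 → Prop, P 0 → P 1 → P 2 → ∀ a, P a := by
    intro P x y z a; fin_cases a <;> assumption
  -- Each of the three messages `a` misses `b₁` or `b₂`. Since `b₁` and `b₂` both occur, one of them
  -- occurs with a single `a`.
  rcases hex 0 with e0 | e0 <;> rcases hex 1 with e1 | e1 <;> rcases hex 2 with e2 | e2
  · linarith
  · exact core1 2 e2 (all _ (fun _ => e0) (fun _ => e1) (fun h => absurd rfl h))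
  · exact core1 1 e1 (all _ (fun _ => e0) (fun h => absurd rfl h) (fun _ => e2))
  · exact core2 0 e0 (all _ (fun h => absurd rfl h) (fun _ => e1) (fun _ => e2))
  · exact core1 0 e0 (all _ (fun h => absurd rfl h) (fun _ => e1) (fun _ => e2))
  · exact core2 1 e1 (all _ (fun _ => e0) (fun h => absurd rfl h) (fun _ => e2))
  · exact core2 2 e2 (all _ (fun _ => e0) (fun _ => e1) (fun h => absurd rfl h))
  · linarith

theorem polar_polar (h : AxisPair κ u v p) (hr : Regular u v p) (hκ : κ ≠ 0) {a₀ b₀ : Fin 3}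
    (hu0 : u a₀ 0 = 0) (hu1 : u a₀ 1 = 0) (h0 : v b₀ 0 = 0) (h1 : v b₀ 1 = 0) :
    p a₀ b₀ = 1 / 4 := by
  have hi := h.polar_independent hr hκ h0 h1 a₀
  have hz := h.unit_left a₀
  rw [hu0, hu1] at hz
  have hne : u a₀ 2 ≠ 0 := by intro e; rw [e] at hz; norm_num at hz
  have := (mul_eq_zero.1 hi).resolve_right hne
  have h3 := (h.swap.polar_right hr.swap hu0 hu1).1
  rw [h3] at this
  linarith

/-! ### A node whose axes all have squared z component 1/2 -/

/-- A node all of whose axes have the polar angle `π/4` or `3π/4` excludes any other node without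
the polar axis. -/
theorem not_centered (h : AxisPair κ u v p) (hr : Regular u v p) (hκ : κ ≠ 0)
    (hv : ∀ b, v b 2 ^ 2 = 1 / 2) (hu : ∀ a, ¬ (u a 0 = 0 ∧ u a 1 = 0)) : False := by
  -- With $v_z^2=1/2$ throughout, the terms with `κ` in the moment $(2,2)$ cancel and leave the
  -- mixed expectation equal to zero.
  have ho := h.orthogonal_of_expect_eq_zero (by
    have m := h.moment 2 2
    have l := h.left_moment 2
    have r := h.right_moment 2
    have e : expect p (fun a b => (2 * (u a 0 * v b 0 + u a 1 * v b 1) + κ * (u a 2 * v b 2)) *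
        (u a 2 * v b 2)) =
        2 * expect p (fun a b => (u a 0 * v b 0 + u a 1 * v b 1) * (u a 2 * v b 2)) +
          κ / 2 * expect p (fun a _ => u a 2 * u a 2) := by
      simp only [expect, Finset.mul_sum, ← Finset.sum_add_distrib]
      refine Finset.sum_congr rfl fun a _ => Finset.sum_congr rfl fun b _ => ?_
      linear_combination p a b * κ * u a 2 ^ 2 * hv b
    rw [e, l, r] at m
    simp only [wWeight, Matrix.cons_val, if_true] at m
    linarith)
  have hvne : ∀ b, v b 2 ≠ 0 := by
    intro b e
    have := hv b
    rw [e] at this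
    norm_num at this
  -- The transverse parts weighted by $P(b)v_{b,z}$ sum to zero, so orthogonality to two of them
  -- implies orthogonality to the third, and `u a` would lie along $z$. The possible pairs of
  -- messages are therefore the graph of a bijection `τ`.
  have hex : ∀ a b b', b ≠ b' → p a b ≠ 0 → p a b' = 0 := by
    intro a b b' hbb hb
    by_contra hb'
    have e1 := (mul_eq_zero.1 (ho a b)).resolve_left hb
    have e2 := (mul_eq_zero.1 (ho a b')).resolve_left hb'
    obtain ⟨c, hc1, hc2, hs⟩ := exists_third hbb
    have e3 : u a 0 * v c 0 + u a 1 * v c 1 = 0 := by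
      have r0 := h.right_sum 0
      have r1 := h.right_sum 1
      rw [hs] at r0 r1
      simp only [Fin.isValue, Fin.reduceEq, if_false] at r0 r1
      have : ((∑ a, p a c) * v c 2) * (u a 0 * v c 0 + u a 1 * v c 1) = 0 := by
        linear_combination u a 0 * r0 + u a 1 * r1 - (∑ a, p a b) * v b 2 * e1 -
          (∑ a, p a b') * v b' 2 * e2
      exact (mul_eq_zero.1 this).resolve_left (mul_ne_zero (hr.pos_right c).ne' (hvne c))
    have := eq_zero_of_orthogonal hr.det_right ![u a 0, u a 1, 0] (fun x => by
      rw [Fin.sum_univ_three]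
      simp only [Matrix.cons_val]
      have hb : x = b ∨ x = b' ∨ x = c := by
        have := hs (fun y => if y = x then 1 else 0)
        by_contra hn
        push Not at hn
        simp [hn.1.symm, hn.2.1.symm, hn.2.2.symm] at this
      rcases hb with rfl | rfl | rfl <;> linarith)
    have t0 := this 0
    have t1 := this 1
    simp only [Matrix.cons_val] at t0 t1
    exact hu a ⟨t0, t1⟩
  have hsome : ∀ b, ∃ a, p a b ≠ 0 := by
    intro b
    by_contra hn
    push Not at hn
    have := hr.pos_right b
    simp [hn] at this
  choose τ hτ using hsome
  have hinj : τ.Injective := by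
    intro b b' hbb
    by_contra hne
    have := hex (τ b) b b' hne (hτ b)
    rw [hbb] at this
    exact hτ b' this
  have hbij : τ.Bijective := Finite.injective_iff_bijective.1 hinj
  have hcol : ∀ b a, a ≠ τ b → p a b = 0 := by
    intro b a ha
    obtain ⟨b', rfl⟩ := hbij.2 a
    exact hex (τ b') b' b (fun e => ha (by rw [e])) (hτ b')
  have hsum : ∀ f : Fin 3 → Fin 3 → ℝ, expect p f = ∑ b, p (τ b) b * f (τ b) b := by
    intro f
    rw [expect, Finset.sum_comm]
    refine Finset.sum_congr rfl fun b _ => ?_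
    rw [Finset.sum_eq_single (τ b) (fun a _ ha => by rw [hcol b a ha, zero_mul]) (by simp)]
  have horth : ∀ b, u (τ b) 0 * v b 0 + u (τ b) 1 * v b 1 = 0 := fun b =>
    (mul_eq_zero.1 (ho (τ b) b)).resolve_left (hτ b)
  have r := h.right_moment
  have hm := h.moment_of_orthogonal ho
  simp only [hsum] at r
  -- the other node has the same polar angles
  have hu2 : ∀ b, u (τ b) 2 ^ 2 = 1 / 2 := by
    intro b
    have := eq_zero_of_comb hr.det_right
      (fun b => p (τ b) b * (u (τ b) 2 ^ 2 - 1 / 2) * v b 2) (fun i => by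
        have m := hm 2 i
        have l := h.left_moment i
        have e2 : expect p (fun _ b => v b 2 * v b i) = if i = 2 then 1 / 2 else 0 := h.right_moment i
        rw [l, e2, hsum] at m
        have goal : ∑ b, p (τ b) b * (u (τ b) 2 ^ 2 * (v b 2 * v b i)) =
            1 / 2 * if i = 2 then 1 / 2 else 0 := by
          apply mul_left_cancel₀ hκ
          rw [← mul_assoc κ (1 / 2)]
          have : κ * ∑ b, p (τ b) b * (u (τ b) 2 ^ 2 * (v b 2 * v b i)) =
            κ * ∑ b, p (τ b) b * (u (τ b) 2 * v b 2 * (u (τ b) 2 * v b i)) := by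
              congr 1
              exact Finset.sum_congr rfl fun b _ => by ring
          rw [this, m]
          fin_cases i <;> simp [wWeight]
          ring
        calc _ = ∑ b, p (τ b) b * (u (τ b) 2 ^ 2 * (v b 2 * v b i)) -
              1 / 2 * ∑ b, p (τ b) b * (v b 2 * v b i) := by
              rw [Finset.mul_sum, ← Finset.sum_sub_distrib]
              exact Finset.sum_congr rfl fun b _ => by ring
          _ = 0 := by rw [goal, r i, sub_self]) b
    rcases mul_eq_zero.1 this with e | e
    · linarith [(mul_eq_zero.1 e).resolve_left (hτ b)]
    · exact absurd e (hvne b)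
  -- `χ b` is the oriented area spanned by the orthogonal components
  set χ : Fin 3 → ℝ := fun b => u (τ b) 0 * v b 1 - u (τ b) 1 * v b 0 with hχ
  have hv01 : ∀ b, v b 0 ^ 2 + v b 1 ^ 2 = 1 / 2 := fun b => by linarith [h.unit_right b, hv b]
  have hu01 : ∀ b, u (τ b) 0 ^ 2 + u (τ b) 1 ^ 2 = 1 / 2 := fun b => by
    linarith [h.unit_left (τ b), hu2 b]
  have hχ2 : ∀ b, χ b ^ 2 = 1 / 4 := by
    intro b
    have : (u (τ b) 0 ^ 2 + u (τ b) 1 ^ 2) * (v b 0 ^ 2 + v b 1 ^ 2) = 1 / 4 := by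
      rw [hv01, hu01]; norm_num
    simp only [hχ]
    linear_combination this - (u (τ b) 0 * v b 0 + u (τ b) 1 * v b 1) * horth b
  have hu0 : ∀ b, u (τ b) 0 = 2 * χ b * v b 1 := by
    intro b
    simp only [hχ]
    linear_combination -2 * u (τ b) 0 * hv01 b + 2 * v b 0 * horth b
  have hu1 : ∀ b, u (τ b) 1 = -2 * χ b * v b 0 := by
    intro b
    simp only [hχ]
    linear_combination -2 * u (τ b) 1 * hv01 b + 2 * v b 1 * horth b
  -- The right sides of the moments $(0,1)$ and $(1,0)$ agree, so the antisymmetric part of the left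
  -- side vanishes.
  have hS : ∑ b, p (τ b) b * (u (τ b) 2 * v b 2 * χ b) = 0 := by
    have m01 := hm 0 1
    have m10 := hm 1 0
    have c1 : expect p (fun a _ => u a 1 * u a 0) = expect p (fun a _ => u a 0 * u a 1) := by
      simp only [mul_comm]
    have c2 : expect p (fun _ b => v b 1 * v b 0) = expect p (fun _ b => v b 0 * v b 1) := by
      simp only [mul_comm]
    rw [c1, c2] at m10
    simp only [wWeight, Matrix.cons_val, Fin.isValue, Fin.reduceEq, if_false] at m01 m10
    rw [hsum] at m01 m10
    apply mul_left_cancel₀ hκ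
    calc _ = κ * ∑ b, p (τ b) b * (u (τ b) 2 * v b 2 * (u (τ b) 0 * v b 1)) -
          κ * ∑ b, p (τ b) b * (u (τ b) 2 * v b 2 * (u (τ b) 1 * v b 0)) := by
          rw [← mul_sub, ← Finset.sum_sub_distrib]
          congr 1
          refine Finset.sum_congr rfl fun b _ => ?_
          simp only [hχ]
          ring
      _ = κ * 0 := by rw [m01, m10]; ring
  have hl : ∀ i, ∑ b, p (τ b) b * (u (τ b) 2 * u (τ b) i) = if i = 2 then 1 / 2 else 0 := fun i => by
    rw [← h.left_moment i, hsum]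
  -- The transverse part of $u_{\tau b}$ is $2\chi_b$ times that of $v_b$ turned by a right angle.
  -- The left moments thus give the two transverse components of $\sum_b p_bu_{\tau
  -- b,z}\chi_bv_b=0$, and `hS` is the third. By independence every coefficient vanishes, although
  -- no factor of them does.
  have key := eq_zero_of_comb hr.det_right (fun b => p (τ b) b * (u (τ b) 2 * χ b)) (fun i => by
    fin_cases i
    · have := hl 1
      simp only [hu1, Fin.isValue, Fin.reduceEq, if_false] at this
      have e : ∑ b, p (τ b) b * (u (τ b) 2 * (-2 * χ b * v b 0)) =
          -2 * ∑ b, p (τ b) b * (u (τ b) 2 * χ b) * v b 0 := by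
        rw [Finset.mul_sum]
        exact Finset.sum_congr rfl fun b _ => by ring
      rw [e] at this
      simpa using this
    · have := hl 0
      simp only [hu0, Fin.isValue, Fin.reduceEq, if_false] at this
      have e : ∑ b, p (τ b) b * (u (τ b) 2 * (2 * χ b * v b 1)) =
          2 * ∑ b, p (τ b) b * (u (τ b) 2 * χ b) * v b 1 := by
        rw [Finset.mul_sum]
        exact Finset.sum_congr rfl fun b _ => by ring
      rw [e] at this
      simpa using this
    · rw [← hS]
      exact Finset.sum_congr rfl fun b _ => by simp only [Fin.reduceFinMk, Fin.isValue]; ring) 0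
  simp only [mul_eq_zero] at key
  rcases key with e | e | e
  · exact hτ 0 e
  · have := hu2 0; rw [e] at this; norm_num at this
  · have := hχ2 0; rw [e] at this; norm_num at this

end AxisPair

/-! ### The axes of a protocol and their one- and two-body correlators -/

/-- The action of the half-turn about the axis `u` on a vector. -/
noncomputable def halfTurn (u : Fin 3 → ℝ) (m : Fin 3 → ℂ) : Fin 3 → ℂ :=
  fun i => 2 * (∑ j, u j * m j) * u i - m i

theorem pauliVec_conj {u : Fin 3 → ℝ} (hu : u ⬝ᵥ u = 1) (m : Fin 3 → ℂ) :
    pauliVec (cvec u) * pauliVec m * pauliVec (cvec u) = pauliVec (halfTurn u m) := by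
  have h : (u 0 : ℂ) * u 0 + u 1 * u 1 + u 2 * u 2 = 1 := by
    rw [dotProduct, Fin.sum_univ_three] at hu
    exact_mod_cast hu
  have hI : Complex.I ^ 2 = -1 := Complex.I_sq
  ext i j
  fin_cases i <;> fin_cases j <;>
    simp [pauliVec, cvec, halfTurn, Matrix.mul_apply, Fin.sum_univ_two, Fin.sum_univ_three]
  · linear_combination -m 2 * h + (-2 * u 2 * u 1 * m 1 + u 1 ^ 2 * m 2) * hI
  · linear_combination -(m 0 - Complex.I * m 1) * h +
      (-2 * (u 0 - Complex.I * u 1) * u 1 * m 1 + u 1 ^ 2 * (m 0 - Complex.I * m 1)) * hI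
  · linear_combination -(m 0 + Complex.I * m 1) * h +
      (-2 * (u 0 + Complex.I * u 1) * u 1 * m 1 + u 1 ^ 2 * (m 0 + Complex.I * m 1)) * hI
  · linear_combination m 2 * h - (-2 * u 2 * u 1 * m 1 + u 1 ^ 2 * m 2) * hI

/-- The data of an end node with at most three messages: its recoveries are half-turns in a
suitable frame of its qubit. -/
structure HalfTurns {N : ℕ} (P : Protocol N) (k : Fin N) where
  /-- the message, numbered from `0` -/
  label : Bits N → Fin 3
  label_eq : ∀ s, (P.msg k s : ℕ) = label s + 1
  /-- the axes of the half-turns -/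
  axis : Fin 3 → Fin 3 → ℝ
  unit : ∀ a, axis a ⬝ᵥ axis a = 1
  /-- the frame of the qubit -/
  frame : Matrix (Fin 2) (Fin 2) ℂ
  frame_unitary : frame * frameᴴ = 1
  sandwich : ∀ s H, (P.recovery k (P.msg k s) : Matrix (Fin 2) (Fin 2) ℂ) * (frameᴴ * H * frame) *
      (P.recovery k (P.msg k s) : Matrix (Fin 2) (Fin 2) ℂ)ᴴ =
    pauliVec (cvec (axis (label s))) * H * pauliVec (cvec (axis (label s)))

theorem exists_halfTurns {N : ℕ} (P : Protocol N) (k : Fin N) (h : ∀ s, (P.msg k s : ℕ) ≤ 3) :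
    Nonempty (HalfTurns P k) := by
  have hl : ∀ s, (P.msg k s : ℕ) - 1 < 3 := fun s => by have := h s; have := (P.msg k s).pos; omega
  obtain ⟨V, u, hV, hu, hR⟩ := exists_axes (fun a => P.recovery k (Nat.succPNat a))
  have e : ∀ s, Nat.succPNat ((⟨(P.msg k s : ℕ) - 1, hl s⟩ : Fin 3) : ℕ) = P.msg k s := by
    intro s
    apply PNat.eq
    have := (P.msg k s).pos
    simp only [Nat.succPNat_coe]
    omega
  refine ⟨⟨fun s => ⟨(P.msg k s : ℕ) - 1, hl s⟩, fun s => ?_, u, hu, V, hV, fun s H => ?_⟩⟩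
  · have := (P.msg k s).pos
    simp only
    omega
  · have := hR ⟨(P.msg k s : ℕ) - 1, hl s⟩ H
    rw [e] at this
    exact this

theorem trace_frame {V : Matrix (Fin 2) (Fin 2) ℂ} (hV : V * Vᴴ = 1) (H : Matrix (Fin 2) (Fin 2) ℂ) :
    (Vᴴ * H * V).trace = H.trace := by
  rw [Matrix.mul_assoc, Matrix.trace_mul_comm, Matrix.mul_assoc, hV, Matrix.mul_one]

theorem pauliVec_trace (m : Fin 3 → ℂ) : (pauliVec m).trace = 0 := by
  simp [pauliVec, Matrix.trace_fin_two]

namespace HalfTurns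

variable {N : ℕ} {P : Protocol N} {i j : Fin N}

theorem sandwich_pauliVec (D : HalfTurns P i) (s : Bits N) (m : Fin 3 → ℂ) :
    (P.recovery i (P.msg i s) : Matrix (Fin 2) (Fin 2) ℂ) * (D.frameᴴ * pauliVec m * D.frame) *
      (P.recovery i (P.msg i s) : Matrix (Fin 2) (Fin 2) ℂ)ᴴ =
    pauliVec (halfTurn (D.axis (D.label s)) m) := by
  rw [D.sandwich, pauliVec_conj (D.unit _)]

/-- The probability of a message. -/
noncomputable def prob (D : HalfTurns P i) (a : Fin 3) : ℝ :=
  ∑ s : Bits N, if D.label s = a then (1 / 2 ^ N : ℝ) else 0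

/-- The joint probability of the messages of two nodes. -/
noncomputable def joint (D : HalfTurns P i) (D' : HalfTurns P j) (a b : Fin 3) : ℝ :=
  ∑ s : Bits N, if D.label s = a ∧ D'.label s = b then (1 / 2 ^ N : ℝ) else 0

theorem expect_joint (D : HalfTurns P i) (D' : HalfTurns P j) (f : Fin 3 → Fin 3 → ℝ) :
    expect (D.joint D') f = (1 / 2 ^ N : ℝ) * ∑ s : Bits N, f (D.label s) (D'.label s) := by
  simp only [expect, joint, Finset.sum_mul, Finset.mul_sum]
  rw [Finset.sum_comm' (t' := Finset.univ) (s' := fun _ => Finset.univ) (by simp)]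
  rw [Finset.sum_congr rfl fun b _ => Finset.sum_comm, Finset.sum_comm]
  refine Finset.sum_congr rfl fun s _ => ?_
  rw [Finset.sum_eq_single (D'.label s), Finset.sum_eq_single (D.label s)]
  · simp
  · intro a _ ha; simp [ha.symm]
  · simp
  · intro b _ hb
    exact Finset.sum_eq_zero fun a _ => by simp [hb.symm]
  · simp

theorem sum_prob (D : HalfTurns P i) (f : Fin 3 → ℝ) :
    ∑ a, D.prob a * f a = (1 / 2 ^ N : ℝ) * ∑ s : Bits N, f (D.label s) := by
  simp only [prob, Finset.sum_mul, Finset.mul_sum]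
  rw [Finset.sum_comm]
  refine Finset.sum_congr rfl fun s _ => ?_
  rw [Finset.sum_eq_single (D.label s)]
  · simp
  · intro a _ ha; simp [ha.symm]
  · simp

theorem expect_left (D : HalfTurns P i) (D' : HalfTurns P j) (f : Fin 3 → ℝ) :
    expect (D.joint D') (fun a _ => f a) = ∑ a, D.prob a * f a := by
  rw [expect_joint, sum_prob]

theorem expect_right (D : HalfTurns P i) (D' : HalfTurns P j) (f : Fin 3 → ℝ) :
    expect (D.joint D') (fun _ b => f b) = ∑ b, D'.prob b * f b := by
  rw [expect_joint, sum_prob]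

theorem prob_nonneg (D : HalfTurns P i) (a : Fin 3) : 0 ≤ D.prob a :=
  Finset.sum_nonneg fun s _ => by split_ifs <;> positivity

theorem joint_nonneg (D : HalfTurns P i) (D' : HalfTurns P j) (a b : Fin 3) : 0 ≤ D.joint D' a b :=
  Finset.sum_nonneg fun s _ => by split_ifs <;> positivity

theorem joint_left (D : HalfTurns P i) (D' : HalfTurns P j) (a : Fin 3) :
    ∑ b, D.joint D' a b = D.prob a := by
  have := D.expect_left D' (fun x => if x = a then 1 else 0)
  simpa [expect] using this

theorem joint_right (D : HalfTurns P i) (D' : HalfTurns P j) (b : Fin 3) :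
    ∑ a, D.joint D' a b = D'.prob b := by
  have := D.expect_right D' (fun x => if x = b then 1 else 0)
  simpa [expect] using this

theorem sum_one (N : ℕ) : (1 / 2 ^ N : ℝ) * ∑ _s : Bits N, (1 : ℝ) = 1 := by
  simp

theorem sum_prob_one (D : HalfTurns P i) : ∑ a, D.prob a = 1 := by
  have := D.sum_prob (fun _ => 1)
  rw [sum_one] at this
  simpa using this

/-- One-body correlators. -/
theorem moment_one (hN : 3 ≤ N) (hP : P.Distributes (pure (wState N))) (D : HalfTurns P i) (c : Fin 3) :
    ∑ a, D.prob a * (D.axis a 2 * D.axis a c) = if c = 2 then 1 / 2 else 0 := by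
  have h := sum_sandwich_extend (by omega) P hP (g := fun _ : Fin 1 => i)
    (fun a b _ => Subsingleton.elim a b) (fun _ => D.frameᴴ * pauliVec (Pi.single c 1) * D.frame)
    (fun s _ => pauliVec (halfTurn (D.axis (D.label s)) (Pi.single c 1)))
    (fun s _ => D.sandwich_pauliVec s _)
  simp only [Fintype.prod_subsingleton _ (0 : Fin 1), Fintype.sum_subsingleton _ (0 : Fin 1),
    trace_frame D.frame_unitary, pauliVec_trace] at h
  have e : ∀ s, ((N : ℂ) - (1 : ℕ)) * pauliVec (halfTurn (D.axis (D.label s)) (Pi.single c 1)) 0 0 +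
      pauliVec (halfTurn (D.axis (D.label s)) (Pi.single c 1)) (spike (0 : Fin 1) 0) (spike (0 : Fin 1) 0) =
      (((N - 2) * (2 * (D.axis (D.label s) 2 * D.axis (D.label s) c) - if c = 2 then 1 else 0) : ℝ) : ℂ) := by
    intro s
    have hs : spike (0 : Fin 1) 0 = 1 := by simp [spike]
    rw [hs]
    simp only [pauliVec, halfTurn, Matrix.of_apply, Matrix.cons_val', Matrix.cons_val_zero,
      Matrix.cons_val_one, Matrix.cons_val_fin_one, Pi.single_apply, mul_ite, mul_one, mul_zero,
      Finset.sum_ite_eq', Finset.mem_univ, if_true]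
    by_cases hc : c = 2
    · subst hc; push_cast; simp; ring
    · simp [hc, Ne.symm hc]; ring
  simp only [e] at h
  rw [← Complex.ofReal_sum] at h
  have h2 : ∑ s : Bits N, ((N : ℝ) - 2) * (2 * (D.axis (D.label s) 2 * D.axis (D.label s) c) -
      if c = 2 then 1 else 0) = 0 := by
    have : ((∑ s : Bits N, ((N : ℝ) - 2) * (2 * (D.axis (D.label s) 2 * D.axis (D.label s) c) -
      if c = 2 then 1 else 0) : ℝ) : ℂ) = 0 := by rw [h]; simp
    exact_mod_cast this
  rw [← Finset.mul_sum] at h2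
  -- One-body correlators carry the factor $N\langle Z\rangle=N-2$ of the W state, hence the
  -- restriction to $N\ge3$.
  have hN' : (N : ℝ) - 2 ≠ 0 := by
    have : (3 : ℝ) ≤ N := by exact_mod_cast hN
    linarith
  have h3 := (mul_eq_zero.1 h2).resolve_left hN'
  rw [Finset.sum_sub_distrib, ← Finset.mul_sum] at h3
  rw [D.sum_prob (fun a => D.axis a 2 * D.axis a c)]
  have h4 := sum_one N
  split_ifs at h3 ⊢ with hc
  · linear_combination (1 / 2) * (1 / 2 ^ N : ℝ) * h3 + (1 / 2) * h4
  · simp only [Finset.sum_const_zero] at h3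
    linear_combination (1 / 2) * (1 / 2 ^ N : ℝ) * h3

/-- Two-body correlators. -/
theorem moment_two (hN : 0 < N) (hP : P.Distributes (pure (wState N))) (hij : i ≠ j)
    (D : HalfTurns P i) (D' : HalfTurns P j) (m m' : Fin 3 → ℂ) :
    ∑ s : Bits N, (2 * (halfTurn (D.axis (D.label s)) m 0 * halfTurn (D'.axis (D'.label s)) m' 0 +
      halfTurn (D.axis (D.label s)) m 1 * halfTurn (D'.axis (D'.label s)) m' 1) + ((N : ℂ) - 4) *
      (halfTurn (D.axis (D.label s)) m 2 * halfTurn (D'.axis (D'.label s)) m' 2)) = 0 := by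
  have hg : Function.Injective ![i, j] := by
    intro a b h
    fin_cases a <;> fin_cases b <;> simp_all
  have h := sum_sandwich_extend hN P hP hg
    ![D.frameᴴ * pauliVec m * D.frame, D'.frameᴴ * pauliVec m' * D'.frame]
    (fun s => ![pauliVec (halfTurn (D.axis (D.label s)) m), pauliVec (halfTurn (D'.axis (D'.label s)) m')])
    (fun s t => by
      fin_cases t
      · exact D.sandwich_pauliVec s m
      · exact D'.sandwich_pauliVec s m')
  simp only [Fin.prod_univ_two, Fin.sum_univ_two, Matrix.cons_val_zero, Matrix.cons_val_one,
    Matrix.cons_val_fin_one, trace_frame D.frame_unitary, pauliVec_trace, zero_div, zero_mul, mul_zero] at h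
  rw [← h]
  refine Finset.sum_congr rfl fun s _ => ?_
  simp [spike, pauliVec]
  linear_combination (2 * halfTurn (D.axis (D.label s)) m 1 * halfTurn (D'.axis (D'.label s)) m' 1) *
    Complex.I_sq

/-- A half-turn takes the basis vector $e_c$ to $2u_cu-e_c$. Expanding the two-body correlators of
$e_c$ and $e_d$, with weights $2,2,N-4$ from $N\langle XX\rangle,N\langle YY\rangle,N\langle
ZZ\rangle$, yields the field `moment`. -/
theorem axisPair (hN : 3 ≤ N) (hP : P.Distributes (pure (wState N))) (hij : i ≠ j)
    (D : HalfTurns P i) (D' : HalfTurns P j) :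
    AxisPair ((N : ℝ) - 4) D.axis D'.axis (D.joint D') where
  unit_left a := by have := D.unit a; rw [dotProduct, Fin.sum_univ_three] at this; linarith
  unit_right a := by have := D'.unit a; rw [dotProduct, Fin.sum_univ_three] at this; linarith
  nonneg := D.joint_nonneg D'
  total := by rw [D.expect_left D' (fun _ => 1)]; simpa using D.sum_prob_one
  left_moment c := by rw [D.expect_left D' (fun a => D.axis a 2 * D.axis a c)]; exact D.moment_one hN hP c
  right_moment c := by
    rw [D.expect_right D' (fun a => D'.axis a 2 * D'.axis a c)]; exact D'.moment_one hN hP c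
  moment c d := by
    have h := moment_two (by omega) hP hij D D' (Pi.single c 1) (Pi.single d 1)
    have e : ∀ (u : Fin 3 → ℝ) (x y : Fin 3), halfTurn u (Pi.single x 1) y =
        ((2 * (u x * u y) - if x = y then 1 else 0 : ℝ) : ℂ) := by
      intro u x y
      simp only [halfTurn, Pi.single_apply, mul_ite, mul_one, mul_zero, Finset.sum_ite_eq',
        Finset.mem_univ, if_true]
      by_cases hxy : x = y
      · simp [hxy]; ring
      · simp [hxy, Ne.symm hxy]; ring
    simp only [e] at h
    have h2 : ∑ s : Bits N, (4 * ((2 * (D.axis (D.label s) 0 * D'.axis (D'.label s) 0 +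
        D.axis (D.label s) 1 * D'.axis (D'.label s) 1) + ((N : ℝ) - 4) *
        (D.axis (D.label s) 2 * D'.axis (D'.label s) 2)) *
        (D.axis (D.label s) c * D'.axis (D'.label s) d)) -
        2 * wWeight ((N : ℝ) - 4) d * (D.axis (D.label s) c * D.axis (D.label s) d) -
        2 * wWeight ((N : ℝ) - 4) c * (D'.axis (D'.label s) c * D'.axis (D'.label s) d) +
        if c = d then wWeight ((N : ℝ) - 4) c else 0) = 0 := by
      rw [← Complex.ofReal_inj, Complex.ofReal_zero, ← h, Complex.ofReal_sum]
      refine Finset.sum_congr rfl fun s _ => ?_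
      fin_cases c <;> fin_cases d <;> simp [wWeight] <;> ring
    simp only [expect_joint]
    simp only [Finset.sum_add_distrib, Finset.sum_sub_distrib, ← Finset.mul_sum] at h2
    have h4 := sum_one N
    split_ifs at h2 ⊢ with hcd
    · have e2 : ∑ _s : Bits N, wWeight ((N : ℝ) - 4) c = wWeight ((N : ℝ) - 4) c * ∑ _s : Bits N, (1 : ℝ) := by
        rw [Finset.mul_sum]; simp
      rw [e2] at h2
      linear_combination (1 / 4) * (1 / 2 ^ N : ℝ) * h2 - (1 / 4) * wWeight ((N : ℝ) - 4) c * h4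
    · simp only [Finset.sum_const_zero] at h2
      linear_combination (1 / 4) * (1 / 2 ^ N : ℝ) * h2

end HalfTurns

/-! ### Degenerate nodes -/

/-- A degenerate second moment has a null direction, which is orthogonal to all possible axes. -/
theorem exists_null_of_planeDet {p : Fin 3 → ℝ} (hp : ∀ a, 0 ≤ p a) {u : Fin 3 → Fin 3 → ℝ}
    (h : planeDet p u = 0) :
    ∃ e₀ e₁ : ℝ, (e₀ ≠ 0 ∨ e₁ ≠ 0) ∧ ∀ a, p a * (e₀ * u a 0 + e₁ * u a 1) = 0 := by
  have key : ∀ e₀ e₁ : ℝ, e₀ ^ 2 * (∑ a, p a * u a 0 ^ 2) + 2 * (e₀ * e₁) * (∑ a, p a * (u a 0 * u a 1)) +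
      e₁ ^ 2 * (∑ a, p a * u a 1 ^ 2) = 0 → ∀ a, p a * (e₀ * u a 0 + e₁ * u a 1) = 0 := by
    intro e₀ e₁ he a
    have h1 : ∑ a, p a * (e₀ * u a 0 + e₁ * u a 1) ^ 2 = 0 := by
      rw [← he]
      simp only [Finset.mul_sum, ← Finset.sum_add_distrib]
      exact Finset.sum_congr rfl fun a _ => by ring
    have h2 := (Finset.sum_eq_zero_iff_of_nonneg (fun a _ =>
      mul_nonneg (hp a) (sq_nonneg _))).1 h1 a (Finset.mem_univ a)
    rcases mul_eq_zero.1 h2 with h3 | h3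
    · rw [h3, zero_mul]
    · rw [pow_eq_zero_iff two_ne_zero |>.1 h3, mul_zero]
  rw [planeDet] at h
  by_cases h0 : ∑ a, p a * u a 0 ^ 2 = 0
  · exact ⟨1, 0, Or.inl one_ne_zero, key 1 0 (by rw [h0]; ring)⟩
  · refine ⟨-∑ a, p a * (u a 0 * u a 1), ∑ a, p a * u a 0 ^ 2, Or.inr h0, key _ _ ?_⟩
    linear_combination (∑ a, p a * u a 0 ^ 2) * h

namespace AxisPair

variable {κ : ℝ} {u v : Fin 3 → Fin 3 → ℝ} {p : Fin 3 → Fin 3 → ℝ}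

/-- A null direction of one node is an eigendirection of the other. -/
theorem null_left (h : AxisPair κ u v p) {e₀ e₁ : ℝ}
    (he : ∀ a, (∑ b, p a b) * (e₀ * u a 0 + e₁ * u a 1) = 0) :
    e₀ * expect p (fun _ b => v b 0 * v b 0) + e₁ * expect p (fun _ b => v b 0 * v b 1) = e₀ / 2 ∧
    e₀ * expect p (fun _ b => v b 0 * v b 1) + e₁ * expect p (fun _ b => v b 1 * v b 1) = e₁ / 2 := by
  have hab : ∀ a b, p a b * (e₀ * u a 0 + e₁ * u a 1) = 0 := by
    intro a b
    rcases mul_eq_zero.1 (he a) with h1 | h1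
    · rw [(Finset.sum_eq_zero_iff_of_nonneg (fun b _ => h.nonneg a b)).1 h1 b (Finset.mem_univ b), zero_mul]
    · rw [h1, mul_zero]
  have l : ∀ j, e₀ * expect p (fun a _ => u a 0 * u a j) + e₁ * expect p (fun a _ => u a 1 * u a j) = 0 := by
    intro j
    simp only [expect, Finset.mul_sum, ← Finset.sum_add_distrib]
    refine Finset.sum_eq_zero fun a _ => Finset.sum_eq_zero fun b _ => ?_
    linear_combination u a j * hab a b
  have m : ∀ j, e₀ * expect p (fun a b => (2 * (u a 0 * v b 0 + u a 1 * v b 1) + κ * (u a 2 * v b 2)) *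
      (u a 0 * v b j)) + e₁ * expect p (fun a b => (2 * (u a 0 * v b 0 + u a 1 * v b 1) +
      κ * (u a 2 * v b 2)) * (u a 1 * v b j)) = 0 := by
    intro j
    simp only [expect, Finset.mul_sum, ← Finset.sum_add_distrib]
    refine Finset.sum_eq_zero fun a _ => Finset.sum_eq_zero fun b _ => ?_
    linear_combination (2 * (u a 0 * v b 0 + u a 1 * v b 1) + κ * (u a 2 * v b 2)) * v b j * hab a b
  have m0 := m 0
  have m1 := m 1
  rw [h.moment, h.moment] at m0 m1
  have c : expect p (fun _ b => v b 1 * v b 0) = expect p (fun _ b => v b 0 * v b 1) := by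
    simp only [mul_comm]
  simp only [wWeight, Matrix.cons_val, Fin.isValue, Fin.reduceEq, if_false, if_true, c] at m0 m1
  constructor
  · linear_combination m0 - l 0
  · linear_combination m1 - l 1

end AxisPair

namespace HalfTurns

variable {N : ℕ} {P : Protocol N} {i j k : Fin N}

theorem null_transfer (hN : 3 ≤ N) (hP : P.Distributes (pure (wState N))) (hij : i ≠ j)
    (D : HalfTurns P i) (D' : HalfTurns P j) {e₀ e₁ : ℝ}
    (he : ∀ a, D.prob a * (e₀ * D.axis a 0 + e₁ * D.axis a 1) = 0) :
    e₀ * (∑ a, D'.prob a * (D'.axis a 0 * D'.axis a 0)) +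
      e₁ * (∑ a, D'.prob a * (D'.axis a 0 * D'.axis a 1)) = e₀ / 2 ∧
    e₀ * (∑ a, D'.prob a * (D'.axis a 0 * D'.axis a 1)) +
      e₁ * (∑ a, D'.prob a * (D'.axis a 1 * D'.axis a 1)) = e₁ / 2 := by
  have := (D.axisPair hN hP hij D').null_left (e₀ := e₀) (e₁ := e₁)
    (fun a => by rw [joint_left]; exact he a)
  rwa [D.expect_right D' (fun b => D'.axis b 0 * D'.axis b 0),
    D.expect_right D' (fun b => D'.axis b 0 * D'.axis b 1),
    D.expect_right D' (fun b => D'.axis b 1 * D'.axis b 1)] at this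

theorem plane_trace (hN : 3 ≤ N) (hP : P.Distributes (pure (wState N))) (D : HalfTurns P i) :
    (∑ a, D.prob a * (D.axis a 0 * D.axis a 0)) + (∑ a, D.prob a * (D.axis a 1 * D.axis a 1)) =
      1 / 2 := by
  have h2 := D.moment_one hN hP 2
  have h1 := D.sum_prob_one
  rw [if_pos rfl] at h2
  have : (∑ a, D.prob a * (D.axis a 0 * D.axis a 0)) + (∑ a, D.prob a * (D.axis a 1 * D.axis a 1)) +
      (∑ a, D.prob a * (D.axis a 2 * D.axis a 2)) = ∑ a, D.prob a := by
    rw [← Finset.sum_add_distrib, ← Finset.sum_add_distrib]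
    refine Finset.sum_congr rfl fun a _ => ?_
    have := D.unit a
    rw [dotProduct, Fin.sum_univ_three] at this
    linear_combination D.prob a * this
  linarith

/-- Among three end nodes with at most three messages, none is degenerate. -/
theorem planeDet_ne_zero (hN : 3 ≤ N) (hP : P.Distributes (pure (wState N))) (hij : i ≠ j)
    (hik : i ≠ k) (hjk : j ≠ k) (D : HalfTurns P i) (D' : HalfTurns P j) (D'' : HalfTurns P k) :
    planeDet D.prob D.axis ≠ 0 := by
  intro h
  obtain ⟨e₀, e₁, hne, he⟩ := exists_null_of_planeDet D.prob_nonneg h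
  obtain ⟨a1, a2⟩ := D.null_transfer hN hP hij D' he
  obtain ⟨b1, b2⟩ := D.null_transfer hN hP hik D'' he
  have t1 := D'.plane_trace hN hP
  have t2 := D''.plane_trace hN hP
  -- The null direction $e$ of the first node has eigenvalue $1/2$ at the second, which is the whole
  -- trace; so the direction perpendicular to $e$ is null there.
  have hf : ∀ a, D'.prob a * (-e₁ * D'.axis a 0 + e₀ * D'.axis a 1) = 0 := by
    have h1 : ∑ a, D'.prob a * (-e₁ * D'.axis a 0 + e₀ * D'.axis a 1) ^ 2 = 0 := by
      have : ∑ a, D'.prob a * (-e₁ * D'.axis a 0 + e₀ * D'.axis a 1) ^ 2 =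
          e₁ ^ 2 * (∑ a, D'.prob a * (D'.axis a 0 * D'.axis a 0)) -
          2 * (e₀ * e₁) * (∑ a, D'.prob a * (D'.axis a 0 * D'.axis a 1)) +
          e₀ ^ 2 * (∑ a, D'.prob a * (D'.axis a 1 * D'.axis a 1)) := by
        simp only [Finset.mul_sum, ← Finset.sum_add_distrib, ← Finset.sum_sub_distrib]
        exact Finset.sum_congr rfl fun a _ => by ring
      rw [this]
      linear_combination (e₀ ^ 2 + e₁ ^ 2) * t1 - e₀ * a1 - e₁ * a2
    intro a
    have h2 := (Finset.sum_eq_zero_iff_of_nonneg (fun a _ =>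
      mul_nonneg (D'.prob_nonneg a) (sq_nonneg _))).1 h1 a (Finset.mem_univ a)
    rcases mul_eq_zero.1 h2 with h3 | h3
    · rw [h3, zero_mul]
    · rw [pow_eq_zero_iff two_ne_zero |>.1 h3, mul_zero]
  obtain ⟨c1, c2⟩ := D'.null_transfer hN hP hjk D'' hf
  -- The third node would have eigenvalue $1/2$ in both directions, against its trace $1/2$.
  have : e₀ ^ 2 + e₁ ^ 2 = 0 := by
    linear_combination 2 * (e₀ ^ 2 + e₁ ^ 2) * t2 - 2 * e₀ * b1 - 2 * e₁ * b2 + 2 * e₁ * c1 - 2 * e₀ * c2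
  rcases hne with h0 | h0
  · have := sq_nonneg e₁; have := pow_pos (abs_pos.2 h0) 2; rw [sq_abs] at this; linarith
  · have := sq_nonneg e₀; have := pow_pos (abs_pos.2 h0) 2; rw [sq_abs] at this; linarith

/-- Nondegeneracy: all three messages occur, and their axes are linearly independent. -/
theorem pos_and_det (hN : 3 ≤ N) (hP : P.Distributes (pure (wState N))) (D : HalfTurns P i)
    (h : planeDet D.prob D.axis ≠ 0) : (∀ a, 0 < D.prob a) ∧ (Matrix.of D.axis).det ≠ 0 := by
  rw [planeDet_eq _ _ (fun c => D.moment_one hN hP c)] at h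
  have h1 := right_ne_zero_of_mul h
  have h2 := left_ne_zero_of_mul h1
  have h3 := left_ne_zero_of_mul h2
  refine ⟨fun a => lt_of_le_of_ne (D.prob_nonneg a) (Ne.symm ?_), fun e => ?_⟩
  · fin_cases a
    · exact left_ne_zero_of_mul h3
    · exact right_ne_zero_of_mul h3
    · exact right_ne_zero_of_mul h2
  · exact right_ne_zero_of_mul h1 (by rw [e]; norm_num)

theorem regular (hN : 3 ≤ N) (hP : P.Distributes (pure (wState N))) (D : HalfTurns P i)
    (D' : HalfTurns P j) (h : planeDet D.prob D.axis ≠ 0) (h' : planeDet D'.prob D'.axis ≠ 0) :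
    AxisPair.Regular D.axis D'.axis (D.joint D') where
  pos_left a := by rw [joint_left]; exact (D.pos_and_det hN hP h).1 a
  pos_right b := by rw [joint_right]; exact (D'.pos_and_det hN hP h').1 b
  det_left := (D.pos_and_det hN hP h).2
  det_right := (D'.pos_and_det hN hP h').2

/-- A nondegenerate node receives the message `3`. -/
theorem exists_msg_eq_three (hN : 3 ≤ N) (hP : P.Distributes (pure (wState N))) (D : HalfTurns P i)
    (h : planeDet D.prob D.axis ≠ 0) : ∃ s, (P.msg i s : ℕ) = 3 := by
  have h2 := (D.pos_and_det hN hP h).1 2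
  by_contra hn
  push Not at hn
  refine h2.ne' (Finset.sum_eq_zero fun s _ => if_neg fun e => hn s ?_)
  rw [D.label_eq, e]; rfl

end HalfTurns

/-! ### Five nodes without an axis along z -/

/-- The terms of the W state on five qubits. -/
theorem sum_spike_five (A : Fin 5 → Matrix (Fin 2) (Fin 2) ℂ) :
    ∑ t, ∑ t', ∏ r, A r (spike t r) (spike t' r) =
      A 0 1 1 * A 1 0 0 * A 2 0 0 * A 3 0 0 * A 4 0 0 + A 0 0 0 * A 1 1 1 * A 2 0 0 * A 3 0 0 * A 4 0 0 +
      A 0 0 0 * A 1 0 0 * A 2 1 1 * A 3 0 0 * A 4 0 0 + A 0 0 0 * A 1 0 0 * A 2 0 0 * A 3 1 1 * A 4 0 0 +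
      A 0 0 0 * A 1 0 0 * A 2 0 0 * A 3 0 0 * A 4 1 1 +
      (A 0 1 0 * A 1 0 1 + A 0 0 1 * A 1 1 0) * A 2 0 0 * A 3 0 0 * A 4 0 0 +
      (A 0 1 0 * A 2 0 1 + A 0 0 1 * A 2 1 0) * A 1 0 0 * A 3 0 0 * A 4 0 0 +
      (A 0 1 0 * A 3 0 1 + A 0 0 1 * A 3 1 0) * A 1 0 0 * A 2 0 0 * A 4 0 0 +
      (A 0 1 0 * A 4 0 1 + A 0 0 1 * A 4 1 0) * A 1 0 0 * A 2 0 0 * A 3 0 0 +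
      (A 1 1 0 * A 2 0 1 + A 1 0 1 * A 2 1 0) * A 0 0 0 * A 3 0 0 * A 4 0 0 +
      (A 1 1 0 * A 3 0 1 + A 1 0 1 * A 3 1 0) * A 0 0 0 * A 2 0 0 * A 4 0 0 +
      (A 1 1 0 * A 4 0 1 + A 1 0 1 * A 4 1 0) * A 0 0 0 * A 2 0 0 * A 3 0 0 +
      (A 2 1 0 * A 3 0 1 + A 2 0 1 * A 3 1 0) * A 0 0 0 * A 1 0 0 * A 4 0 0 +
      (A 2 1 0 * A 4 0 1 + A 2 0 1 * A 4 1 0) * A 0 0 0 * A 1 0 0 * A 3 0 0 +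
      (A 3 1 0 * A 4 0 1 + A 3 0 1 * A 4 1 0) * A 0 0 0 * A 1 0 0 * A 2 0 0 := by
  simp only [Fin.sum_univ_five, Fin.prod_univ_five, spike, Fin.isValue, Fin.reduceEq, if_true, if_false]
  ring

/-- The (unnormalised) expectation of a product of functions of the messages `L s` of five nodes. -/
def moment5 {S : Type} [Fintype S] (L : S → Fin 5 → Fin 3) (g : Fin 5 → Fin 3 → ℂ) : ℂ :=
  ∑ s, ∏ k, g k (L s k)

/-- The matrix family of an operator orthogonal to the normal direction of a node. -/
noncomputable def tangentFamily (y w f Df : Fin 3 → ℂ) (c : ℂ) (a : Fin 3) : Matrix (Fin 2) (Fin 2) ℂ :=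
  !![f a, w a * Df a; -(y a * Df a), 2 * c - f a]

/-- The matrix family of the normal direction of a node. -/
def normalFamily (y w : Fin 3 → ℂ) (a : Fin 3) : Matrix (Fin 2) (Fin 2) ℂ := !![0, w a; y a, 0]

/-- Exchange relations on pairs of nodes kill mixed products over three nodes. -/
theorem moment5_eq_zero_of_mixed {S : Type} [Fintype S] {L : S → Fin 5 → Fin 3}
    {y w : Fin 5 → Fin 3 → ℂ}
    (hR : ∀ i j, i ≠ j → ∀ g, moment5 L (Function.update (Function.update g i (y i)) j (w j)) +
      moment5 L (Function.update (Function.update g i (w i)) j (y j)) = 0)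
    {i j k : Fin 5} (hij : i ≠ j) (hik : i ≠ k) (hjk : j ≠ k) {g : Fin 5 → Fin 3 → ℂ}
    (hi : g i = w i) (hj : g j = y j) (hk : g k = y k) : moment5 L g = 0 := by
  have e1 := hR i j hij g
  have e2 := hR i k hik g
  have e3 := hR j k hjk (Function.update g i (y i))
  have c1 : Function.update (Function.update g i (w i)) j (y j) = g := by
    rw [← hi, ← hj, Function.update_eq_self, Function.update_eq_self]
  have c2 : Function.update (Function.update g i (w i)) k (y k) = g := by
    rw [← hi, ← hk, Function.update_eq_self, Function.update_eq_self]
  have c3 : Function.update (Function.update (Function.update g i (y i)) j (y j)) k (w k) =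
      Function.update (Function.update g i (y i)) k (w k) := by
    congr 1
    rw [Function.update_eq_self_iff, Function.update_of_ne hij.symm, hj]
  have c4 : Function.update (Function.update (Function.update g i (y i)) j (w j)) k (y k) =
      Function.update (Function.update g i (y i)) j (w j) := by
    rw [Function.update_eq_self_iff, Function.update_of_ne hjk.symm, Function.update_of_ne hik.symm, hk]
  rw [c1] at e1
  rw [c2] at e2
  rw [c3, c4] at e3
  linear_combination (e1 + e2 - e3) / 2

/-- Five nodes with a normal direction each: one of the mean transverse components vanishes. -/
theorem pentagon {S : Type} [Fintype S] (L : S → Fin 5 → Fin 3) (y w : Fin 5 → Fin 3 → ℂ)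
    (D : Fin 5 → (Fin 3 → ℂ) → Fin 3 → ℂ) (c : Fin 5 → (Fin 3 → ℂ) → ℂ) (n K : ℂ)
    (h : ∀ (M : Fin 5 → Fin 3 → Matrix (Fin 2) (Fin 2) ℂ) (τ : Fin 5 → ℂ),
      (∀ t, (∃ f, M t = tangentFamily (y t) (w t) f (D t f) (c t f) ∧ τ t = c t f) ∨
        (M t = normalFamily (y t) (w t) ∧ τ t = 0)) →
      ∑ s, (n * ∏ t, M t (L s t) 0 0 + ∑ t, ∑ t', ∏ r, M r (L s r) (spike t r) (spike t' r)) =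
        K * ∏ t, τ t) :
    K * (c 0 (y 0) * c 1 (y 1) * c 2 (y 2) * c 3 (w 3) * c 4 (w 4)) = 0 := by
  -- Normal operators at `i` and `j` are purely off-diagonal, so only the two terms that move the
  -- excitation between `i` and `j` survive. The other three nodes carry tangent operators, whose `0
  -- 0` entry is an arbitrary function.
  have hR : ∀ i j, i ≠ j → ∀ g, moment5 L (Function.update (Function.update g i (y i)) j (w j)) +
      moment5 L (Function.update (Function.update g i (w i)) j (y j)) = 0 := by
    intro i j hij g
    set M : Fin 5 → Fin 3 → Matrix (Fin 2) (Fin 2) ℂ := fun t =>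
      if t = i ∨ t = j then normalFamily (y t) (w t)
      else tangentFamily (y t) (w t) (g t) (D t (g t)) (c t (g t)) with hM
    have hn : ∀ t, (t = i ∨ t = j) → M t = normalFamily (y t) (w t) := fun t ht => if_pos ht
    have e := h M (fun t => if t = i ∨ t = j then 0 else c t (g t)) (fun t => by
      by_cases ht : t = i ∨ t = j
      · exact Or.inr ⟨hn t ht, if_pos ht⟩
      · exact Or.inl ⟨g t, if_neg ht, if_neg ht⟩)
    rw [Finset.prod_eq_zero (Finset.mem_univ i) (by simp), mul_zero] at e
    rw [← e, moment5, moment5, ← Finset.sum_add_distrib]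
    refine Finset.sum_congr rfl fun s _ => ?_
    have e00 : ∏ t, M t (L s t) 0 0 = 0 :=
      Finset.prod_eq_zero (Finset.mem_univ i) (by rw [hn i (Or.inl rfl)]; simp [normalFamily])
    rw [e00, mul_zero, zero_add]
    rw [← Fintype.sum_prod_type' (f := fun t t' => ∏ r, M r (L s r) (spike t r) (spike t' r))]
    rw [Finset.sum_eq_add (i, j) (j, i) (by simp [hij]) _ (by simp) (by simp)]
    · congr 1
      · refine Finset.prod_congr rfl fun r _ => ?_
        by_cases hrj : r = j
        · subst hrj
          rw [hn r (Or.inr rfl)]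
          simp [normalFamily, spike, hij.symm]
        · by_cases hri : r = i
          · subst hri
            rw [hn r (Or.inl rfl)]
            simp [normalFamily, spike, hij]
          · simp [hM, hrj, hri, spike, tangentFamily]
      · refine Finset.prod_congr rfl fun r _ => ?_
        by_cases hrj : r = j
        · subst hrj
          rw [hn r (Or.inr rfl)]
          simp [normalFamily, spike, hij.symm]
        · by_cases hri : r = i
          · subst hri
            rw [hn r (Or.inl rfl)]
            simp [normalFamily, spike, hij]
          · simp [hM, hrj, hri, spike, tangentFamily]
    · rintro ⟨t, t'⟩ - ⟨h1, h2⟩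
      simp only [ne_eq, Prod.mk.injEq, not_and] at h1 h2
      have hz : ∀ r, (r = i ∨ r = j) → (r = t ↔ r = t') →
          M r (L s r) (spike t r) (spike t' r) = 0 := by
        intro r hr ht
        rw [hn r hr]
        by_cases h3 : r = t
        · simp [normalFamily, spike, ← h3, ← (ht.1 h3)]
        · have h4 : ¬ r = t' := fun e => h3 (ht.2 e)
          simp [normalFamily, spike, h3, h4]
      by_cases hi : i = t ↔ i = t'
      · exact Finset.prod_eq_zero (Finset.mem_univ i) (hz i (Or.inl rfl) hi)
      · refine Finset.prod_eq_zero (Finset.mem_univ j) (hz j (Or.inr rfl) ?_)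
        grind
  have mixed : ∀ {i j k : Fin 5} (_ : i ≠ j) (_ : i ≠ k) (_ : j ≠ k) {g : Fin 5 → Fin 3 → ℂ}
      (_ : g i = w i) (_ : g j = y j) (_ : g k = y k), moment5 L g = 0 :=
    fun hij hik hjk _ hi hj hk => moment5_eq_zero_of_mixed hR hij hik hjk hi hj hk
  have mixed' : ∀ {i j k : Fin 5} (_ : i ≠ j) (_ : i ≠ k) (_ : j ≠ k) {g : Fin 5 → Fin 3 → ℂ}
      (_ : g i = y i) (_ : g j = w j) (_ : g k = w k), moment5 L g = 0 :=
    fun hij hik hjk _ hi hj hk => moment5_eq_zero_of_mixed (y := w) (w := y)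
      (fun i j hij g => by rw [add_comm]; exact hR i j hij g) hij hik hjk hi hj hk
  have expand : ∀ g₀ g₁ g₂ g₃ g₄ : Fin 3 → ℂ, moment5 L ![g₀, g₁, g₂, g₃, g₄] =
      ∑ s, g₀ (L s 0) * g₁ (L s 1) * g₂ (L s 2) * g₃ (L s 3) * g₄ (L s 4) := fun g₀ g₁ g₂ g₃ g₄ =>
    Finset.sum_congr rfl fun s _ => by rw [Fin.prod_univ_five]; rfl
  have m01 : ∀ A B : Fin 3 → ℂ, moment5 L ![A, B, y 2, w 3, w 4] = 0 := fun A B =>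
    mixed' (i := 2) (j := 3) (k := 4) (by decide) (by decide) (by decide) rfl rfl rfl
  have m02 : ∀ A B : Fin 3 → ℂ, moment5 L ![A, y 1, B, w 3, w 4] = 0 := fun A B =>
    mixed' (i := 1) (j := 3) (k := 4) (by decide) (by decide) (by decide) rfl rfl rfl
  have m12 : ∀ A B : Fin 3 → ℂ, moment5 L ![y 0, A, B, w 3, w 4] = 0 := fun A B =>
    mixed' (i := 0) (j := 3) (k := 4) (by decide) (by decide) (by decide) rfl rfl rfl
  have m03 : ∀ A B : Fin 3 → ℂ, moment5 L ![A, y 1, y 2, B, w 4] = 0 := fun A B =>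
    mixed (i := 4) (j := 1) (k := 2) (by decide) (by decide) (by decide) rfl rfl rfl
  have m13 : ∀ A B : Fin 3 → ℂ, moment5 L ![y 0, A, y 2, B, w 4] = 0 := fun A B =>
    mixed (i := 4) (j := 0) (k := 2) (by decide) (by decide) (by decide) rfl rfl rfl
  have m23 : ∀ A B : Fin 3 → ℂ, moment5 L ![y 0, y 1, A, B, w 4] = 0 := fun A B =>
    mixed (i := 4) (j := 0) (k := 1) (by decide) (by decide) (by decide) rfl rfl rfl
  have m04 : ∀ A B : Fin 3 → ℂ, moment5 L ![A, y 1, y 2, w 3, B] = 0 := fun A B =>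
    mixed (i := 3) (j := 1) (k := 2) (by decide) (by decide) (by decide) rfl rfl rfl
  have m14 : ∀ A B : Fin 3 → ℂ, moment5 L ![y 0, A, y 2, w 3, B] = 0 := fun A B =>
    mixed (i := 3) (j := 0) (k := 2) (by decide) (by decide) (by decide) rfl rfl rfl
  have m24 : ∀ A B : Fin 3 → ℂ, moment5 L ![y 0, y 1, A, w 3, B] = 0 := fun A B =>
    mixed (i := 3) (j := 0) (k := 1) (by decide) (by decide) (by decide) rfl rfl rfl
  have n01 : ∀ A B : Fin 3 → ℂ, moment5 L ![w 0, A, y 2, w 3, B] = 0 := fun A B =>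
    mixed' (i := 2) (j := 0) (k := 3) (by decide) (by decide) (by decide) rfl rfl rfl
  have n02 : ∀ A B : Fin 3 → ℂ, moment5 L ![w 0, y 1, A, w 3, B] = 0 := fun A B =>
    mixed' (i := 1) (j := 0) (k := 3) (by decide) (by decide) (by decide) rfl rfl rfl
  have n03 : ∀ A B : Fin 3 → ℂ, moment5 L ![w 0, A, y 2, B, w 4] = 0 := fun A B =>
    mixed' (i := 2) (j := 0) (k := 4) (by decide) (by decide) (by decide) rfl rfl rfl
  have n04 : ∀ A B : Fin 3 → ℂ, moment5 L ![w 0, y 1, A, B, w 4] = 0 := fun A B =>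
    mixed' (i := 1) (j := 0) (k := 4) (by decide) (by decide) (by decide) rfl rfl rfl
  have n05 : ∀ A B : Fin 3 → ℂ, moment5 L ![w 0, y 1, y 2, A, B] = 0 := fun A B =>
    mixed (i := 0) (j := 1) (k := 2) (by decide) (by decide) (by decide) rfl rfl rfl
  -- the normal direction at node `0`
  have R1 : ∀ g₁ g₂ g₃ g₄ : Fin 3 → ℂ,
      moment5 L ![y 0, w 1 * D 1 g₁, g₂, g₃, g₄] - moment5 L ![w 0, y 1 * D 1 g₁, g₂, g₃, g₄] +
      (moment5 L ![y 0, g₁, w 2 * D 2 g₂, g₃, g₄] - moment5 L ![w 0, g₁, y 2 * D 2 g₂, g₃, g₄]) +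
      (moment5 L ![y 0, g₁, g₂, w 3 * D 3 g₃, g₄] - moment5 L ![w 0, g₁, g₂, y 3 * D 3 g₃, g₄]) +
      (moment5 L ![y 0, g₁, g₂, g₃, w 4 * D 4 g₄] - moment5 L ![w 0, g₁, g₂, g₃, y 4 * D 4 g₄]) = 0 := by
    intro g₁ g₂ g₃ g₄
    have e := h ![normalFamily (y 0) (w 0), tangentFamily (y 1) (w 1) g₁ (D 1 g₁) (c 1 g₁),
      tangentFamily (y 2) (w 2) g₂ (D 2 g₂) (c 2 g₂), tangentFamily (y 3) (w 3) g₃ (D 3 g₃) (c 3 g₃),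
      tangentFamily (y 4) (w 4) g₄ (D 4 g₄) (c 4 g₄)] ![0, c 1 g₁, c 2 g₂, c 3 g₃, c 4 g₄]
      (fun t => by
        fin_cases t
        · exact Or.inr ⟨rfl, rfl⟩
        · exact Or.inl ⟨g₁, rfl, rfl⟩
        · exact Or.inl ⟨g₂, rfl, rfl⟩
        · exact Or.inl ⟨g₃, rfl, rfl⟩
        · exact Or.inl ⟨g₄, rfl, rfl⟩)
    have e0 : K * ∏ t, (![0, c 1 g₁, c 2 g₂, c 3 g₃, c 4 g₄] : Fin 5 → ℂ) t = 0 := by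
      rw [Fin.prod_univ_five]; simp
    rw [e0] at e
    rw [← e]
    simp only [expand, ← Finset.sum_add_distrib, ← Finset.sum_sub_distrib]
    refine Finset.sum_congr rfl fun s _ => ?_
    rw [sum_spike_five, Fin.prod_univ_five]
    simp only [Matrix.cons_val, normalFamily, tangentFamily, Matrix.of_apply, Pi.mul_apply]
    ring
  -- In the pattern `y, y, y, w, w`, deleting two nodes leaves a mixed triple, which kills the
  -- product, unless both `w` are deleted. `Φ3` and `Φ4` supply that remaining case from a single
  -- normal operator at node `0`.
  have Φ3 : ∀ G : Fin 3 → ℂ, moment5 L ![y 0, y 1, y 2, w 3 * D 3 (w 3), G] = 0 := by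
    intro G
    have e := R1 (y 1) (y 2) (w 3) G
    simpa only [n01, n02, n05, m14, m24, sub_zero, add_zero, zero_add] using e
  have Φ4 : ∀ G : Fin 3 → ℂ, moment5 L ![y 0, y 1, y 2, G, w 4 * D 4 (w 4)] = 0 := by
    intro G
    have e := R1 (y 1) (y 2) G (w 4)
    simpa only [n03, n04, n05, m13, m23, sub_zero, add_zero, zero_add] using e
  have e := h ![tangentFamily (y 0) (w 0) (y 0) (D 0 (y 0)) (c 0 (y 0)),
      tangentFamily (y 1) (w 1) (y 1) (D 1 (y 1)) (c 1 (y 1)),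
      tangentFamily (y 2) (w 2) (y 2) (D 2 (y 2)) (c 2 (y 2)),
      tangentFamily (y 3) (w 3) (w 3) (D 3 (w 3)) (c 3 (w 3)),
      tangentFamily (y 4) (w 4) (w 4) (D 4 (w 4)) (c 4 (w 4))]
      ![c 0 (y 0), c 1 (y 1), c 2 (y 2), c 3 (w 3), c 4 (w 4)]
      (fun t => by
        fin_cases t
        · exact Or.inl ⟨y 0, rfl, rfl⟩
        · exact Or.inl ⟨y 1, rfl, rfl⟩
        · exact Or.inl ⟨y 2, rfl, rfl⟩
        · exact Or.inl ⟨w 3, rfl, rfl⟩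
        · exact Or.inl ⟨w 4, rfl, rfl⟩)
  have eτ : ∏ t, (![c 0 (y 0), c 1 (y 1), c 2 (y 2), c 3 (w 3), c 4 (w 4)] : Fin 5 → ℂ) t =
      c 0 (y 0) * c 1 (y 1) * c 2 (y 2) * c 3 (w 3) * c 4 (w 4) := by
    rw [Fin.prod_univ_five]; rfl
  rw [eτ] at e
  rw [← e]
  -- the surviving products are killed by the relations above
  set d : Fin 5 → Fin 3 → ℂ := ![D 0 (y 0), D 1 (y 1), D 2 (y 2), D 3 (w 3), D 4 (w 4)] with hd
  have total : ∑ s, (n * ∏ t, (![tangentFamily (y 0) (w 0) (y 0) (D 0 (y 0)) (c 0 (y 0)),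
      tangentFamily (y 1) (w 1) (y 1) (D 1 (y 1)) (c 1 (y 1)),
      tangentFamily (y 2) (w 2) (y 2) (D 2 (y 2)) (c 2 (y 2)),
      tangentFamily (y 3) (w 3) (w 3) (D 3 (w 3)) (c 3 (w 3)),
      tangentFamily (y 4) (w 4) (w 4) (D 4 (w 4)) (c 4 (w 4))] : Fin 5 → Fin 3 → Matrix (Fin 2) (Fin 2) ℂ)
        t (L s t) 0 0 + ∑ t, ∑ t', ∏ r,
      (![tangentFamily (y 0) (w 0) (y 0) (D 0 (y 0)) (c 0 (y 0)),
      tangentFamily (y 1) (w 1) (y 1) (D 1 (y 1)) (c 1 (y 1)),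
      tangentFamily (y 2) (w 2) (y 2) (D 2 (y 2)) (c 2 (y 2)),
      tangentFamily (y 3) (w 3) (w 3) (D 3 (w 3)) (c 3 (w 3)),
      tangentFamily (y 4) (w 4) (w 4) (D 4 (w 4)) (c 4 (w 4))] : Fin 5 → Fin 3 → Matrix (Fin 2) (Fin 2) ℂ)
        r (L s r) (spike t r) (spike t' r)) =
      n * moment5 L ![y 0, y 1, y 2, w 3, w 4] +
      moment5 L ![fun a => 2 * c 0 (y 0) - y 0 a, y 1, y 2, w 3, w 4] +
      moment5 L ![y 0, fun a => 2 * c 1 (y 1) - y 1 a, y 2, w 3, w 4] +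
      moment5 L ![y 0, y 1, fun a => 2 * c 2 (y 2) - y 2 a, w 3, w 4] +
      moment5 L ![y 0, y 1, y 2, fun a => 2 * c 3 (w 3) - w 3 a, w 4] +
      moment5 L ![y 0, y 1, y 2, w 3, fun a => 2 * c 4 (w 4) - w 4 a] -
      (moment5 L ![y 0 * d 0, w 1 * d 1, y 2, w 3, w 4] + moment5 L ![w 0 * d 0, y 1 * d 1, y 2, w 3, w 4]) -
      (moment5 L ![y 0 * d 0, y 1, w 2 * d 2, w 3, w 4] + moment5 L ![w 0 * d 0, y 1, y 2 * d 2, w 3, w 4]) -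
      (moment5 L ![y 0 * d 0, y 1, y 2, w 3 * d 3, w 4] + moment5 L ![w 0 * d 0, y 1, y 2, y 3 * d 3, w 4]) -
      (moment5 L ![y 0 * d 0, y 1, y 2, w 3, w 4 * d 4] + moment5 L ![w 0 * d 0, y 1, y 2, w 3, y 4 * d 4]) -
      (moment5 L ![y 0, y 1 * d 1, w 2 * d 2, w 3, w 4] + moment5 L ![y 0, w 1 * d 1, y 2 * d 2, w 3, w 4]) -
      (moment5 L ![y 0, y 1 * d 1, y 2, w 3 * d 3, w 4] + moment5 L ![y 0, w 1 * d 1, y 2, y 3 * d 3, w 4]) -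
      (moment5 L ![y 0, y 1 * d 1, y 2, w 3, w 4 * d 4] + moment5 L ![y 0, w 1 * d 1, y 2, w 3, y 4 * d 4]) -
      (moment5 L ![y 0, y 1, y 2 * d 2, w 3 * d 3, w 4] + moment5 L ![y 0, y 1, w 2 * d 2, y 3 * d 3, w 4]) -
      (moment5 L ![y 0, y 1, y 2 * d 2, w 3, w 4 * d 4] + moment5 L ![y 0, y 1, w 2 * d 2, w 3, y 4 * d 4]) -
      (moment5 L ![y 0, y 1, y 2, y 3 * d 3, w 4 * d 4] + moment5 L ![y 0, y 1, y 2, w 3 * d 3, y 4 * d 4]) := by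
    simp only [expand, ← Finset.sum_add_distrib, ← Finset.sum_sub_distrib, Finset.mul_sum]
    refine Finset.sum_congr rfl fun s _ => ?_
    rw [sum_spike_five, Fin.prod_univ_five]
    simp only [Matrix.cons_val, tangentFamily, Matrix.of_apply, Pi.mul_apply, hd]
    ring
  rw [total]
  have d3 : d 3 = D 3 (w 3) := rfl
  have d4 : d 4 = D 4 (w 4) := rfl
  rw [d3, d4, Φ3, Φ4]
  simp only [m01, m02, m12, m03, m13, m23, m04, m14, m24]
  simp

theorem pauliVec_sq {u : Fin 3 → ℝ} (hu : u ⬝ᵥ u = 1) : pauliVec (cvec u) * pauliVec (cvec u) = 1 := by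
  have h : (u 0 : ℂ) * u 0 + u 1 * u 1 + u 2 * u 2 = 1 := by
    rw [dotProduct, Fin.sum_univ_three] at hu
    exact_mod_cast hu
  have hI : Complex.I ^ 2 = -1 := Complex.I_sq
  ext i j
  fin_cases i <;> fin_cases j <;> simp [pauliVec, cvec, Matrix.mul_apply, Fin.sum_univ_two]
  · linear_combination h - (u 1 : ℂ) ^ 2 * hI
  · ring
  · ring
  · linear_combination h - (u 1 : ℂ) ^ 2 * hI

/-- Half-turns preserve the bilinear inner product. -/
theorem halfTurn_dot {u : Fin 3 → ℝ} (hu : u ⬝ᵥ u = 1) (m m' : Fin 3 → ℂ) :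
    ∑ i, halfTurn u m i * halfTurn u m' i = ∑ i, m i * m' i := by
  have h : (u 0 : ℂ) * u 0 + u 1 * u 1 + u 2 * u 2 = 1 := by
    rw [dotProduct, Fin.sum_univ_three] at hu
    exact_mod_cast hu
  simp only [halfTurn, Fin.sum_univ_three]
  linear_combination 4 * (u 0 * m 0 + u 1 * m 1 + u 2 * m 2) * (u 0 * m' 0 + u 1 * m' 1 + u 2 * m' 2) * h

namespace HalfTurns

variable {N : ℕ} {P : Protocol N} {i : Fin N}

/-- A direction that every half-turn takes to the plane orthogonal to the `z` axis. -/
theorem exists_normal (hN : 3 ≤ N) (hP : P.Distributes (pure (wState N))) (D : HalfTurns P i) :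
    ∃ n : Fin 3 → ℝ, n ⬝ᵥ n = 1 ∧ ∀ a, 2 * (D.axis a ⬝ᵥ n) * D.axis a 2 - n 2 = 0 := by
  -- Row `a` is the functional that takes a vector to the $z$ component of its image under the
  -- half-turn about `axis a`. By the one-body correlators the rows average to zero, so there is a
  -- common kernel vector.
  set V : Matrix (Fin 3) (Fin 3) ℝ := Matrix.of fun a c => 2 * (D.axis a 2 * D.axis a c) - if c = 2 then 1 else 0
    with hV
  have hp0 : D.prob ≠ 0 := by
    intro e
    have := D.sum_prob_one
    rw [e] at this
    simp at this
  have hdet : V.det = 0 := by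
    refine Matrix.exists_vecMul_eq_zero_iff.1 ⟨D.prob, hp0, ?_⟩
    funext c
    have h1 := D.moment_one hN hP c
    have h2 := D.sum_prob_one
    calc (D.prob ᵥ* V) c = ∑ a, D.prob a * (2 * (D.axis a 2 * D.axis a c) - if c = 2 then 1 else 0) := rfl
      _ = 2 * (∑ a, D.prob a * (D.axis a 2 * D.axis a c)) - (∑ a, D.prob a) * if c = 2 then 1 else 0 := by
        rw [Finset.mul_sum, Finset.sum_mul, ← Finset.sum_sub_distrib]
        exact Finset.sum_congr rfl fun a _ => by ring
      _ = 0 := by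
        rw [h1, h2]
        split_ifs <;> norm_num
  obtain ⟨n, hn0, hn⟩ := Matrix.exists_mulVec_eq_zero_iff.2 hdet
  have hpos : 0 < n ⬝ᵥ n := by
    refine lt_of_le_of_ne (Finset.sum_nonneg fun i _ => mul_self_nonneg _) fun e => hn0 ?_
    exact dotProduct_self_eq_zero.1 e.symm
  refine ⟨(√(n ⬝ᵥ n))⁻¹ • n, ?_, fun a => ?_⟩
  · rw [dotProduct_smul, smul_dotProduct, smul_smul, ← mul_inv, Real.mul_self_sqrt hpos.le, smul_eq_mul,
      inv_mul_cancel₀ hpos.ne']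
  · have := congrFun hn a
    simp only [hV, Matrix.mulVec, dotProduct, Fin.sum_univ_three, Matrix.of_apply, Pi.zero_apply,
      Fin.isValue, Fin.reduceEq, if_false, if_true] at this
    simp only [dotProduct, Fin.sum_univ_three, Pi.smul_apply, smul_eq_mul]
    linear_combination (√(n 0 * n 0 + n 1 * n 1 + n 2 * n 2))⁻¹ * this

/-- The transverse component of the normal direction. -/
noncomputable def transverse (D : HalfTurns P i) (n : Fin 3 → ℝ) (a : Fin 3) : ℂ :=
  halfTurn (D.axis a) (cvec n) 0 + Complex.I * halfTurn (D.axis a) (cvec n) 1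

/-- The complex conjugate of the transverse component. -/
noncomputable def transverse' (D : HalfTurns P i) (n : Fin 3 → ℝ) (a : Fin 3) : ℂ :=
  halfTurn (D.axis a) (cvec n) 0 - Complex.I * halfTurn (D.axis a) (cvec n) 1

theorem normal_sandwich (D : HalfTurns P i) {n : Fin 3 → ℝ}
    (hn : ∀ a, 2 * (D.axis a ⬝ᵥ n) * D.axis a 2 - n 2 = 0) (s : Bits N) :
    (P.recovery i (P.msg i s) : Matrix (Fin 2) (Fin 2) ℂ) * (D.frameᴴ * pauliVec (cvec n) * D.frame) *
      (P.recovery i (P.msg i s) : Matrix (Fin 2) (Fin 2) ℂ)ᴴ =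
    normalFamily (D.transverse n) (D.transverse' n) (D.label s) := by
  rw [D.sandwich_pauliVec]
  have h2 : halfTurn (D.axis (D.label s)) (cvec n) 2 = 0 := by
    have := hn (D.label s)
    simp only [dotProduct, Fin.sum_univ_three] at this
    simp only [halfTurn, cvec, Fin.sum_univ_three]
    exact_mod_cast this
  simp [pauliVec, normalFamily, transverse, transverse', h2]

/-- Every function of the message is the `z` component of some operator orthogonal to the normal
direction. -/
theorem exists_tangent (hN : 3 ≤ N) (hP : P.Distributes (pure (wState N))) (D : HalfTurns P i)
    (hd : planeDet D.prob D.axis ≠ 0) (hz : ∀ a a', a ≠ a' → D.axis a 2 = 0 → D.axis a' 2 ≠ 0)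
    {n : Fin 3 → ℝ} (hn1 : n ⬝ᵥ n = 1) (hn : ∀ a, 2 * (D.axis a ⬝ᵥ n) * D.axis a 2 - n 2 = 0)
    (f : Fin 3 → ℂ) : ∃ (ℓ : Fin 3 → ℂ), ∑ j, ℓ j * n j = 0 ∧
      ∀ a, (∑ a, D.prob a * f a) + halfTurn (D.axis a) ℓ 2 = f a := by
  -- By `hz` at most one axis is orthogonal to $z$. There a half-turn has the fixed $z$ component
  -- $-\ell_z$, so `t` is the value of `f` at that message; the quotient below is then `0 / 0 = 0`
  -- and does no harm.
  obtain ⟨t, ht⟩ : ∃ t : ℂ, ∀ a, D.axis a 2 = 0 → f a = t := by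
    by_cases h : ∃ a, D.axis a 2 = 0
    · obtain ⟨a, ha⟩ := h
      refine ⟨f a, fun a' ha' => ?_⟩
      by_contra hne
      exact hz a a' (fun e => hne (by rw [e])) ha ha'
    · exact ⟨0, fun a ha => absurd ⟨a, ha⟩ h⟩
  have hdet : ((Matrix.of D.axis).map ((↑) : ℝ → ℂ)).det ≠ 0 := by
    have := (D.pos_and_det hN hP hd).2
    have e := RingHom.map_det Complex.ofRealHom (Matrix.of D.axis)
    have e' : ((Matrix.of D.axis).map ((↑) : ℝ → ℂ)).det = ((Matrix.of D.axis).det : ℂ) := by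
      rw [← Complex.ofRealHom_eq_coe, e]; rfl
    rw [e']
    exact_mod_cast this
  have hsol : ((Matrix.of D.axis).map ((↑) : ℝ → ℂ)) *ᵥ
      (((Matrix.of D.axis).map ((↑) : ℝ → ℂ))⁻¹ *ᵥ fun a => (f a - t) / (2 * D.axis a 2)) =
      fun a => (f a - t) / (2 * D.axis a 2) := by
    rw [Matrix.mulVec_mulVec, Matrix.mul_nonsing_inv _ (isUnit_iff_ne_zero.2 hdet), Matrix.one_mulVec]
  set ℓ₀ := ((Matrix.of D.axis).map ((↑) : ℝ → ℂ))⁻¹ *ᵥ fun a => (f a - t) / (2 * D.axis a 2) with hℓ₀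
  have h0 : ∀ a, halfTurn (D.axis a) ℓ₀ 2 = f a - t - ℓ₀ 2 := by
    intro a
    have h1 : ∑ j, (D.axis a j : ℂ) * ℓ₀ j = (f a - t) / (2 * D.axis a 2) := congrFun hsol a
    rw [halfTurn, h1]
    by_cases ha : D.axis a 2 = 0
    · rw [ht a ha, ha]; simp
    · have : (D.axis a 2 : ℂ) ≠ 0 := by exact_mod_cast ha
      field_simp
  -- Removing the normal component does not change any $z$ component, as the half-turns send `n`
  -- into the plane.
  set ℓ : Fin 3 → ℂ := fun j => ℓ₀ j - (∑ j, ℓ₀ j * n j) * n j with hℓ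
  have hℓn : ∑ j, ℓ j * n j = 0 := by
    have hnc : (n 0 : ℂ) * n 0 + n 1 * n 1 + n 2 * n 2 = 1 := by
      rw [dotProduct, Fin.sum_univ_three] at hn1
      exact_mod_cast hn1
    simp only [hℓ, Fin.sum_univ_three]
    linear_combination -(ℓ₀ 0 * n 0 + ℓ₀ 1 * n 1 + ℓ₀ 2 * n 2) * hnc
  have h1 : ∀ a, halfTurn (D.axis a) ℓ 2 = f a - t - ℓ₀ 2 := by
    intro a
    have hna : 2 * ((D.axis a 0 : ℂ) * n 0 + D.axis a 1 * n 1 + D.axis a 2 * n 2) * D.axis a 2 - n 2 = 0 := by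
      have := hn a
      rw [dotProduct, Fin.sum_univ_three] at this
      exact_mod_cast this
    rw [← h0]
    simp only [halfTurn, hℓ, Fin.sum_univ_three]
    linear_combination -(ℓ₀ 0 * n 0 + ℓ₀ 1 * n 1 + ℓ₀ 2 * n 2) * hna
  -- the mean of the `z` component vanishes
  have hmean : ∑ a, (D.prob a : ℂ) * halfTurn (D.axis a) ℓ 2 = 0 := by
    have hm : ∀ c, ∑ a, (D.prob a : ℂ) * (D.axis a 2 * D.axis a c) = if c = 2 then 1 / 2 else 0 := by
      intro c
      have := congrArg ((↑) : ℝ → ℂ) (D.moment_one hN hP c)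
      push_cast at this
      rw [this]
      split_ifs <;> simp
    have hs : ∑ a, (D.prob a : ℂ) = 1 := by exact_mod_cast D.sum_prob_one
    have hm0 := hm 0
    have hm1 := hm 1
    have hm2 := hm 2
    simp only [Fin.sum_univ_three, Fin.isValue, Fin.reduceEq, if_false, if_true] at hm0 hm1 hm2 hs
    simp only [halfTurn, Fin.sum_univ_three]
    linear_combination 2 * ℓ 0 * hm0 + 2 * ℓ 1 * hm1 + 2 * ℓ 2 * hm2 - ℓ 2 * hs
  refine ⟨ℓ, hℓn, fun a => ?_⟩
  have hs : ∑ a, (D.prob a : ℂ) = 1 := by exact_mod_cast D.sum_prob_one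
  have hf : ∑ a, (D.prob a : ℂ) * f a = t + ℓ₀ 2 := by
    have : ∑ a, (D.prob a : ℂ) * f a = ∑ a, (D.prob a : ℂ) * halfTurn (D.axis a) ℓ 2 +
        (∑ a, (D.prob a : ℂ)) * (t + ℓ₀ 2) := by
      rw [Finset.sum_mul, ← Finset.sum_add_distrib]
      exact Finset.sum_congr rfl fun a _ => by rw [h1]; ring
    rw [this, hmean, hs]; ring
  rw [hf, h1]; ring

/-- The associated transverse amplitude. -/
noncomputable def tangentAmp (D : HalfTurns P i) (n : Fin 3 → ℝ) (ℓ : Fin 3 → ℂ) (a : Fin 3) : ℂ :=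
  -Complex.I * (halfTurn (D.axis a) ℓ 1 * halfTurn (D.axis a) (cvec n) 0 -
    halfTurn (D.axis a) ℓ 0 * halfTurn (D.axis a) (cvec n) 1)

/-- Half-turns preserve orthogonality to `n`, and the image of `n` is a unit vector of the plane.
The transverse part of the image of `ℓ` is therefore a multiple of that vector turned by a right
angle, which gives the off-diagonal entries $w\,Df$ and $-y\,Df$. -/
theorem tangent_sandwich (D : HalfTurns P i) {n : Fin 3 → ℝ} (hn1 : n ⬝ᵥ n = 1)
    (hn : ∀ a, 2 * (D.axis a ⬝ᵥ n) * D.axis a 2 - n 2 = 0) {f ℓ : Fin 3 → ℂ} {c : ℂ}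
    (hℓ : ∑ j, ℓ j * n j = 0) (hf : ∀ a, c + halfTurn (D.axis a) ℓ 2 = f a) (s : Bits N) :
    (P.recovery i (P.msg i s) : Matrix (Fin 2) (Fin 2) ℂ) *
      (D.frameᴴ * (c • (1 : Matrix (Fin 2) (Fin 2) ℂ) + pauliVec ℓ) * D.frame) *
      (P.recovery i (P.msg i s) : Matrix (Fin 2) (Fin 2) ℂ)ᴴ =
    tangentFamily (D.transverse n) (D.transverse' n) f (D.tangentAmp n ℓ) c (D.label s) := by
  set a := D.label s with ha
  have hu := D.unit a
  rw [D.sandwich, ← ha, Matrix.mul_add, Matrix.add_mul, Matrix.mul_smul, Matrix.smul_mul, Matrix.mul_one,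
    pauliVec_sq hu, pauliVec_conj hu]
  have h2 : halfTurn (D.axis a) (cvec n) 2 = 0 := by
    have := hn a
    simp only [dotProduct, Fin.sum_univ_three] at this
    simp only [halfTurn, cvec, Fin.sum_univ_three]
    exact_mod_cast this
  have e1 := halfTurn_dot hu ℓ (cvec n)
  have e2 := halfTurn_dot hu (cvec n) (cvec n)
  have e3 : ∑ i, cvec n i * cvec n i = 1 := by
    rw [dotProduct] at hn1
    simp only [cvec]
    exact_mod_cast hn1
  have e4 : ∑ i, ℓ i * cvec n i = 0 := hℓ
  rw [e4] at e1
  rw [e3] at e2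
  simp only [Fin.sum_univ_three, h2, mul_zero, add_zero] at e1 e2
  have hfa := hf a
  set m := halfTurn (D.axis a) ℓ
  set y := halfTurn (D.axis a) (cvec n)
  have hI : Complex.I ^ 2 = -1 := Complex.I_sq
  ext x x'
  fin_cases x <;> fin_cases x' <;>
    simp [pauliVec, tangentFamily, transverse, transverse', tangentAmp, m]
  · exact hfa
  · change m 0 - Complex.I * m 1 = -((y 0 - Complex.I * y 1) * (Complex.I * (m 1 * y 0 - m 0 * y 1)))
    linear_combination (y 0 - Complex.I * y 1) * e1 - (m 0 - Complex.I * m 1) * e2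
      - (m 1 * y 0 - m 0 * y 1) * y 1 * hI
  · change m 0 + Complex.I * m 1 = (y 0 + Complex.I * y 1) * (Complex.I * (m 1 * y 0 - m 0 * y 1))
    linear_combination (y 0 + Complex.I * y 1) * e1 - (m 0 + Complex.I * m 1) * e2
      - (m 1 * y 0 - m 0 * y 1) * y 1 * hI
  · linear_combination -hfa

/-- Let $M$ be the transverse second-moment matrix. The mean conditions say $(2M-1)n_\perp=0$, but
$M$ has trace $1/2$ and nonzero determinant, so $1/2$ is not an eigenvalue. Hence $n$ lies along
$z$, and its defining relation becomes $2u_z^2=1$. -/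
theorem centered_of_mean (hN : 3 ≤ N) (hP : P.Distributes (pure (wState N))) (D : HalfTurns P i)
    (hd : planeDet D.prob D.axis ≠ 0) {n : Fin 3 → ℝ} (hn1 : n ⬝ᵥ n = 1)
    (hn : ∀ a, 2 * (D.axis a ⬝ᵥ n) * D.axis a 2 - n 2 = 0)
    (h0 : ∑ a, D.prob a * (2 * (D.axis a ⬝ᵥ n) * D.axis a 0 - n 0) = 0)
    (h1 : ∑ a, D.prob a * (2 * (D.axis a ⬝ᵥ n) * D.axis a 1 - n 1) = 0) (a : Fin 3) :
    D.axis a 2 ^ 2 = 1 / 2 := by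
  have t := D.plane_trace hN hP
  have s := D.sum_prob_one
  have m0 := D.moment_one hN hP 0
  have m1 := D.moment_one hN hP 1
  simp only [Fin.isValue, Fin.reduceEq, if_false] at m0 m1
  have q0 : (∑ a, D.prob a * (2 * (D.axis a ⬝ᵥ n) * D.axis a 0 - n 0)) =
      2 * n 0 * (∑ a, D.prob a * (D.axis a 0 * D.axis a 0)) +
      2 * n 1 * (∑ a, D.prob a * (D.axis a 0 * D.axis a 1)) +
      2 * n 2 * (∑ a, D.prob a * (D.axis a 2 * D.axis a 0)) - n 0 * ∑ a, D.prob a := by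
    simp only [dotProduct, Fin.sum_univ_three]; ring
  have q1 : (∑ a, D.prob a * (2 * (D.axis a ⬝ᵥ n) * D.axis a 1 - n 1)) =
      2 * n 0 * (∑ a, D.prob a * (D.axis a 0 * D.axis a 1)) +
      2 * n 1 * (∑ a, D.prob a * (D.axis a 1 * D.axis a 1)) +
      2 * n 2 * (∑ a, D.prob a * (D.axis a 2 * D.axis a 1)) - n 1 * ∑ a, D.prob a := by
    simp only [dotProduct, Fin.sum_univ_three]; ring
  rw [h0, m0, s] at q0
  rw [h1, m1, s] at q1
  have hd' : (∑ a, D.prob a * (D.axis a 0 * D.axis a 0)) * (∑ a, D.prob a * (D.axis a 1 * D.axis a 1)) -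
      (∑ a, D.prob a * (D.axis a 0 * D.axis a 1)) ^ 2 ≠ 0 := by
    simpa only [planeDet, sq (D.axis _ _)] using hd
  set A := ∑ a, D.prob a * (D.axis a 0 * D.axis a 0)
  set B := ∑ a, D.prob a * (D.axis a 0 * D.axis a 1)
  set C := ∑ a, D.prob a * (D.axis a 1 * D.axis a 1)
  have hn0 : n 0 = 0 := by
    have : 4 * (A * C - B ^ 2) * n 0 = 0 := by
      linear_combination 2 * n 0 * t - (2 * C - 1) * q0 + 2 * B * q1
    exact (mul_eq_zero.1 this).resolve_left (mul_ne_zero (by norm_num) hd')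
  have hn1' : n 1 = 0 := by
    have : 4 * (A * C - B ^ 2) * n 1 = 0 := by
      linear_combination 2 * n 1 * t - (2 * A - 1) * q1 + 2 * B * q0
    exact (mul_eq_zero.1 this).resolve_left (mul_ne_zero (by norm_num) hd')
  have ha := hn a
  simp only [dotProduct, Fin.sum_univ_three, hn0, hn1', mul_zero, zero_add] at ha hn1
  have hn2 : n 2 ≠ 0 := by rintro e; rw [e] at hn1; norm_num at hn1
  have : n 2 * (D.axis a 2 ^ 2 - 1 / 2) = 0 := by linear_combination (1 / 2) * ha
  linarith [(mul_eq_zero.1 this).resolve_left hn2]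

theorem mean_transverse (D : HalfTurns P i) (n : Fin 3 → ℝ) :
    ∑ a, (D.prob a : ℂ) * D.transverse n a =
      ((∑ a, D.prob a * (2 * (D.axis a ⬝ᵥ n) * D.axis a 0 - n 0) : ℝ) : ℂ) +
        (∑ a, D.prob a * (2 * (D.axis a ⬝ᵥ n) * D.axis a 1 - n 1) : ℝ) * Complex.I := by
  push_cast
  simp only [transverse, halfTurn, cvec, dotProduct, Finset.sum_mul, ← Finset.sum_add_distrib]
  refine Finset.sum_congr rfl fun a _ => ?_
  push_cast
  ring

theorem mean_transverse' (D : HalfTurns P i) (n : Fin 3 → ℝ) :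
    ∑ a, (D.prob a : ℂ) * D.transverse' n a =
      star (∑ a, (D.prob a : ℂ) * D.transverse n a) := by
  rw [star_sum]
  refine Finset.sum_congr rfl fun a _ => ?_
  simp [transverse, transverse', halfTurn, cvec]
  left
  ring

/-- Among five nodes without the polar axis there is a centered one. -/
theorem exists_centered (hN : 3 ≤ N) (hP : P.Distributes (pure (wState N))) {g : Fin 5 → Fin N}
    (hg : g.Injective) (D : ∀ t, HalfTurns P (g t)) (hd : ∀ t, planeDet (D t).prob (D t).axis ≠ 0)
    (hz : ∀ t a a', a ≠ a' → (D t).axis a 2 = 0 → (D t).axis a' 2 ≠ 0) :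
    ∃ t, ∀ a, (D t).axis a 2 ^ 2 = 1 / 2 := by
  choose n hn1 hn using fun t => (D t).exists_normal hN hP
  choose ℓ hℓ hf using fun t => (D t).exists_tangent hN hP (hd t) (hz t) (hn1 t) (hn t)
  have key := pentagon (fun s t => (D t).label s) (fun t => (D t).transverse (n t))
    (fun t => (D t).transverse' (n t)) (fun t f => (D t).tangentAmp (n t) (ℓ t f))
    (fun t f => ∑ a, ((D t).prob a : ℂ) * f a) ((N : ℂ) - (5 : ℕ)) (2 ^ N * N) (by
      intro M τ hM
      have hH : ∀ t, ∃ H : Matrix (Fin 2) (Fin 2) ℂ, H.trace / 2 = τ t ∧ ∀ s,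
          (P.recovery (g t) (P.msg (g t) s) : Matrix (Fin 2) (Fin 2) ℂ) * ((D t).frameᴴ * H * (D t).frame) *
          (P.recovery (g t) (P.msg (g t) s) : Matrix (Fin 2) (Fin 2) ℂ)ᴴ = M t ((D t).label s) := by
        intro t
        rcases hM t with ⟨f, h1, h2⟩ | ⟨h1, h2⟩
        · refine ⟨(∑ a, ((D t).prob a : ℂ) * f a) • 1 + pauliVec (ℓ t f), ?_, fun s => ?_⟩
          · rw [Matrix.trace_add, pauliVec_trace, Matrix.trace_smul, Matrix.trace_one, h2]
            simp
          · rw [h1]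
            exact (D t).tangent_sandwich (hn1 t) (hn t) (hℓ t f) (hf t f) s
        · refine ⟨pauliVec (cvec (n t)), by rw [pauliVec_trace, h2]; simp, fun s => ?_⟩
          rw [h1]
          exact (D t).normal_sandwich (hn t) s
      choose H hτ hs using hH
      rw [sum_sandwich_extend (by omega) P hP hg (fun t => (D t).frameᴴ * H t * (D t).frame)
        (fun s t => M t ((D t).label s)) (fun s t => hs t s)]
      simp only [trace_frame (D _).frame_unitary, hτ]
      ring)
  have hK : (2 ^ N * N : ℂ) ≠ 0 := by
    have : (N : ℂ) ≠ 0 := by exact_mod_cast (by omega : N ≠ 0)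
    exact mul_ne_zero (pow_ne_zero _ two_ne_zero) this
  have key2 := (mul_eq_zero.1 key).resolve_left hK
  have fin : ∃ t, ∑ a, ((D t).prob a : ℂ) * (D t).transverse (n t) a = 0 := by
    simp only [mean_transverse', mul_eq_zero, star_eq_zero] at key2
    rcases key2 with (((h | h) | h) | h) | h
    exacts [⟨0, h⟩, ⟨1, h⟩, ⟨2, h⟩, ⟨3, h⟩, ⟨4, h⟩]
  obtain ⟨t, ht⟩ := fin
  refine ⟨t, (D t).centered_of_mean hN hP (hd t) (hn1 t) (hn t) ?_ ?_⟩
  · rw [mean_transverse] at ht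
    have := congrArg Complex.re ht
    rwa [Complex.add_re, Complex.re_ofReal_mul, Complex.I_re, mul_zero, add_zero, Complex.ofReal_re,
      Complex.zero_re] at this
  · rw [mean_transverse] at ht
    have := congrArg Complex.im ht
    rwa [Complex.add_im, Complex.im_ofReal_mul, Complex.I_im, mul_one, Complex.ofReal_im, zero_add,
      Complex.zero_im] at this

end HalfTurns

/-! ### Excluding five nodes with at most three messages -/

namespace HalfTurns

variable {N : ℕ} {P : Protocol N} {i j k : Fin N}

theorem joint_pos (D : HalfTurns P i) (D' : HalfTurns P j) (s : Bits N) :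
    0 < D.joint D' (D.label s) (D'.label s) := by
  have : (1 / 2 ^ N : ℝ) ≤ D.joint D' (D.label s) (D'.label s) := by
    refine le_trans (le_of_eq ?_) (Finset.single_le_sum (fun t _ => ?_) (Finset.mem_univ s))
    · simp
    · split_ifs <;> positivity
  exact lt_of_lt_of_le (by positivity) this

/-- Of three nodes with a polar axis, one always has it. -/
theorem exists_polar_of_three (hN : 3 ≤ N) (hP : P.Distributes (pure (wState N))) (hij : i ≠ j)
    (hik : i ≠ k) (hjk : j ≠ k) (D : HalfTurns P i) (D' : HalfTurns P j) (D'' : HalfTurns P k)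
    (hd : planeDet D.prob D.axis ≠ 0) (hd' : planeDet D'.prob D'.axis ≠ 0)
    (hd'' : planeDet D''.prob D''.axis ≠ 0) {a b c : Fin 3}
    (ha : D.axis a 0 = 0 ∧ D.axis a 1 = 0) (hb : D'.axis b 0 = 0 ∧ D'.axis b 1 = 0)
    (hc : D''.axis c 0 = 0 ∧ D''.axis c 1 = 0) (s : Bits N) (h1 : D.label s ≠ a) (h2 : D'.label s ≠ b)
    (h3 : D''.label s ≠ c) : False := by
  have p12 := D.axisPair hN hP hij D'
  have p13 := D.axisPair hN hP hik D''
  have p23 := D'.axisPair hN hP hjk D''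
  have r12 := D.regular hN hP D' hd hd'
  have r13 := D.regular hN hP D'' hd hd''
  have r23 := D'.regular hN hP D'' hd' hd''
  have o12 := (mul_eq_zero.1 (p12.polar_orthogonal r12 hb.1 hb.2 (D.label s) (D'.label s))).resolve_left
    (D.joint_pos D' s).ne'
  have o13 := (mul_eq_zero.1 (p13.polar_orthogonal r13 hc.1 hc.2 (D.label s) (D''.label s))).resolve_left
    (D.joint_pos D'' s).ne'
  have o23 := (mul_eq_zero.1 (p23.polar_orthogonal r23 hc.1 hc.2 (D'.label s) (D''.label s))).resolve_left
    (D'.joint_pos D'' s).ne'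
  have z1 := (p12.swap.polar_right r12.swap ha.1 ha.2).2 _ h1
  have z2 := (p12.polar_right r12 hb.1 hb.2).2 _ h2
  have z3 := (p13.polar_right r13 hc.1 hc.2).2 _ h3
  have n1 := p12.unit_left (D.label s)
  have n2 := p12.unit_right (D'.label s)
  have n3 := p13.unit_right (D''.label s)
  rw [z1] at n1
  rw [z2] at n2
  rw [z3] at n3
  -- The Gram determinant of three plane vectors vanishes; for three orthonormal ones it would be 1.
  have gram : ∀ u₀ u₁ v₀ v₁ w₀ w₁ : ℝ, (u₀ ^ 2 + u₁ ^ 2 + 0 ^ 2) * (v₀ ^ 2 + v₁ ^ 2 + 0 ^ 2) * (w₀ ^ 2 + w₁ ^ 2 + 0 ^ 2) +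
      2 * (u₀ * v₀ + u₁ * v₁) * (u₀ * w₀ + u₁ * w₁) * (v₀ * w₀ + v₁ * w₁) -
      (u₀ ^ 2 + u₁ ^ 2 + 0 ^ 2) * (v₀ * w₀ + v₁ * w₁) ^ 2 - (v₀ ^ 2 + v₁ ^ 2 + 0 ^ 2) * (u₀ * w₀ + u₁ * w₁) ^ 2 -
      (w₀ ^ 2 + w₁ ^ 2 + 0 ^ 2) * (u₀ * v₀ + u₁ * v₁) ^ 2 = 0 := by intros; ring
  have := gram (D.axis (D.label s) 0) (D.axis (D.label s) 1) (D'.axis (D'.label s) 0)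
    (D'.axis (D'.label s) 1) (D''.axis (D''.label s) 0) (D''.axis (D''.label s) 1)
  rw [n1, n2, n3, o12, o13, o23] at this
  norm_num at this

/-- There are no four nodes with a polar axis. -/
theorem not_four_polar (hN : 5 ≤ N) (hP : P.Distributes (pure (wState N))) {g : Fin 4 → Fin N}
    (hg : g.Injective) (D : ∀ t, HalfTurns P (g t)) (hd : ∀ t, planeDet (D t).prob (D t).axis ≠ 0)
    (b : Fin 4 → Fin 3) (hb : ∀ t, (D t).axis (b t) 0 = 0 ∧ (D t).axis (b t) 1 = 0) : False := by
  have hN3 : 3 ≤ N := by omega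
  have hκ : (N : ℝ) - 4 ≠ 0 := by
    have : (5 : ℝ) ≤ N := by exact_mod_cast hN
    linarith
  set χ : Fin 4 → Bits N → ℝ := fun t s => if (D t).label s = b t then 0 else 1 with hχ
  have e1 : ∀ t, (1 / 2 ^ N : ℝ) * ∑ s, χ t s = 1 / 2 := by
    intro t
    obtain ⟨t', ht'⟩ : ∃ t' : Fin 4, t' ≠ t := by revert t; decide
    have hp := ((D t').axisPair hN3 hP (fun e => ht' (hg e)) (D t)).polar_right
      ((D t').regular hN3 hP (D t) (hd t') (hd t)) (hb t).1 (hb t).2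
    have h1 := (D t).sum_prob (fun a => if a = b t then 0 else 1)
    rw [← h1]
    have h2 := (D t).sum_prob_one
    have h3 : (D t).prob (b t) = 1 / 2 := by rw [← hp.1, joint_right]
    have : ∑ a, (D t).prob a * (if a = b t then 0 else 1) =
        ∑ a, (D t).prob a - ∑ a, if a = b t then (D t).prob a else 0 := by
      rw [← Finset.sum_sub_distrib]
      exact Finset.sum_congr rfl fun a _ => by split_ifs <;> simp
    rw [this, h2, Finset.sum_ite_eq' , if_pos (Finset.mem_univ _), h3]
    norm_num
  have e2 : ∀ t t', t ≠ t' → (1 / 2 ^ N : ℝ) * ∑ s, χ t s * χ t' s = 1 / 4 := by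
    intro t t' htt
    have hpair := (D t).axisPair hN3 hP (fun e => htt (hg e)) (D t')
    have hreg := (D t).regular hN3 hP (D t') (hd t) (hd t')
    have h4 := hpair.polar_polar hreg hκ (hb t).1 (hb t).2 (hb t').1 (hb t').2
    have h5 := (D t).expect_joint (D t') (fun a c => if a = b t ∧ c = b t' then 1 else 0)
    have h6 : expect ((D t).joint (D t')) (fun a c => if a = b t ∧ c = b t' then 1 else 0) =
        (D t).joint (D t') (b t) (b t') := by
      simp only [expect]
      rw [Finset.sum_eq_single (b t) (fun a _ ha => by simp [ha]) (by simp),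
        Finset.sum_eq_single (b t') (fun a _ ha => by simp [ha]) (by simp)]
      simp
    rw [h6, h4] at h5
    have h7 : ∀ s, χ t s * χ t' s = χ t s + χ t' s - 1 +
        if (D t).label s = b t ∧ (D t').label s = b t' then 1 else 0 := by
      intro s
      simp only [hχ]
      by_cases x1 : (D t).label s = b t <;> by_cases x2 : (D t').label s = b t' <;> simp [x1, x2]
    simp only [h7, Finset.sum_add_distrib, Finset.sum_sub_distrib]
    have h8 := sum_one N
    linear_combination e1 t + e1 t' - h8 - h5
  -- At most two of the four indicators are 1, so their sum $S\in\{0,1,2\}$ satisfies $S^2\le2S$.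
  -- But $E[S]=2$ and $E[S^2]=2+12\cdot\tfrac14=5$.
  have e3 : ∀ s, (∑ t, χ t s) ^ 2 ≤ 2 * ∑ t, χ t s := by
    intro s
    have h01 : ∀ t, χ t s = 0 ∨ χ t s = 1 := fun t => by simp only [hχ]; split_ifs <;> simp
    have htriple : ∀ t t' t'', t ≠ t' → t ≠ t'' → t' ≠ t'' → χ t s * χ t' s * χ t'' s = 0 := by
      intro t t' t'' x1 x2 x3
      by_contra hne
      have y1 : (D t).label s ≠ b t := fun e => hne (by simp [hχ, e])
      have y2 : (D t').label s ≠ b t' := fun e => hne (by simp [hχ, e])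
      have y3 : (D t'').label s ≠ b t'' := fun e => hne (by simp [hχ, e])
      exact exists_polar_of_three hN3 hP (fun e => x1 (hg e)) (fun e => x2 (hg e)) (fun e => x3 (hg e))
        (D t) (D t') (D t'') (hd t) (hd t') (hd t'') (hb t) (hb t') (hb t'') s y1 y2 y3
    have t1 := htriple 0 1 2 (by decide) (by decide) (by decide)
    have t2 := htriple 0 1 3 (by decide) (by decide) (by decide)
    have t3 := htriple 0 2 3 (by decide) (by decide) (by decide)
    have t4 := htriple 1 2 3 (by decide) (by decide) (by decide)
    rw [Fin.sum_univ_four]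
    rcases h01 0 with q0 | q0 <;> rcases h01 1 with q1 | q1 <;> rcases h01 2 with q2 | q2 <;>
      rcases h01 3 with q3 | q3 <;> rw [q0, q1, q2, q3] <;> norm_num <;>
      simp [q0, q1, q2, q3] at t1 t2 t3 t4
  have e4 : (1 / 2 ^ N : ℝ) * ∑ s, (∑ t, χ t s) ^ 2 ≤ (1 / 2 ^ N : ℝ) * ∑ s, 2 * ∑ t, χ t s :=
    mul_le_mul_of_nonneg_left (Finset.sum_le_sum fun s _ => e3 s) (by positivity)
  have e5 : (1 / 2 ^ N : ℝ) * ∑ s, 2 * ∑ t, χ t s = 4 := by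
    rw [← Finset.mul_sum, Finset.sum_comm, Fin.sum_univ_four]
    linear_combination 2 * e1 0 + 2 * e1 1 + 2 * e1 2 + 2 * e1 3
  have e6 : (1 / 2 ^ N : ℝ) * ∑ s, (∑ t, χ t s) ^ 2 = 5 := by
    have hsq : ∀ t s, χ t s * χ t s = χ t s := fun t s => by simp only [hχ]; split_ifs <;> simp
    have : ∀ s, (∑ t, χ t s) ^ 2 = χ 0 s + χ 1 s + χ 2 s + χ 3 s + 2 * (χ 0 s * χ 1 s) +
        2 * (χ 0 s * χ 2 s) + 2 * (χ 0 s * χ 3 s) + 2 * (χ 1 s * χ 2 s) + 2 * (χ 1 s * χ 3 s) +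
        2 * (χ 2 s * χ 3 s) := by
      intro s
      rw [Fin.sum_univ_four]
      linear_combination hsq 0 s + hsq 1 s + hsq 2 s + hsq 3 s
    simp only [this, Finset.sum_add_distrib, ← Finset.mul_sum]
    linear_combination e1 0 + e1 1 + e1 2 + e1 3 + 2 * e2 0 1 (by decide) + 2 * e2 0 2 (by decide) +
      2 * e2 0 3 (by decide) + 2 * e2 1 2 (by decide) + 2 * e2 1 3 (by decide) + 2 * e2 2 3 (by decide)
  rw [e5, e6] at e4
  norm_num at e4

/-- At most four end nodes receive at most three different messages. -/
theorem not_five (hP : P.Distributes (pure (wState N))) {g : Fin 5 → Fin N}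
    (hg : g.Injective) (D : ∀ t, HalfTurns P (g t)) : False := by
  have hN : 5 ≤ N := by simpa using Fintype.card_le_of_injective g hg
  have hN3 : 3 ≤ N := by omega
  have hκ : (N : ℝ) - 4 ≠ 0 := by
    have : (5 : ℝ) ≤ N := by exact_mod_cast hN
    linarith
  have hd : ∀ t, planeDet (D t).prob (D t).axis ≠ 0 := by
    intro t
    obtain ⟨t', t'', h1, h2, h3⟩ : ∃ t' t'' : Fin 5, t ≠ t' ∧ t ≠ t'' ∧ t' ≠ t'' := by revert t; decide
    exact planeDet_ne_zero hN3 hP (fun e => h1 (hg e)) (fun e => h2 (hg e)) (fun e => h3 (hg e))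
      (D t) (D t') (D t'')
  have pair := fun t t' (h : t ≠ t') => (D t).axisPair hN3 hP (fun e => h (hg e)) (D t')
  have reg := fun t t' => (D t).regular hN3 hP (D t') (hd t) (hd t')
  by_cases hB : ∃ t a, (D t).axis a 0 = 0 ∧ (D t).axis a 1 = 0
  · by_cases hA : ∃ t, ∀ a, ¬ ((D t).axis a 0 = 0 ∧ (D t).axis a 1 = 0)
    · obtain ⟨t, a, ha⟩ := hB
      obtain ⟨t', ht'⟩ := hA
      have hne : t' ≠ t := by rintro rfl; exact ht' a ha
      exact (pair t' t hne).not_polar_mixed (reg t' t) hκ ha.1 ha.2 ht'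
    · push Not at hA
      choose b hb using hA
      exact not_four_polar hN hP (g := fun t : Fin 4 => g t.castSucc)
        (fun x y e => Fin.castSucc_injective _ (hg e)) (fun t => D t.castSucc) (fun t => hd _)
        (fun t => b t.castSucc) (fun t => hb _)
  · push Not at hB
    have hB' : ∀ t a, ¬ ((D t).axis a 0 = 0 ∧ (D t).axis a 1 = 0) := fun t a h => hB t a h.1 h.2
    have next : ∀ t : Fin 5, ∃ t', t ≠ t' := by decide
    obtain ⟨t, ht⟩ := exists_centered hN3 hP hg D hd (fun t a a' haa h0 => by
      obtain ⟨t', ht'⟩ := next t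
      exact (pair t t' ht').left_z_ne (reg t t') (hB' t) haa h0)
    obtain ⟨t', ht'⟩ := next t
    exact (pair t' t ht'.symm).not_centered (reg t' t) hκ ht (hB' t')

end HalfTurns

/-! ### The lower bound on the cost -/

/-- The largest message to an end node. -/
def maxMsg {N : ℕ} (P : Protocol N) (k : Fin N) : ℕ := Finset.univ.sup fun s => (P.msg k s : ℕ)

theorem le_maxMsg {N : ℕ} (P : Protocol N) (k : Fin N) (s : Bits N) : (P.msg k s : ℕ) ≤ maxMsg P k :=
  Finset.le_sup (f := fun s => (P.msg k s : ℕ)) (Finset.mem_univ s)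

/-- A single axis would have $u_z^2=1/2$ and $u_zu_x=u_zu_y=0$, which is impossible for a unit
vector. -/
theorem two_le_maxMsg {N : ℕ} (hN : 3 ≤ N) (P : Protocol N) (hP : P.Distributes (pure (wState N)))
    (k : Fin N) : 2 ≤ maxMsg P k := by
  by_contra hlt
  have hone : ∀ s, (P.msg k s : ℕ) = 1 := fun s => by
    have := le_maxMsg P k s
    have := (P.msg k s).pos
    omega
  obtain ⟨D⟩ := exists_halfTurns P k (fun s => by rw [hone s]; norm_num)
  have hl : ∀ s, D.label s = 0 := fun s => by
    have := D.label_eq s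
    rw [hone s] at this
    exact Fin.ext (by simp only [Fin.val_zero]; omega)
  have hm := D.moment_one hN hP
  have hs : ∀ f : Fin 3 → ℝ, ∑ a, D.prob a * f a = f 0 := fun f => by
    rw [D.sum_prob]
    have := HalfTurns.sum_one N
    simp only [hl]
    rw [show ∑ _s : Bits N, f 0 = f 0 * ∑ _s : Bits N, (1 : ℝ) by rw [Finset.mul_sum]; simp]
    linear_combination f 0 * this
  have m0 := hm 0
  have m1 := hm 1
  have m2 := hm 2
  rw [hs fun a => D.axis a 2 * D.axis a 0] at m0
  rw [hs fun a => D.axis a 2 * D.axis a 1] at m1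
  rw [hs fun a => D.axis a 2 * D.axis a 2] at m2
  simp only [Fin.isValue, Fin.reduceEq, if_false, if_true] at m0 m1 m2
  have u := D.unit 0
  rw [dotProduct, Fin.sum_univ_three] at u
  have hne : D.axis 0 2 ≠ 0 := by intro e; rw [e] at m2; norm_num at m2
  rw [(mul_eq_zero.1 m0).resolve_left hne, (mul_eq_zero.1 m1).resolve_left hne, m2] at u
  norm_num at u

/-- Equal messages mean equal recoveries, so the two rows of `U` would both be phases times the same
preimage of the W state, against their orthogonality. -/
theorem msg_injective {N : ℕ} (hN : 0 < N) (P : Protocol N) (hP : P.Distributes (pure (wState N)))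
    {s s' : Bits N} (h : ∀ k, P.msg k s = P.msg k s') : s = s' := by
  by_contra hne
  obtain ⟨c, hc, hs⟩ := exists_phase hN P hP s
  obtain ⟨c', hc', hs'⟩ := exists_phase hN P hP s'
  have back : ∀ t, (P.U : Matrix (Bits N) (Bits N) ℂ) t =
      (tensor fun k => (P.recovery k (P.msg k t) : Matrix (Fin 2) (Fin 2) ℂ))ᴴ *ᵥ endState P t := by
    intro t
    rw [endState, Matrix.mulVec_mulVec, recovery_tensor_unitary, Matrix.one_mulVec]
  have h1 := back s
  have h2 := back s'
  simp only [h] at h1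
  rw [hs, Matrix.mulVec_smul] at h1
  rw [hs', Matrix.mulVec_smul] at h2
  have hU := Matrix.mem_unitaryGroup_iff.1 P.U.2
  have o1 := congrFun (congrFun hU s) s'
  have o2 := congrFun (congrFun hU s') s'
  rw [Matrix.one_apply_ne hne, Matrix.mul_apply] at o1
  rw [Matrix.one_apply_eq, Matrix.mul_apply] at o2
  have hc0 : c ≠ 0 := by rintro rfl; simp at hc
  have e : ∀ d, (P.U : Matrix (Bits N) (Bits N) ℂ) s' d = c' * c⁻¹ * (P.U : Matrix (Bits N) (Bits N) ℂ) s d := by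
    intro d
    rw [h1, h2]
    simp only [Pi.smul_apply, smul_eq_mul]
    field_simp
  have : ∑ d, (P.U : Matrix (Bits N) (Bits N) ℂ) s' d * (star (P.U : Matrix (Bits N) (Bits N) ℂ)) d s' =
      c' * c⁻¹ * ∑ d, (P.U : Matrix (Bits N) (Bits N) ℂ) s d * (star (P.U : Matrix (Bits N) (Bits N) ℂ)) d s' := by
    rw [Finset.mul_sum]
    exact Finset.sum_congr rfl fun d _ => by rw [e d]; ring
  rw [o1, o2] at this
  simp at this

theorem two_pow_le_prod_maxMsg {N : ℕ} (hN : 0 < N) (P : Protocol N)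
    (hP : P.Distributes (pure (wState N))) : 2 ^ N ≤ ∏ k, maxMsg P k := by
  have hl : ∀ s k, (P.msg k s : ℕ) - 1 < maxMsg P k := fun s k => by
    have := le_maxMsg P k s
    have := (P.msg k s).pos
    omega
  have hinj : Function.Injective (fun (s : Bits N) (k : Fin N) =>
      (⟨(P.msg k s : ℕ) - 1, hl s k⟩ : Fin (maxMsg P k))) := by
    intro s s' h
    refine msg_injective hN P hP fun k => PNat.eq ?_
    have h1 := congrArg Fin.val (congrFun h k)
    simp only at h1
    have := (P.msg k s).pos
    have := (P.msg k s').pos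
    omega
  simpa using Fintype.card_le_of_injective _ hinj

/-- Only nodes in `S` fall short of a factor 4, and the total shortfall must stay within one factor
4. Two nodes with two messages each, or four with three each, are within it; five with three each
are not, since $4\cdot3^5<4^5$. -/
theorem four_pow_le {N : ℕ} (hN : 2 ≤ N) (P : Protocol N) (hP : P.Distributes (pure (wState N))) :
    4 ^ N ≤ 4 * ∏ k, maxMsg P k := by
  -- For $N=2$ the one-body correlators are void, but the four outcomes need distinct message
  -- tuples, which is already enough.
  rcases Nat.eq_or_lt_of_le hN with rfl | hN3
  · have := two_pow_le_prod_maxMsg (by norm_num) P hP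
    norm_num at this ⊢
    omega
  replace hN3 : 3 ≤ N := hN3
  set S : Finset (Fin N) := Finset.univ.filter fun k => maxMsg P k ≤ 3 with hS
  have hD : ∀ k ∈ S, Nonempty (HalfTurns P k) := fun k hk =>
    exists_halfTurns P k fun s => (le_maxMsg P k s).trans (Finset.mem_filter.1 hk).2
  have hcard : S.card ≤ 4 := by
    by_contra hlt
    push Not at hlt
    obtain ⟨T, hT, hT5⟩ := Finset.exists_subset_card_eq hlt
    have D : ∀ t, HalfTurns P (T.orderEmbOfFin hT5 t) := fun t =>
      (hD _ (hT (Finset.orderEmbOfFin_mem T hT5 t))).some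
    exact HalfTurns.not_five hP (T.orderEmbOfFin hT5).injective D
  have hthree : 3 ≤ S.card → ∀ k ∈ S, 3 ≤ maxMsg P k := by
    intro h3 k hk
    obtain ⟨D⟩ := hD k hk
    have h2 : 1 < (S.erase k).card := by rw [Finset.card_erase_of_mem hk]; omega
    obtain ⟨a, ha, b, hb, hab⟩ := Finset.one_lt_card.1 h2
    obtain ⟨Da⟩ := hD a (Finset.mem_of_mem_erase ha)
    obtain ⟨Db⟩ := hD b (Finset.mem_of_mem_erase hb)
    have hd := HalfTurns.planeDet_ne_zero hN3 hP (Finset.ne_of_mem_erase ha).symm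
      (Finset.ne_of_mem_erase hb).symm hab D Da Db
    obtain ⟨s, hs⟩ := D.exists_msg_eq_three hN3 hP hd
    rw [← hs]
    exact le_maxMsg P k s
  have hcompl : 4 ^ (N - S.card) ≤ ∏ k ∈ Sᶜ, maxMsg P k := by
    have : N - S.card = Sᶜ.card := by rw [Finset.card_compl, Fintype.card_fin]
    rw [this]
    refine Finset.pow_card_le_prod _ _ _ fun k hk => ?_
    simp only [hS, Finset.mem_compl, Finset.mem_filter, Finset.mem_univ, true_and] at hk
    omega
  have hSN : S.card ≤ N := by simpa using Finset.card_le_univ S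
  have hpow : 4 ^ N = 4 ^ S.card * 4 ^ (N - S.card) := by rw [← pow_add]; congr 1; omega
  have main : 4 ^ S.card ≤ 4 * ∏ k ∈ S, maxMsg P k := by
    by_cases h3 : 3 ≤ S.card
    · have : 3 ^ S.card ≤ ∏ k ∈ S, maxMsg P k := Finset.pow_card_le_prod _ _ _ (hthree h3)
      refine le_trans ?_ (Nat.mul_le_mul_left 4 this)
      interval_cases S.card <;> norm_num
    · have : 2 ^ S.card ≤ ∏ k ∈ S, maxMsg P k :=
        Finset.pow_card_le_prod _ _ _ fun k _ => two_le_maxMsg hN3 P hP k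
      refine le_trans ?_ (Nat.mul_le_mul_left 4 this)
      push Not at h3
      interval_cases S.card <;> norm_num
  rw [hpow, ← Finset.prod_mul_prod_compl S, ← mul_assoc]
  exact Nat.mul_le_mul main hcompl

theorem le_cost {N : ℕ} (hN : 2 ≤ N) (P : Protocol N) (hP : P.Distributes (pure (wState N))) :
    2 * (N : ℝ) - 2 ≤ P.cost := by
  have h := four_pow_le hN P hP
  have h1 : (4 : ℝ) ^ N ≤ 4 * ((∏ k, maxMsg P k : ℕ) : ℝ) := by exact_mod_cast h
  have hpos : (0 : ℝ) < ((∏ k, maxMsg P k : ℕ) : ℝ) := by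
    have : (0 : ℝ) < 4 ^ N := by positivity
    linarith
  change _ ≤ Real.logb 2 ((∏ k, maxMsg P k : ℕ) : ℝ)
  rw [Real.le_logb_iff_rpow_le (by norm_num) hpos]
  have e : (2 : ℝ) ^ (2 * (N : ℝ) - 2) = 4 ^ N / 4 := by
    rw [Real.rpow_sub (by norm_num), Real.rpow_mul (by norm_num), Real.rpow_natCast]
    norm_num
  rw [e]
  linarith

/-! ### The explicit protocol -/

/-- The tensor factors of the `r`-th term of `wUnitary`. -/
noncomputable def jordanWigner {N : ℕ} (r j : Fin N) : Matrix (Fin 2) (Fin 2) ℂ :=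
  if j < r then pauliZ else if j = r then pauliX else 1

theorem wUnitary_eq (N : ℕ) :
    wUnitary N = (((√(N : ℝ) : ℝ) : ℂ)⁻¹) • ∑ r : Fin N, tensor (jordanWigner r) := rfl

theorem pauliX_mul_pauliX : pauliX * pauliX = 1 := by
  ext i j; fin_cases i <;> fin_cases j <;> simp [pauliX, Matrix.mul_apply, Fin.sum_univ_two]

theorem pauliZ_mul_pauliZ : pauliZ * pauliZ = 1 := by
  ext i j; fin_cases i <;> fin_cases j <;> simp [pauliZ, Matrix.mul_apply, Fin.sum_univ_two]

theorem pauliX_mul_pauliZ : pauliX * pauliZ = (-1 : ℂ) • (pauliZ * pauliX) := by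
  ext i j
  fin_cases i <;> fin_cases j <;> simp [pauliX, pauliZ, Matrix.mul_apply, Fin.sum_univ_two]

theorem pauliX_conjTranspose : pauliXᴴ = pauliX := by
  ext i j; fin_cases i <;> fin_cases j <;> simp [pauliX]

theorem pauliZ_conjTranspose : pauliZᴴ = pauliZ := by
  ext i j; fin_cases i <;> fin_cases j <;> simp [pauliZ]

theorem jordanWigner_sq {N : ℕ} (r : Fin N) :
    tensor (jordanWigner r) * tensor (jordanWigner r) = 1 := by
  rw [tensor_mul, ← tensor_one]
  congr 1
  funext j
  unfold jordanWigner
  split_ifs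
  · exact pauliZ_mul_pauliZ
  · exact pauliX_mul_pauliX
  · exact one_mul 1

theorem jordanWigner_conjTranspose {N : ℕ} (r : Fin N) :
    (tensor (jordanWigner r))ᴴ = tensor (jordanWigner r) := by
  rw [tensor_conjTranspose]
  congr 1
  funext j
  unfold jordanWigner
  split_ifs
  · exact pauliZ_conjTranspose
  · exact pauliX_conjTranspose
  · exact Matrix.conjTranspose_one

/-- The factors commute at every position except `r`, where $X$ meets $Z$. -/
theorem jordanWigner_anticomm_of_lt {N : ℕ} {r r' : Fin N} (h : r < r') :
    tensor (jordanWigner r) * tensor (jordanWigner r') +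
      tensor (jordanWigner r') * tensor (jordanWigner r) = 0 := by
  have e : tensor (jordanWigner r) * tensor (jordanWigner r') =
      -(tensor (jordanWigner r') * tensor (jordanWigner r)) := by
    rw [tensor_mul, tensor_mul]
    have : (fun k => jordanWigner r k * jordanWigner r' k) =
        fun k => (if k = r then (-1 : ℂ) else 1) • (jordanWigner r' k * jordanWigner r k) := by
      funext k
      unfold jordanWigner
      by_cases h1 : k < r
      · simp [h1, h1.trans h, h1.ne]
      · by_cases h2 : k = r
        · subst h2
          simp only [lt_irrefl, if_false, if_true, h]
          exact pauliX_mul_pauliZ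
        · simp [h1, h2]
    rw [this, tensor_smul]
    simp
  rw [e, neg_add_cancel]

theorem wUnitary_mem {N : ℕ} (hN : 0 < N) : wUnitary N ∈ Matrix.unitaryGroup (Bits N) ℂ := by
  rw [Matrix.mem_unitaryGroup_iff, wUnitary_eq, Matrix.star_eq_conjTranspose, Matrix.conjTranspose_smul,
    Matrix.conjTranspose_sum]
  simp only [jordanWigner_conjTranspose]
  rw [Matrix.smul_mul, Matrix.mul_smul, smul_smul, Matrix.sum_mul]
  simp only [Matrix.mul_sum]
  have hsum : ∑ r : Fin N, ∑ r' : Fin N, tensor (jordanWigner r) * tensor (jordanWigner r') =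
      (N : ℂ) • (1 : Matrix (Bits N) (Bits N) ℂ) := by
    have hanti : ∀ r r' : Fin N, tensor (jordanWigner r) * tensor (jordanWigner r') +
        tensor (jordanWigner r') * tensor (jordanWigner r) =
        if r = r' then (2 : ℂ) • (1 : Matrix (Bits N) (Bits N) ℂ) else 0 := by
      intro r r'
      rcases lt_trichotomy r r' with h | h | h
      · rw [if_neg h.ne, jordanWigner_anticomm_of_lt h]
      · subst h
        rw [if_pos rfl, jordanWigner_sq, two_smul]
      · rw [if_neg h.ne', add_comm, jordanWigner_anticomm_of_lt h]
    -- Doubling the sum and exchanging `r` and `r'` in one copy produces anticommutators, of which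
    -- only the diagonal ones survive.
    have h2 : (2 : ℂ) • ∑ r : Fin N, ∑ r' : Fin N, tensor (jordanWigner r) * tensor (jordanWigner r') =
        (2 : ℂ) • ((N : ℂ) • (1 : Matrix (Bits N) (Bits N) ℂ)) := by
      rw [two_smul]
      nth_rewrite 2 [Finset.sum_comm]
      simp only [← Finset.sum_add_distrib, hanti]
      simp [smul_smul, mul_comm, ← Nat.cast_smul_eq_nsmul ℂ]
    exact smul_right_injective _ (two_ne_zero : (2 : ℂ) ≠ 0) h2
  rw [hsum, smul_smul, star_inv₀, RCLike.star_def, Complex.conj_ofReal, ← mul_inv, ← Complex.ofReal_mul,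
    Real.mul_self_sqrt (by positivity)]
  have : (N : ℂ) ≠ 0 := by exact_mod_cast hN.ne'
  rw [Complex.ofReal_natCast, inv_mul_cancel₀ this, one_smul]

theorem pauliX_mem : pauliX ∈ Matrix.unitaryGroup (Fin 2) ℂ := by
  rw [Matrix.mem_unitaryGroup_iff, Matrix.star_eq_conjTranspose, pauliX_conjTranspose, pauliX_mul_pauliX]

theorem pauliZ_mem : pauliZ ∈ Matrix.unitaryGroup (Fin 2) ℂ := by
  rw [Matrix.mem_unitaryGroup_iff, Matrix.star_eq_conjTranspose, pauliZ_conjTranspose, pauliZ_mul_pauliZ]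

theorem wCorrection_mem {N : ℕ} (k : Fin N) (s : Bits N) :
    wCorrection k s ∈ Matrix.unitaryGroup (Fin 2) ℂ := by
  unfold wCorrection
  split_ifs
  · exact mul_mem (pow_mem pauliX_mem _) (pow_mem pauliZ_mem _)
  · exact pow_mem pauliX_mem _
  · exact mul_mem (pow_mem pauliZ_mem _) (pow_mem pauliX_mem _)

theorem kappa_lt_two {N : ℕ} (k : Fin N) (s : Bits N) : kappa k s < 2 := Nat.mod_lt _ two_pos

theorem wCorrection_eq_of_wMessage_eq {N : ℕ} {k : Fin N} {s s' : Bits N}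
    (h : wMessage k s = wMessage k s') : wCorrection k s = wCorrection k s' := by
  have h1 := congrArg (fun n : ℕ+ => (n : ℕ)) h
  unfold wMessage at h1
  have hs := (s k).isLt
  have hs' := (s' k).isLt
  unfold wCorrection
  by_cases hk : (k : ℕ) ≤ 1
  · simp only [hk, if_true, Nat.succPNat_coe, Nat.succ.injEq] at h1
    by_cases hk0 : (k : ℕ) = 0
    · simp only [hk0, if_true, h1]
    · have hk1 : (k : ℕ) = 1 := by omega
      simp only [hk1, one_ne_zero, if_false, if_true, h1]
  · simp only [hk, if_false, Nat.succPNat_coe, Nat.succ.injEq] at h1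
    have h2 : (s k : ℕ) = s' k ∧ kappa k s = kappa k s' := by omega
    rw [if_neg (by omega), if_neg (by omega), if_neg (by omega), if_neg (by omega), h2.1, h2.2]

open Classical in
/-- The Pauli correction as a function of the message. -/
noncomputable def wRecovery {N : ℕ} (k : Fin N) (a : ℕ+) : Matrix.unitaryGroup (Fin 2) ℂ :=
  if h : ∃ s, wMessage k s = a then ⟨wCorrection k h.choose, wCorrection_mem k _⟩ else 1

theorem wRecovery_wMessage {N : ℕ} (k : Fin N) (s : Bits N) :
    (wRecovery k (wMessage k s) : Matrix (Fin 2) (Fin 2) ℂ) = wCorrection k s := by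
  have h : ∃ s', wMessage k s' = wMessage k s := ⟨s, rfl⟩
  rw [wRecovery, dif_pos h]
  exact wCorrection_eq_of_wMessage_eq h.choose_spec

/-- The explicit protocol for the W state. -/
noncomputable def wProtocol {N : ℕ} (hN : 0 < N) : Protocol N where
  U := ⟨wUnitary N, wUnitary_mem hN⟩
  msg := wMessage
  recovery := wRecovery

/-- The sign that the `k`-th node contributes to the `r`-th term. -/
def correctionSign {N : ℕ} (s : Bits N) (r k : Fin N) : ℂ :=
  if k = r then (-1) ^ kappa r s else if 1 ≤ (k : ℕ) ∧ k < r then (-1) ^ (s k : ℕ) else 1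

/-- The factors $Z$ before position `r` contribute $(-1)^{s_k}$ each. The first node cancels its own
sign by $Z^{s_1}$; the others combine to $(-1)^{\kappa_r}$, which the $Z^{\kappa_r}$ at node `r`
cancels. -/
theorem correctionSign_prod {N : ℕ} (s : Bits N) (r : Fin N) : ∏ k, correctionSign s r k = 1 := by
  have h : ∀ k, correctionSign s r k = (if k = r then (-1 : ℂ) ^ kappa r s else 1) *
      if 1 ≤ (k : ℕ) ∧ k < r then (-1) ^ (s k : ℕ) else 1 := by
    intro k
    unfold correctionSign
    by_cases h1 : k = r
    · simp [h1]
    · simp [h1]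
  simp only [h, Finset.prod_mul_distrib, Finset.prod_ite_eq', Finset.mem_univ, if_true]
  rw [← Finset.prod_filter, Finset.prod_pow_eq_pow_sum, kappa, ← neg_one_pow_eq_pow_mod_two, ← pow_add]
  exact Even.neg_one_pow ⟨_, rfl⟩

/-- The correction undoes $s_k$, so each node returns to $|0\rangle$ except node `r`, which ends in
$|1\rangle$; $Z^{\kappa_k}$ therefore acts as a sign at node `r` alone. For the first two nodes
$\kappa_k$ is an empty sum. -/
theorem correction_factor {N : ℕ} (s : Bits N) (r k : Fin N) (x : Fin 2) :
    ∑ d, wCorrection k s x d * jordanWigner r k (s k) d = correctionSign s r k * flip r k x 0 := by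
  have hκ := kappa_lt_two k s
  have hκ1 : (k : ℕ) ≤ 1 → kappa k s = 0 := by
    intro hk
    unfold kappa
    rw [Finset.sum_eq_zero, Nat.zero_mod]
    intro l hl
    simp only [Finset.mem_filter, Finset.mem_univ, true_and, Fin.lt_def] at hl
    omega
  unfold wCorrection correctionSign jordanWigner flip
  generalize s k = t at *
  rcases lt_trichotomy k r with h | h | h
  · have h2 : k ≠ r := h.ne
    simp only [h, h2, if_true, if_false, and_true]
    by_cases hk0 : (k : ℕ) = 0
    · simp only [hk0, if_true]
      fin_cases t <;> fin_cases x <;>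
        simp [pauliX, pauliZ, Matrix.mul_apply, Fin.sum_univ_two, Matrix.one_apply]
    · by_cases hk1 : (k : ℕ) = 1
      · simp only [hk1, one_ne_zero, le_refl, if_true, if_false]
        fin_cases t <;> fin_cases x <;> simp [pauliX, pauliZ, Fin.sum_univ_two, Matrix.one_apply]
      · have : 1 ≤ (k : ℕ) := by omega
        simp only [hk0, hk1, this, if_true, if_false]
        interval_cases kappa k s <;> fin_cases t <;> fin_cases x <;>
          simp [pauliX, pauliZ, Matrix.mul_apply, Fin.sum_univ_two, Matrix.one_apply]
  · subst h
    simp only [lt_irrefl, if_true, if_false]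
    by_cases hk0 : (k : ℕ) = 0
    · rw [hκ1 (by omega)]
      simp only [hk0, if_true]
      fin_cases t <;> fin_cases x <;>
        simp [pauliX, pauliZ, Matrix.mul_apply, Fin.sum_univ_two, Matrix.one_apply]
    · by_cases hk1 : (k : ℕ) = 1
      · rw [hκ1 (by omega)]
        simp only [hk1, one_ne_zero, if_true, if_false]
        fin_cases t <;> fin_cases x <;> simp [pauliX, Fin.sum_univ_two, Matrix.one_apply]
      · simp only [hk0, hk1, if_false]
        interval_cases kappa k s <;> fin_cases t <;> fin_cases x <;>
          simp [pauliX, pauliZ, Matrix.mul_apply, Fin.sum_univ_two, Matrix.one_apply]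
  · have h2 : k ≠ r := h.ne'
    have h3 : ¬ k < r := h.le.not_gt
    simp only [h2, h3, if_false, and_false]
    have hk0 : (k : ℕ) ≠ 0 := by
      have := Fin.lt_def.1 h
      omega
    by_cases hk1 : (k : ℕ) = 1
    · simp only [hk1, one_ne_zero, if_true, if_false]
      fin_cases t <;> fin_cases x <;> simp [pauliX, Matrix.one_apply]
    · simp only [hk0, hk1, if_false]
      interval_cases kappa k s <;> fin_cases t <;> fin_cases x <;>
        simp [pauliX, pauliZ, Matrix.mul_apply, Fin.sum_univ_two, Matrix.one_apply]

theorem wProtocol_endState {N : ℕ} (hN : 0 < N) (s : Bits N) : endState (wProtocol hN) s = wState N := by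
  have hw : wState N = (((√(N : ℝ) : ℝ) : ℂ)⁻¹) • ∑ i : Fin N, tensor (flip i) *ᵥ ket 0 := rfl
  have hU : ((wProtocol hN).U : Matrix (Bits N) (Bits N) ℂ) s =
      (((√(N : ℝ) : ℝ) : ℂ)⁻¹) • ∑ r : Fin N, fun d => tensor (jordanWigner r) s d := by
    change wUnitary N s = _
    rw [wUnitary_eq]
    funext d
    simp [Matrix.sum_apply]
  have hT : (tensor fun k => ((wProtocol hN).recovery k ((wProtocol hN).msg k s) :
      Matrix (Fin 2) (Fin 2) ℂ)) = tensor fun k => wCorrection k s := by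
    congr 1
    funext k
    exact wRecovery_wMessage k s
  rw [endState, hT, hU, hw, Matrix.mulVec_smul, Matrix.mulVec_sum]
  congr 1
  refine Finset.sum_congr rfl fun r _ => ?_
  funext x
  have h1 : (tensor (flip r) *ᵥ ket 0) x = ∏ k, flip r k (x k) 0 := by
    rw [ket, Matrix.mulVec_single_one]
    rfl
  rw [h1, Matrix.mulVec, dotProduct]
  simp only [tensor, Matrix.of_apply, ← Finset.prod_mul_distrib]
  rw [← one_mul (∏ k, flip r k (x k) 0), ← correctionSign_prod s r, ← Finset.prod_mul_distrib,
    ← Finset.prod_congr rfl (fun k _ => correction_factor s r k (x k)), Finset.prod_univ_sum,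
    Fintype.piFinset_univ]

theorem wProtocol_branch {N : ℕ} (hN : 0 < N) (s : Bits N) :
    (wProtocol hN).branch s = ((1 / 2 ^ N : ℝ) : ℂ) • pure (wState N) := by
  rw [branch_eq, wProtocol_endState]

theorem wProtocol_distributes {N : ℕ} (hN : 0 < N) :
    (wProtocol hN).Distributes (pure (wState N)) := by
  rw [Protocol.Distributes, Protocol.output]
  simp only [wProtocol_branch]
  rw [Finset.sum_const, ← Nat.cast_smul_eq_nsmul ℂ, smul_smul]
  simp

theorem sup_wMessage {N : ℕ} (k : Fin N) :
    (Finset.univ.sup fun s => (wMessage k s : ℕ)) = if (k : ℕ) ≤ 1 then 2 else 4 := by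
  apply le_antisymm
  · refine Finset.sup_le fun s _ => ?_
    have h1 := (s k).isLt
    have h2 := kappa_lt_two k s
    unfold wMessage
    split_ifs <;> simp only [Nat.succPNat_coe] <;> omega
  · by_cases hk : (k : ℕ) ≤ 1
    · rw [if_pos hk]
      refine le_trans ?_ (Finset.le_sup (f := fun s => (wMessage k s : ℕ)) (Finset.mem_univ fun _ => 1))
      simp [wMessage, hk]
    · rw [if_neg hk]
      have hk1 : 1 < N := by have := k.isLt; omega
      -- Ones at the second node and at node `k` make both $\kappa_k$ and $s_k$ equal to 1, which
      -- gives the largest message 4.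
      have hκ : kappa k (fun l => if (l : ℕ) = 1 ∨ l = k then 1 else 0) = 1 := by
        unfold kappa
        rw [Finset.sum_eq_single (⟨1, hk1⟩ : Fin N)]
        · simp
        · intro l hl hl1
          simp only [Finset.mem_filter, Finset.mem_univ, true_and] at hl
          have : (l : ℕ) ≠ 1 := fun e => hl1 (Fin.ext e)
          simp [this, hl.2.ne]
        · intro hn
          refine absurd ?_ hn
          simp only [Finset.mem_filter, Finset.mem_univ, true_and, le_refl]
          exact Fin.mk_lt_of_lt_val (by omega)
      refine le_trans ?_ (Finset.le_sup (f := fun s => (wMessage k s : ℕ))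
        (Finset.mem_univ fun l : Fin N => if (l : ℕ) = 1 ∨ l = k then 1 else 0))
      simp [wMessage, hk, hκ]

theorem wProtocol_cost {N : ℕ} (hN : 2 ≤ N) (h0 : 0 < N) : (wProtocol h0).cost = 2 * (N : ℝ) - 2 := by
  obtain ⟨n, rfl⟩ := Nat.exists_eq_add_of_le' hN
  have h : (∏ k : Fin (n + 2), Finset.univ.sup fun s => (((wProtocol h0).msg k s : ℕ+) : ℕ)) =
      2 ^ (2 * n + 2) := by
    change (∏ k : Fin (n + 2), Finset.univ.sup fun s => (wMessage k s : ℕ)) = _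
    simp only [sup_wMessage]
    rw [Fin.prod_univ_succ, Fin.prod_univ_succ]
    simp only [Fin.val_succ, Fin.val_zero, zero_le_one, if_true, zero_add, le_refl]
    rw [Finset.prod_congr rfl (g := fun _ => 4) (fun i _ => if_neg (by omega))]
    simp only [Finset.prod_const, Finset.card_univ, Fintype.card_fin]
    rw [pow_add, pow_mul]
    norm_num
    ring
  rw [Protocol.cost, h]
  push_cast
  rw [Real.logb_pow, Real.logb_self_eq_one (by norm_num)]
  push_cast
  ring

end CentralHub

/-- For `N ≥ 2` the explicit protocol (unitary `U_N`, computational-basis measurement, Pauli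
corrections) yields the W state on every outcome, each of probability `2^{-N}`, at a cost of
`2N - 2` bits; and `2N - 2` is the least cost of all protocols that distribute the W state. -/
theorem proposition1 (N : ℕ) (hN : 2 ≤ N) :
    (∃ P : CentralHub.Protocol N,
      (P.U : Matrix (CentralHub.Bits N) (CentralHub.Bits N) ℂ) = CentralHub.wUnitary N ∧
      P.msg = CentralHub.wMessage ∧
      (∀ (k : Fin N) (s : CentralHub.Bits N),
        (P.recovery k (P.msg k s) : Matrix (Fin 2) (Fin 2) ℂ) = CentralHub.wCorrection k s) ∧
      (∀ s : CentralHub.Bits N,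
        P.branch s = ((1 / 2 ^ N : ℝ) : ℂ) • CentralHub.pure (CentralHub.wState N)) ∧
      P.Distributes (CentralHub.pure (CentralHub.wState N)) ∧
      P.cost = 2 * (N : ℝ) - 2) ∧
    IsLeast {c : ℝ | ∃ P : CentralHub.Protocol N,
      P.Distributes (CentralHub.pure (CentralHub.wState N)) ∧ P.cost = c} (2 * (N : ℝ) - 2) := by
  have h0 : 0 < N := by omega
  refine ⟨⟨CentralHub.wProtocol h0, rfl, rfl, CentralHub.wRecovery_wMessage,
    CentralHub.wProtocol_branch h0, CentralHub.wProtocol_distributes h0,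
    CentralHub.wProtocol_cost hN h0⟩, ⟨CentralHub.wProtocol h0, CentralHub.wProtocol_distributes h0,
    CentralHub.wProtocol_cost hN h0⟩, ?_⟩
  rintro c ⟨P, hP, rfl⟩
  exact CentralHub.le_cost hN P hP
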